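/- **Setting.** Let $\mathfrak g$ be a finite-dimensional real Lie algebra of compact type with basis $\xi_a$ and totally antisymmetric real structure constants, $i[\xi_a,\xi_b]=\sum_c f_{abc}\xi_c$ (physicists' convention: $\xi_a$ is hermitean in unitary representations, the Lie bracket is $i[\cdot,\cdot]$), and $\langle\xi_a|\xi_b\rangle=\delta_{ab}$. Minkowski space $\mathbb R^{1,3}$ has the metric $\eta=\mathrm{diag}(1,-1,-1,-1)$. Let $c^\mu$ be a real vector-valued distribution on $\mathbb R^{1,3}$ with $\partial_\mu c^\mu=\delta$, supported in a closed convex salient spacelike cone $C$ (the string), and $(I_c^\mu f)(x)=\int d^4y\,c^\mu(y)f(x+y)$ the string integration, so that $I_c^\mu\partial_\mu f=-f$. Let $A_\mu=\sum_aA_\mu^a\xi_a$ be the free massless gauge potential ($\square A_\mu=0$, Feynman gauge), $F_{\mu\nu}=\partial_\mu A_\nu-\partial_\nu A_\mu$, $N=\partial^\mu A_\mu$ (so that $\partial^\mu F_{\mu\nu}=-\partial_\nu N$), $A_\mu(c)=I_c^\nu F_{\mu\nu}$ and $K_0=-\tfrac14\langle F^{\mu\nu}|F_{\mu\nu}\rangle$.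 All products are (commutative) Wick products, that is, fields are identified with the classical functionals of the field configuration. Write $\mathrm{ad}_{is}(v)=i[s,v]$. Let $\mathcal S^{\mathfrak g}$ be the smallest space of $\mathfrak g$-valued scalar fields that contains $I_c^\nu(\mathrm{ad}_{is_k}\cdots\mathrm{ad}_{is_1}(A_\nu))$ $(k\ge0)$ and $I_c^\nu(\mathrm{ad}_{is_k}\cdots\mathrm{ad}_{is_1}(\partial_\nu s_0))$ $(k\ge1)$ whenever it contains $s_0,\dots,s_k$, and let $\mathcal V^{\mathfrak g}$ be the space of $\mathfrak g$-valued vector fields spanned by $\mathrm{ad}_{is_k}\cdots\mathrm{ad}_{is_1}(A_\nu)$ and $\mathrm{ad}_{is_k}\cdots\mathrm{ad}_{is_1}(\partial_\nu s_0)$ with $k\ge0$ and $s_0,\dots,s_k\in\mathcal S^{\mathfrak g}$. For a vector field $U^\mu$, the (tree-level) obstruction map is $$\omega_U(X)(x)=i\int dx'\,O_\mu(U^\mu(x'),X(x)),\qquad O_\mu(Y(x'),X(x))=\sum_{\chi,\varphi}\frac{\partial Y}{\partial\chi}(x')\,\frac{\partial X}{\partial\varphi}(x)\,O_\mu(\chi(x'),\varphi(x)),$$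 $$O_\mu(\chi(x'),\varphi(x))=\langle T\,\partial'_\mu\chi(x')\,\varphi(x)\rangle-\partial'_\mu\langle T\,\chi(x')\,\varphi(x)\rangle ,$$ with the following conventions. The propagators are (up to $\delta_{ab}$) $\langle TA'_\mu A_\kappa\rangle=-\eta_{\mu\kappa}T_0$, $\langle TN'A_\kappa\rangle=-\partial'_\kappa T_0$, $\langle TA'_\mu N\rangle=\partial'_\mu T_0$, $\langle TN'N\rangle=0$, where $T_0=T_0(x'-x)$ and $\square T_0=-i\delta$. In the first term of $O_\mu(\chi',\varphi)$, the derivative $\partial_\mu\chi$ is taken subject to the field equations $\partial^\mu F_{\mu\nu}=-\partial_\nu N$, $\partial_{\mu}A_{\nu}-\partial_\nu A_\mu=F_{\mu\nu}$, $\partial^\mu A_\mu=N$. In the second entry, $O_\mu(Y',\cdot)$ commutes with derivatives and string integrals of $A$ and $N$ (with $N$ kept as a separate field). The elements $s\in\mathcal S^{\mathfrak g}$ are inert in the first entry, $O_\mu(s(x'),X(x))=0$, hence $O_\mu(\partial'_\nu s(x'),X(x))$ is symmetric in $\mu,\nu$; its values are otherwise an arbitrary choice of renormalization. **Proposition (YM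 dressing).** There are formal power series $\alpha_\nu\in g\,\mathcal V^{\mathfrak g}[[g]]$ and $\gamma\in g\,\mathcal S^{\mathfrak g}[[g]]$ in the coupling constant $g$ such that, for every such choice of renormalization, the mediator field $U^\mu=\langle F^{\mu\nu}|\alpha_\nu\rangle$ has the following properties. (i) Let $W=e^{i\gamma}$ and $W^{-1}=e^{-i\gamma}$, understood in any finite-dimensional representation of $\mathfrak g$ by hermitean matrices. Then $WW^{-1}=W^{-1}W=1$ with respect to the Wick product, $W$ is string-localized (for every $\varepsilon>0$, $W(x)$ depends on $A$ only in the $\varepsilon$-neighbourhood of $x+C$), and the flow $e^{\omega_U}$ generates the dressing transformations $$e^{\omega_U}(A_\mu(c))=W\big(A_\mu+ig^{-1}\partial_\mu\big)W^{-1}=WA_\mu W^{-1}+ig^{-1}W\,\partial_\mu(W^{-1}),$$ $$e^{\omega_U}(F_{\mu\nu})=\partial_\mu e^{\omega_U}(A_\nu(c))-\partial_\nu e^{\omega_U}(A_\mu(c)).$$ (ii) $\omega_U(N)=\omega_U(\partial_\kappa N)=0$, and, by the field equations, $$\partial_\mu U^\mu+\omega_U(K_0)=-\langle\partial^\nu N|\alpha_\nu\rangle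 .$$ -/

import Mathlib

open scoped Distributions LineDeriv ContDiff

noncomputable section

namespace StringYM

/-! ### Minkowski spacetime -/

/-- Minkowski spacetime with its coordinates `x 0` (time), `x 1, x 2, x 3` (space). -/
abbrev Spacetime := Fin 4 → ℝ

/-- The diagonal entries of the metric `diag(1,-1,-1,-1)`; lower and upper metric coincide. -/
def sgn (μ : Fin 4) : ℝ := if μ = 0 then 1 else -1

/-- The metric `η_{μν}`. -/
def metric (μ ν : Fin 4) : ℝ := if μ = ν then sgn μ else 0

/-- The coordinate vector in direction `μ`. -/
abbrev coordVec (μ : Fin 4) : Spacetime := Pi.single μ 1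

/-- The Euclidean length of the spatial part. -/
def spaceNorm (x : Spacetime) : ℝ := Real.sqrt (∑ i : Fin 3, x i.succ ^ 2)

/-- The partial derivative `∂_μ f`. -/
def pd {E : Type*} [NormedAddCommGroup E] [NormedSpace ℝ E] (μ : Fin 4) (f : Spacetime → E) :
    Spacetime → E :=
  fun x => fderiv ℝ f x (coordVec μ)

/-- The iterated derivative `∂^m f`. -/
def iterPd (m : Fin 4 →₀ ℕ) (f : Spacetime → ℝ) : Spacetime → ℝ :=
  (pd 0)^[m 0] ((pd 1)^[m 1] ((pd 2)^[m 2] ((pd 3)^[m 3] f)))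

/-! ### String integration -/

/-- A string function: a real vector-valued distribution `c^μ` with `∂_μ c^μ = δ`, supported in a
closed convex salient spacelike cone with apex `0` (the "string"). -/
structure StringFunction where
  /-- the cone that contains the support -/
  cone : Set Spacetime
  isClosed_cone : IsClosed cone
  convex_cone : Convex ℝ cone
  zero_mem : (0 : Spacetime) ∈ cone
  smul_mem : ∀ t : ℝ, 0 ≤ t → ∀ y ∈ cone, t • y ∈ cone
  spacelike : ∀ y ∈ cone, y ≠ 0 → |y 0| < spaceNorm y
  salient : ∀ y ∈ cone, -y ∈ cone → y = 0
  /-- the components `c^μ` -/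
  c : Fin 4 → 𝓓'((⊤ : TopologicalSpace.Opens Spacetime), ℝ)
  supported : ∀ μ, Distribution.IsVanishingOn (c μ) coneᶜ
  div_eq_delta : ∑ μ, ∂_{coordVec μ} (c μ) = Distribution.delta 0

open Classical in
/-- The value `∫ d⁴y c^μ(y) f(y)` of the distribution `c^μ` on a function `f` whose support meets
the cone in a compact set: the value on any test function that agrees with `f` near the cone. -/
def StringFunction.pair (c : StringFunction) (μ : Fin 4) (f : Spacetime → ℝ) : ℝ :=
  if h : ∃ φ : 𝓓((⊤ : TopologicalSpace.Opens Spacetime), ℝ),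
      Disjoint c.cone (tsupport (f - ⇑φ)) then c.c μ h.choose else 0

/-- String integration `(I_c^μ f)(x) = ∫ d⁴y c^μ(y) f(x + y)`. -/
def stringInt (c : StringFunction) (μ : Fin 4) (f : Spacetime → ℝ) : Spacetime → ℝ :=
  fun x => c.pair μ (fun y => f (x + y))

/-! ### Field configurations and fields -/

/-- Configurations `(A_μ^a, N^a)` of the gauge potential and of the null field. As in the
time-ordered products, `N` is kept as an independent field off shell; `N = ∂^μ A_μ` is one of the
field equations. -/
abbrev Conf (ι : Type*) := (Fin 4 → ι → Spacetime → ℝ) × (ι → Spacetime → ℝ)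

/-- Hermitean fields, realized as functionals of the classical configuration with values in
functions on spacetime; the Wick product is the pointwise product. -/
abbrev QField (ι : Type*) := Conf ι → Spacetime → ℝ

/-- Smooth functions supported in `J(B_R) - C`, where `J(B_R)` is the causal influence region of a
ball and `C` is the cone of the string. This class contains all smooth functions of spacelike
compact support, and products, derivatives and string integrals of its members. -/
def Admissible (c : StringFunction) (f : Spacetime → ℝ) : Prop :=
  ContDiff ℝ ∞ f ∧
    ∃ R : ℝ, ∀ x, f x ≠ 0 → ∃ y ∈ c.cone, spaceNorm (x + y) ≤ |(x + y) 0| + R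

/-- Off-shell configurations. -/
def configs (ι : Type*) (c : StringFunction) : Set (Conf ι) :=
  {Φ | (∀ μ a, Admissible c (Φ.1 μ a)) ∧ ∀ a, Admissible c (Φ.2 a)}

/-- On-shell configurations: `□ A_μ = 0` and `N = ∂^μ A_μ`. -/
def onShell (ι : Type*) (c : StringFunction) : Set (Conf ι) :=
  {Φ | Φ ∈ configs ι c ∧
    (∀ μ a x, ∑ ν, sgn ν * pd ν (pd ν (Φ.1 μ a)) x = 0) ∧
    ∀ a x, Φ.2 a x = ∑ μ, sgn μ * pd μ (Φ.1 μ a) x}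

variable {ι : Type*}

/-- The derivative `∂_μ X` of a (real or complex) field. -/
def fieldPd {E : Type*} [NormedAddCommGroup E] [NormedSpace ℝ E] (μ : Fin 4)
    (X : Conf ι → Spacetime → E) : Conf ι → Spacetime → E :=
  fun Φ => pd μ (X Φ)

/-- The string integral `I_c^μ X` of a field. -/
def fieldInt (c : StringFunction) (μ : Fin 4) (X : QField ι) : QField ι :=
  fun Φ => stringInt c μ (X Φ)

/-- The gauge potential `A_μ^a` (lower index). -/
def fieldA (μ : Fin 4) (a : ι) : QField ι := fun Φ => Φ.1 μ a

/-- The null field `N^a`. -/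
def fieldN (a : ι) : QField ι := fun Φ => Φ.2 a

/-- The field strength `F_{μν} = ∂_μ A_ν - ∂_ν A_μ` (lower indices). -/
def fieldF (μ ν : Fin 4) (a : ι) : QField ι :=
  fieldPd μ (fieldA ν a) - fieldPd ν (fieldA μ a)

/-- The string-localized potential `A_μ(c) = I_c^ν F_{μν}`. -/
def fieldAc (c : StringFunction) (μ : Fin 4) (a : ι) : QField ι :=
  ∑ ν, fieldInt c ν (fieldF μ ν a)

/-- The free Lagrangian density `K₀ = -¼ ⟨F^{μν}|F_{μν}⟩`. -/
def fieldK0 [Fintype ι] : QField ι :=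
  (-(1 / 4) : ℝ) • ∑ μ, ∑ ν, ∑ a, (sgn μ * sgn ν) • (fieldF μ ν a * fieldF μ ν a)

/-! ### The Lie algebra and the subspaces `𝒮` and `𝒱` -/

/-- The structure constants: `⁅ξ_a, ξ_b⁆ = ∑_k f_{abk} ξ_k`. The bracket of the Lie algebra is
`i[·,·]` in the physicists' convention. -/
def strConst {𝔤 : Type*} [LieRing 𝔤] [LieAlgebra ℝ 𝔤] (ξ : Module.Basis ι ℝ 𝔤) (a b k : ι) : ℝ :=
  ξ.repr ⁅ξ a, ξ b⁆ k

/-- `ad_{is}(v) = i[s,v]` for Lie-algebra-valued elements `s = ∑ s_a ξ_a`, `v = ∑ v_a ξ_a` with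
components in a commutative algebra. -/
def adField [Fintype ι] {R : Type*} [CommRing R] [Algebra ℝ R] (f : ι → ι → ι → ℝ) (s v : ι → R) :
    ι → R :=
  fun k => ∑ a, ∑ b, f a b k • (s a * v b)

/-- `ad_{is_k} ⋯ ad_{is_1}(v)` for the list `[s_k, …, s_1]`. -/
def adList [Fintype ι] {R : Type*} [CommRing R] [Algebra ℝ R] (f : ι → ι → ι → ℝ)
    (l : List (ι → R)) (v : ι → R) : ι → R :=
  l.foldr (adField f) v

/-- The space `𝒮` of Lie-algebra-valued scalar fields: the smallest subspace that contains
`I_c^ν(ad_{is_k} ⋯ ad_{is_1}(A_ν))` (`k ≥ 0`) and `I_c^ν(ad_{is_k} ⋯ ad_{is_1}(∂_ν s_0))`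
(`k ≥ 1`) whenever it contains `s_0, …, s_k`. -/
def spaceS [Fintype ι] (f : ι → ι → ι → ℝ) (c : StringFunction) : Submodule ℝ (ι → QField ι) :=
  sInf {p | (∀ l : List (ι → QField ι), (∀ s ∈ l, s ∈ p) →
        (fun a => ∑ ν, fieldInt c ν (adList f l (fieldA ν) a)) ∈ p) ∧
      ∀ l : List (ι → QField ι), l ≠ [] → (∀ s ∈ l, s ∈ p) → ∀ s₀ ∈ p,
        (fun a => ∑ ν, fieldInt c ν (adList f l (fun b => fieldPd ν (s₀ b)) a)) ∈ p}

/-- The generators with respect to which fields are contracted, when they are the first entry of an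
obstruction: `F_{μν}`, `A_ν`, `N`, the elements `s` of `𝒮`, and their derivatives `∂_ν s`. -/
inductive Letter (ι : Type*) (S : Submodule ℝ (ι → QField ι))
  | F (μ ν : Fin 4) (a : ι)
  | A (ν : Fin 4) (a : ι)
  | N (a : ι)
  | s (σ : S) (a : ι)
  | ds (ν : Fin 4) (σ : S) (a : ι)

/-- Wick polynomials in the generators. -/
abbrev Wick [Fintype ι] (f : ι → ι → ι → ℝ) (c : StringFunction) :=
  MvPolynomial (Letter ι (spaceS f c)) ℝ

/-- The field that a generator stands for. -/
def Letter.toField {S : Submodule ℝ (ι → QField ι)} : Letter ι S → QField ι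
  | .F μ ν a => fieldF μ ν a
  | .A ν a => fieldA ν a
  | .N a => fieldN a
  | .s σ a => σ.1 a
  | .ds ν σ a => fieldPd ν (σ.1 a)

/-- The field that a Wick polynomial stands for. -/
def wickField [Fintype ι] {f : ι → ι → ι → ℝ} {c : StringFunction} : Wick f c →ₐ[ℝ] QField ι :=
  MvPolynomial.aeval Letter.toField

/-- The space `𝒱` of Lie-algebra-valued vector fields (lower index): it is spanned by
`ad_{is_k} ⋯ ad_{is_1}(A_ν)` and `ad_{is_k} ⋯ ad_{is_1}(∂_ν s_0)` with `k ≥ 0` and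
`s_0, …, s_k ∈ 𝒮`. -/
def spaceV [Fintype ι] (f : ι → ι → ι → ℝ) (c : StringFunction) :
    Submodule ℝ (Fin 4 → ι → Wick f c) :=
  Submodule.span ℝ
    ({v | ∃ l : List (spaceS f c), v = fun ν =>
        adList f (l.map fun σ a => MvPolynomial.X (Letter.s σ a))
          (fun a => MvPolynomial.X (Letter.A ν a))} ∪
     {v | ∃ (l : List (spaceS f c)) (σ₀ : spaceS f c), v = fun ν =>
        adList f (l.map fun σ a => MvPolynomial.X (Letter.s σ a))
          (fun a => MvPolynomial.X (Letter.ds ν σ₀ a))})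

/-! ### Propagators and two-point obstructions

Let `T₀` be the time-ordered two-point function of the massless scalar field, `□ T₀ = -iδ`.
A polynomial `p` in four variables stands for the distribution `p(∂') T₀(x' - x)`. -/

/-- Polynomials in the derivatives `∂'_μ`. -/
abbrev DiffPoly := MvPolynomial (Fin 4) ℝ

/-- The wave operator. -/
def box : DiffPoly := ∑ μ, MvPolynomial.C (sgn μ) * MvPolynomial.X μ ^ 2

/-- Off-shell linear fields (of a given colour): `(p, q)` stands for `∑_ν p_ν(∂) A_ν + q(∂) N`. -/
abbrev LinField := (Fin 4 → DiffPoly) × DiffPoly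

/-- The linear field `A_ν`. -/
def linA (ν : Fin 4) : LinField := (Pi.single ν 1, 0)

/-- The linear field `N`. -/
def linN : LinField := (0, 1)

/-- The derivative `∂_μ` of a linear field. -/
def linPd (μ : Fin 4) (χ : LinField) : LinField := (MvPolynomial.X μ : DiffPoly) • χ

/-- The linear field `F_{μν} = ∂_μ A_ν - ∂_ν A_μ`. -/
def linF (μ ν : Fin 4) : LinField := linPd μ (linA ν) - linPd ν (linA μ)

/-- The combination `-∂_ν N - ∂^μ F_{μν}`, which vanishes by the field equations. -/
def linGauss (ν : Fin 4) : LinField := -linPd ν linN - ∑ μ, sgn μ • linPd μ (linF μ ν)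

/-- The combination `N - ∂^μ A_μ`, which vanishes by the field equations. -/
def linNull : LinField := linN - ∑ μ, sgn μ • linPd μ (linA μ)

/-- The linear fields among which the second entry of a propagator is chosen. -/
inductive Base (ι : Type*)
  | A (κ : Fin 4) (b : ι)
  | N (b : ι)

/-- The colour index. -/
def Base.colour : Base ι → ι
  | .A _ b => b
  | .N b => b

/-- The propagators `⟨T χ(x') φ(x)⟩` (without the factor `δ_{ab}`), which are determined by
`⟨T A'_ν A_κ⟩ = -η_{νκ} T₀`, `⟨T N' A_κ⟩ = -∂'_κ T₀`, `⟨T A'_ν N⟩ = ∂'_ν T₀`, `⟨T N' N⟩ = 0`. -/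
def propagator (χ : LinField) : Base ι → DiffPoly
  | .A κ _ => -(MvPolynomial.C (sgn κ) * χ.1 κ) - χ.2 * MvPolynomial.X κ
  | .N _ => ∑ ν, χ.1 ν * MvPolynomial.X ν

/-- The two-point obstruction `⟨T [∂'_μ χ'] φ⟩ - ∂'_μ ⟨T χ' φ⟩`, where `dχ` is the representative
of `∂_μ χ` that is subject to the field equations. -/
def obstruction (μ : Fin 4) (χ dχ : LinField) (φ : Base ι) : DiffPoly :=
  propagator dχ φ - MvPolynomial.X μ * propagator χ φ

/-- The representative of `∂_μ F_{κλ}`: Lorentz covariant, equal to `∂_μ F_{κλ}` on shell, with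
vanishing cyclic sum and with `∂^μ F_{μν} = -∂_ν N`. -/
def redF (μ κ l : Fin 4) : LinField :=
  linPd μ (linF κ l) + (1 / 3 : ℝ) • (metric μ κ • linGauss l - metric μ l • linGauss κ)

/-- The representative of `∂_μ A_ν`: Lorentz covariant, equal to `∂_μ A_ν` on shell, with
`∂_μ A_ν - ∂_ν A_μ = F_{μν}` and with `∂^μ A_μ = N`. -/
def redA (μ ν : Fin 4) : LinField :=
  linPd μ (linA ν) + ((1 / 4 : ℝ) * metric μ ν) • linNull

open Classical in
/-- For `p = □ q`, the polynomial `q`, so that `i p(∂') T₀(x' - x) = q(∂') δ(x' - x)`. -/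
def deltaCoeff (p : DiffPoly) : DiffPoly := if h : box ∣ p then h.choose else 0

/-- `∫ dx' Z(x') q(∂') δ(x' - x) = (q(-∂) Z)(x)`. -/
def smear (q : DiffPoly) (Z : Spacetime → ℝ) : Spacetime → ℝ :=
  fun x => ∑ m ∈ q.support, (-1) ^ (m.degree) * q.coeff m * iterPd m Z x

/-- The freedom in the time-ordered products of the second derivatives of `s ∈ 𝒮`. As `s` is
inert, `T ∂'_ν s' · X = ∂'_ν T s' · X`, and `val σ μ ν a φ Φ Z` stands for
`i ∫ dx' Z(x') (T ∂'_μ ∂'_ν s'_a · φ - ∂'_μ ∂'_ν T s'_a · φ)` at the configuration `Φ`.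
It is symmetric because derivatives commute, and otherwise arbitrary. -/
structure Renormalization (ι : Type*) (S : Submodule ℝ (ι → QField ι)) where
  /-- the kernels, smeared in `x'` -/
  val : S → Fin 4 → Fin 4 → ι → Base ι → Conf ι → (Spacetime → ℝ) →ₗ[ℝ] (Spacetime → ℝ)
  symm : ∀ σ μ ν a φ Φ, val σ μ ν a φ Φ = val σ ν μ a φ Φ

open Classical in
/-- `i ∫ dx' Z(x') O_μ(χ(x'), φ(x))` for the generators `χ`. The elements of `𝒮` are inert. -/
def contract {S : Submodule ℝ (ι → QField ι)} (τ : Renormalization ι S) (μ : Fin 4)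
    (φ : Base ι) (Φ : Conf ι) (Z : Spacetime → ℝ) : Letter ι S → Spacetime → ℝ
  | .F κ l a =>
      if a = φ.colour then smear (deltaCoeff (obstruction μ (linF κ l) (redF μ κ l) φ)) Z else 0
  | .A ν a =>
      if a = φ.colour then smear (deltaCoeff (obstruction μ (linA ν) (redA μ ν) φ)) Z else 0
  | .N a =>
      if a = φ.colour then smear (deltaCoeff (obstruction μ linN (linPd μ linN) φ)) Z else 0
  | .s _ _ => 0
  | .ds ν σ a => τ.val σ μ ν a φ Φ Z

/-! ### The obstruction map and its flow -/

section Flow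

variable [Fintype ι] {f : ι → ι → ι → ℝ} {c : StringFunction}

/-- `i ∫ dx' O_μ(U^μ(x'), φ(x)) = i ∫ dx' ∑_χ (∂U^μ/∂χ)(x') O_μ(χ(x'), φ(x))`. -/
def variation (τ : Renormalization ι (spaceS f c)) (U : Fin 4 → Wick f c) (φ : Base ι) :
    QField ι :=
  fun Φ => ∑ μ, ∑ χ ∈ (U μ).vars, contract τ μ φ Φ (wickField (MvPolynomial.pderiv χ (U μ)) Φ) χ

/-- The obstruction map `ω_U(X)(x) = i ∫ dx' O_μ(U^μ(x'), X(x))`. The sum over the contractions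
`∂X/∂φ` in the second entry is the functional derivative of `X`. -/
def omega (τ : Renormalization ι (spaceS f c)) (U : Fin 4 → Wick f c) (X : QField ι) : QField ι :=
  fun Φ x => deriv (fun t : ℝ => X (Φ + t • ((fun μ a => variation τ U (.A μ a) Φ,
    fun a => variation τ U (.N a) Φ) : Conf ι)) x) 0

/-- The obstruction map on power series in `g`, for `U = ∑ gⁿ U_n`. -/
def omegaSeries (τ : Renormalization ι (spaceS f c)) (U : ℕ → Fin 4 → Wick f c)
    (Y : PowerSeries (QField ι)) : PowerSeries (QField ι) :=
  PowerSeries.mk fun n => ∑ p ∈ Finset.HasAntidiagonal.antidiagonal n, omega τ (U p.1) (PowerSeries.coeff p.2 Y)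

/-- The flow `e^{ω_U}` for `U = O(g)`: then `ω_U^k` does not contribute to the order `n < k`. -/
def expOmega (τ : Renormalization ι (spaceS f c)) (U : ℕ → Fin 4 → Wick f c)
    (Y : PowerSeries (QField ι)) : PowerSeries (QField ι) :=
  PowerSeries.mk fun n => ∑ k ∈ Finset.range (n + 1),
    ((k.factorial : ℝ)⁻¹) • PowerSeries.coeff n ((omegaSeries τ U)^[k] Y)

/-- The mediator field `U^μ = ⟨F^{μν}|α_ν⟩`, order by order in `g`. -/
def mediator (α : ℕ → Fin 4 → ι → Wick f c) : ℕ → Fin 4 → Wick f c :=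
  fun n μ => ∑ ν, ∑ a, (sgn μ * sgn ν) • (MvPolynomial.X (Letter.F μ ν a) * α n ν a)

end Flow

/-! ### Matrix-valued fields -/

/-- A unitary representation (on the Lie algebra level) by hermitean matrices; the bracket of the
Lie algebra is represented by `i[·,·]`. -/
structure HermitianRep (𝔤 : Type*) [LieRing 𝔤] [LieAlgebra ℝ 𝔤] (d : ℕ) where
  /-- the representing matrices -/
  toFun : 𝔤 →ₗ[ℝ] Matrix (Fin d) (Fin d) ℂ
  isHermitian : ∀ x, (toFun x).IsHermitian
  map_lie : ∀ x y, toFun ⁅x, y⁆ = Complex.I • (toFun x * toFun y - toFun y * toFun x)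

/-- Matrices of complex fields, with the Wick product of the entries. -/
abbrev MatField (ι : Type*) (d : ℕ) := Matrix (Fin d) (Fin d) (Conf ι → Spacetime → ℂ)

/-- The matrix-valued power series `∑_a X_a π(ξ_a)` of a Lie-algebra-valued power series. -/
def repSeries [Fintype ι] {𝔤 : Type*} [LieRing 𝔤] [LieAlgebra ℝ 𝔤] {d : ℕ}
    (π : HermitianRep 𝔤 d) (ξ : Module.Basis ι ℝ 𝔤) (X : ι → PowerSeries (QField ι)) :
    PowerSeries (MatField ι d) :=
  PowerSeries.mk fun n => Matrix.of fun i j => fun Φ x =>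
    ∑ a, ((PowerSeries.coeff n (X a) Φ x : ℝ) : ℂ) * π.toFun (ξ a) i j

/-- The derivative of a matrix-valued power series. -/
def matPd {d : ℕ} (μ : Fin 4) (Y : PowerSeries (MatField ι d)) : PowerSeries (MatField ι d) :=
  PowerSeries.mk fun n => Matrix.of fun i j => fieldPd μ (PowerSeries.coeff n Y i j)

/-- The exponential of a power series without constant term. -/
def expSeries {R : Type*} [Ring R] [Algebra ℝ R] (Y : PowerSeries R) : PowerSeries R :=
  PowerSeries.mk fun n => ∑ k ∈ Finset.range (n + 1),
    ((k.factorial : ℝ)⁻¹) • PowerSeries.coeff n (Y ^ k)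

/-- `e^{iγ}` in the representation `π`, for `γ = ∑ gⁿ γ_n`. -/
def dressingFactor [Fintype ι] {𝔤 : Type*} [LieRing 𝔤] [LieAlgebra ℝ 𝔤] {d : ℕ}
    (π : HermitianRep 𝔤 d) (ξ : Module.Basis ι ℝ 𝔤) (γ : ℕ → ι → QField ι) :
    PowerSeries (MatField ι d) :=
  expSeries (Complex.I • repSeries π ξ fun a => PowerSeries.mk fun n => γ n a)

/-- Equality of power series of fields on all configurations in `𝒞`. -/
def EqOnConf (𝒞 : Set (Conf ι)) (Y Z : PowerSeries (QField ι)) : Prop :=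
  ∀ n, ∀ Φ ∈ 𝒞, PowerSeries.coeff n Y Φ = PowerSeries.coeff n Z Φ

/-- Equality of matrix-valued power series of fields on all configurations in `𝒞`. -/
def MatEqOnConf {d : ℕ} (𝒞 : Set (Conf ι)) (Y Z : PowerSeries (MatField ι d)) : Prop :=
  ∀ n i j, ∀ Φ ∈ 𝒞, PowerSeries.coeff n Y i j Φ = PowerSeries.coeff n Z i j Φ

/-- A matrix-valued series of fields is string-localized if, at `x`, it depends on the potential
only in arbitrarily small neighbourhoods of the string `x + C`. -/
def StringLocalized {d : ℕ} (c : StringFunction) (Y : PowerSeries (MatField ι d)) : Prop :=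
  ∀ n i j x, ∀ ε > 0, ∀ Φ ∈ configs ι c, ∀ Ψ ∈ configs ι c,
    (∀ z ∈ Metric.thickening ε ((fun y => x + y) '' c.cone), ∀ μ a, Φ.1 μ a z = Ψ.1 μ a z) →
      PowerSeries.coeff n Y i j Φ x = PowerSeries.coeff n Y i j Ψ x

end StringYM

end

/-! The proof turns the obstruction map into a functional derivative and then chooses `α` so that
the resulting flow carries the potential along a prescribed formal deformation.

Since `F` is antisymmetric and every contraction of a letter of `α` is symmetric in the two Lorentz
indices (a multiple of the metric for `A`, the symmetric renormalization freedom for `∂s`, zero for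
`s`), only the contractions of `F` itself survive in `O_μ(U^μ, ·)`. They are multiples of the delta
function, and their trace over the Lorentz index equals one. Hence `ω_U` is the derivative in the
direction `δA_ν = α_ν`, `δN = 0`, whatever the renormalization (`sum_contraction_eq_zero`,
`omega_mediator`). This already gives `ω_U(N) = 0`. It also gives the divergence formula, because
`ω_U(K₀) = -F^{μν} ∂_μ α_ν` cancels one of the two terms of `∂_μ U^μ`, and the field equation for
`F` evaluates the other.

For this derivative to be iterated inside the given spaces, `𝒮` and `𝒱` must be closed under
derivatives along `𝒱` (`exists_isDerivS`, `exists_isDerivV`). This rests on the Leibniz rule and on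
`I_c^ν ∂_ν s = -s`, which puts all string integrals of elements of `𝒱` into `𝒮`. The order `n` of
`e^{ω_U}(A)` is then `α_n` plus an element of `𝒱` made from `α_1, …, α_{n-1}`, so any deformation of
`A` with coefficients in `𝒱` is a flow (`exists_flow_eq`).

The deformation comes from the gauge transform `e^{iγ}(g A + i∂)e^{-iγ}`, which lies in the adjoint
action and so does not depend on the representation. Its order `n + 1` is `∂γ_{n+1}` plus an element
of `𝒱` that involves only lower orders of `γ`. Taking `γ_{n+1}` to be the string integral of that
element imposes the axial gauge of the string (`exists_gauge_parameter`). The deformation is `g⁻¹`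
times this transform with its order zero replaced by `A`. Because `A_μ(c) = A_μ + ∂_μ I_c^ν A_ν`,
the flow restores the missing gradient `∂_μ γ_1` at order zero and adds nothing at higher orders, so
that `A_μ(c)` is carried exactly to the gauge transform (`fieldPd_int_gaugePotential`).

The analytic basis is a class of functions on which string integrals of smooth functions are smooth
and stay in the class. Along lines of configurations all relevant fields are polynomials with
coefficients in this class, so functional derivatives are extractions of linear coefficients. -/

noncomputable section

namespace StringYM

open Metric TopologicalSpace

/-! ### Smooth dependence of a distribution on parameters -/

/-- Test functions on spacetime. -/
abbrev TestFn := 𝓓((⊤ : Opens Spacetime), ℝ)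

/-- Distributions on spacetime. -/
abbrev Distr := 𝓓'((⊤ : Opens Spacetime), ℝ)

/-- The product of a test function and a smooth function. -/
def mulTest (χ : TestFn) (g : Spacetime → ℝ) (hg : ContDiff ℝ ∞ g) : TestFn where
  toFun y := χ y * g y
  contDiff' := χ.contDiff.mul hg
  hasCompactSupport' := χ.hasCompactSupport.mul_right
  tsupport_subset' := fun _ _ => trivial

@[simp]
lemma mulTest_apply (χ : TestFn) (g : Spacetime → ℝ) (hg : ContDiff ℝ ∞ g) (y : Spacetime) :
    mulTest χ g hg y = χ y * g y := rfl

/-- The mean value inequality is used twice: for the derivative along the segment, and then for the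
function minus its linear part. Second derivatives are bounded on the ball of radius `r + 1` because
steps have length at most one. -/
lemma taylor_bound_zero {E F : Type} [NormedAddCommGroup E] [NormedSpace ℝ E] [ProperSpace E]
    [NormedAddCommGroup F] [NormedSpace ℝ F]
    (f : E → F) (hf : ContDiff ℝ ∞ f) (r : ℝ) :
    ∃ M, 0 ≤ M ∧ ∀ y, ‖y‖ ≤ r → ∀ h : E, ‖h‖ ≤ 1 →
      ‖f (y + h) - f y - fderiv ℝ f y h‖ ≤ M * ‖h‖ ^ 2 := by
  have hf' : ContDiff ℝ ∞ (fderiv ℝ f) := hf.fderiv_right (by simp)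
  have hf'' : Continuous fun z => ‖fderiv ℝ (fderiv ℝ f) z‖ :=
    continuous_norm.comp (hf'.continuous_fderiv (by simp))
  obtain ⟨M, hM⟩ := (isCompact_closedBall (0 : E) (r + 1)).exists_bound_of_continuousOn
    hf''.continuousOn
  refine ⟨|M|, abs_nonneg _, fun y hy h hh => ?_⟩
  have hseg : segment ℝ y (y + h) ⊆ closedBall (0 : E) (r + 1) := by
    refine (convex_closedBall _ _).segment_subset ?_ ?_
    · simp; linarith
    · simp only [mem_closedBall, dist_zero_right]
      exact (norm_add_le _ _).trans (by linarith)
  have hd : Differentiable ℝ f := hf.differentiable (by simp)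
  have hd' : Differentiable ℝ (fderiv ℝ f) := hf'.differentiable (by simp)
  have key : ∀ z ∈ segment ℝ y (y + h), ‖fderiv ℝ f z - fderiv ℝ f y‖ ≤ |M| * ‖h‖ := by
    intro z hz
    have h1 := (convex_segment y (y + h)).norm_image_sub_le_of_norm_fderiv_le (𝕜 := ℝ)
      (f := fderiv ℝ f) (C := |M|) (fun w _ => hd' w)
      (fun w hw => (le_abs_self _).trans ((hM w (hseg hw)).trans (le_abs_self M)))
      (left_mem_segment ℝ y (y + h)) hz
    refine h1.trans (mul_le_mul_of_nonneg_left ?_ (abs_nonneg _))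
    obtain ⟨t, ⟨ht0, ht1⟩, rfl⟩ := segment_eq_image' ℝ y (y + h) ▸ hz
    simp only [add_sub_cancel_left, norm_smul, Real.norm_eq_abs, abs_of_nonneg ht0]
    exact mul_le_of_le_one_left (norm_nonneg _) ht1
  have h2 := (convex_segment y (y + h)).norm_image_sub_le_of_norm_fderiv_le' (𝕜 := ℝ)
    (f := f) (φ := fderiv ℝ f y) (fun w _ => hd w) key
    (left_mem_segment ℝ y (y + h)) (right_mem_segment ℝ y (y + h))
  simp only [add_sub_cancel_left] at h2
  rw [pow_two, ← mul_assoc]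
  exact h2

/-- By symmetry of the second derivative, differentiating the Taylor remainder of `f` in the base
point gives the Taylor remainder of `fderiv ℝ f`. The induction therefore has to run over all target
spaces at once. -/
lemma taylor_bound {E : Type} [NormedAddCommGroup E] [NormedSpace ℝ E] [ProperSpace E] (i : ℕ) : ∀ {F : Type} [NormedAddCommGroup F] [NormedSpace ℝ F]
    (f : E → F) (_ : ContDiff ℝ ∞ f) (r : ℝ),
    ∃ M, 0 ≤ M ∧ ∀ y, ‖y‖ ≤ r → ∀ h : E, ‖h‖ ≤ 1 →
      ‖iteratedFDeriv ℝ i (fun y => f (y + h) - f y - fderiv ℝ f y h) y‖ ≤ M * ‖h‖ ^ 2 := by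
  induction i with
  | zero =>
    intro F _ _ f hf r
    simpa only [norm_iteratedFDeriv_zero] using taylor_bound_zero f hf r
  | succ i ih =>
    intro F _ _ f hf r
    have hf' : ContDiff ℝ ∞ (fderiv ℝ f) := hf.fderiv_right (by simp)
    obtain ⟨M, hM0, hM⟩ := ih (fderiv ℝ f) hf' r
    refine ⟨M, hM0, fun y hy h hh => ?_⟩
    rw [← norm_iteratedFDeriv_fderiv]
    convert hM y hy h hh using 3
    ext1 z
    have hd : Differentiable ℝ f := hf.differentiable (by simp)
    have hd' : Differentiable ℝ (fderiv ℝ f) := hf'.differentiable (by simp)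
    have h1 : HasFDerivAt (fun y => f (y + h)) (fderiv ℝ f (z + h)) z := by
      simpa [Function.comp_def] using (hd (z + h)).hasFDerivAt.comp z ((hasFDerivAt_id z).add_const h)
    have h2 : HasFDerivAt (fun y => fderiv ℝ f y h) ((fderiv ℝ (fderiv ℝ f) z).flip h) z := by
      simpa using (hd' z).hasFDerivAt.clm_apply (hasFDerivAt_const h z)
    refine ((h1.sub (hd z).hasFDerivAt).sub h2).fderiv.trans ?_
    congr 1
    ext w
    have hs : IsSymmSndFDerivAt ℝ f z :=
      hf.contDiffAt.isSymmSndFDerivAt (by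
        rw [minSmoothness_of_isRCLikeNormedField]
        exact WithTop.coe_le_coe.2 le_top)
    exact hs.eq w h

/-- On test functions supported in a fixed compact set a distribution is bounded by finitely many
seminorms, and the Leibniz rule absorbs the derivatives of `χ` into the constant. What matters is
that the constants do not depend on `g`. -/
lemma exists_bound_mulTest (T : Distr) (χ : TestFn) :
    ∃ (m : ℕ) (C : ℝ), 0 ≤ C ∧ ∀ (g : Spacetime → ℝ) (hg : ContDiff ℝ ∞ g) (M : ℝ), 0 ≤ M →
      (∀ i ≤ m, ∀ y ∈ tsupport χ, ‖iteratedFDeriv ℝ i g y‖ ≤ M) →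
      |T (mulTest χ g hg)| ≤ C * M := by
  let K : Compacts Spacetime := ⟨tsupport χ, χ.hasCompactSupport⟩
  have hK : (K : Set Spacetime) ⊆ (⊤ : Opens Spacetime) := fun _ _ => trivial
  let χK : 𝓓^{⊤}_{K}(Spacetime, ℝ) := .of_support_subset χ.contDiff subset_closure
  let L : 𝓓^{⊤}_{K}(Spacetime, ℝ) →ₗ[ℝ] ℝ :=
    { toFun := fun φ => T (TestFunction.ofSupportedIn hK φ)
      map_add' := fun φ ψ => by
        rw [← map_add]; rfl
      map_smul' := fun a φ => by
        rw [RingHom.id_apply, ← map_smul]; rfl }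
  have hL : Continuous L :=
    (ContinuousLinearMap.continuous T).comp (TestFunction.continuous_ofSupportedIn hK)
  obtain ⟨s, C, -, hC⟩ := Seminorm.bound_of_continuous
    (ContDiffMapSupportedIn.withSeminorms ℝ Spacetime ℝ ⊤ K) ((normSeminorm ℝ ℝ).comp L)
    (continuous_norm.comp hL)
  set N := fun j => ContDiffMapSupportedIn.seminorm ℝ Spacetime ℝ ⊤ K j χK with hN
  have hN0 : ∀ j, 0 ≤ N j := fun j => apply_nonneg _ _
  set B : ℝ := ∑ i ∈ s, ∑ j ∈ Finset.range (i + 1), (i.choose j : ℝ) * N j with hB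
  have hB0 : 0 ≤ B := by
    refine Finset.sum_nonneg fun i _ => Finset.sum_nonneg fun j _ => ?_
    exact mul_nonneg (Nat.cast_nonneg _) (hN0 j)
  refine ⟨s.sup id, C * B, by positivity, fun g hg M hM hgM => ?_⟩
  let φ : 𝓓^{⊤}_{K}(Spacetime, ℝ) := .of_support_subset (mulTest χ g hg).contDiff
    (fun y hy => subset_closure fun h0 => hy (by simp [h0]))
  have h1 := hC φ
  have h2 : (s.sup (ContDiffMapSupportedIn.seminorm ℝ Spacetime ℝ ⊤ K)) φ ≤ B * M := by
    refine Seminorm.finset_sup_apply_le (by positivity) fun i hi => ?_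
    rw [ContDiffMapSupportedIn.seminorm_top_le_iff ℝ (by positivity)]
    intro x hx
    have h3 : ‖iteratedFDeriv ℝ i (fun y => χ y * g y) x‖ ≤ _ :=
      norm_iteratedFDeriv_mul_le (N := ∞) χ.contDiff hg x (mod_cast le_top)
    refine h3.trans ?_
    calc _ ≤ ∑ j ∈ Finset.range (i + 1), (i.choose j : ℝ) * N j * M := by
          refine Finset.sum_le_sum fun j hj => ?_
          refine mul_le_mul (mul_le_mul_of_nonneg_left ?_ (Nat.cast_nonneg _)) ?_
            (norm_nonneg _) (mul_nonneg (Nat.cast_nonneg _) (hN0 j))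
          · exact ContDiffMapSupportedIn.norm_iteratedFDeriv_apply_le_seminorm_top ℝ (f := χK)
          · exact hgM _ ((Nat.sub_le _ _).trans (Finset.le_sup (f := id) hi)) x hx
      _ ≤ B * M := by
          rw [← Finset.sum_mul]
          refine mul_le_mul_of_nonneg_right ?_ hM
          exact Finset.single_le_sum (f := fun i => ∑ j ∈ Finset.range (i + 1),
            (i.choose j : ℝ) * N j)
            (fun i _ => Finset.sum_nonneg fun j _ => mul_nonneg (Nat.cast_nonneg _) (hN0 j)) hi
  calc |T (mulTest χ g hg)| ≤ C * (s.sup (ContDiffMapSupportedIn.seminorm ℝ Spacetime ℝ ⊤ K)) φ := h1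
    _ ≤ C * (B * M) := mul_le_mul_of_nonneg_left h2 C.2
    _ = C * B * M := by ring

/-- The regularization `x ↦ ∫ T(y) χ(y) f(x + y) dy` of the distribution `χ T`. -/
def regularize (T : Distr) (χ : TestFn) (f : Spacetime → ℝ) (hf : ContDiff ℝ ∞ f)
    (x : Spacetime) : ℝ :=
  T (mulTest χ (fun y => f (x + y)) (hf.comp (contDiff_const.add contDiff_id)))

lemma contDiff_pd {E : Type*} [NormedAddCommGroup E] [NormedSpace ℝ E] {f : Spacetime → E}
    (hf : ContDiff ℝ ∞ f) (μ : Fin 4) : ContDiff ℝ ∞ (pd μ f) :=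
  (hf.fderiv_right (m := ∞) (by simp)).clm_apply contDiff_const

lemma fderiv_apply_eq_sum_pd {E : Type*} [NormedAddCommGroup E] [NormedSpace ℝ E]
    (f : Spacetime → E) (x h : Spacetime) : fderiv ℝ f x h = ∑ μ, h μ • pd μ f x := by
  conv_lhs => rw [pi_eq_sum_univ' h]
  simp [pd, map_sum]

/-- Subtracting the candidate for the linear part leaves `T` applied to `χ` times the Taylor
remainder of `f`, and this remainder is quadratic in the increment in all the seminorms that control
`T`. -/
lemma hasFDerivAt_regularize (T : Distr) (χ : TestFn) (f : Spacetime → ℝ)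
    (hf : ContDiff ℝ ∞ f) (x : Spacetime) :
    HasFDerivAt (regularize T χ f hf)
      (∑ μ, regularize T χ (pd μ f) (contDiff_pd hf μ) x •
        (ContinuousLinearMap.proj (R := ℝ) (φ := fun _ : Fin 4 => ℝ) μ)) x := by
  obtain ⟨m, C, hC, hb⟩ := exists_bound_mulTest T χ
  obtain ⟨r, hr⟩ := χ.hasCompactSupport.isCompact.isBounded.exists_norm_le
  choose M hM0 hM using fun i => taylor_bound i f hf (‖x‖ + r)
  set MM := ∑ i ∈ Finset.range (m + 1), M i
  have key : ∀ h : Spacetime, ‖h‖ ≤ 1 →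
      |regularize T χ f hf (x + h) - regularize T χ f hf x -
        (∑ μ, regularize T χ (pd μ f) (contDiff_pd hf μ) x •
          (ContinuousLinearMap.proj (R := ℝ) (φ := fun _ : Fin 4 => ℝ) μ)) h| ≤
        C * (MM * ‖h‖ ^ 2) := by
    intro h hh
    have hg : ContDiff ℝ ∞ (fun y => f (y + h) - f y - fderiv ℝ f y h) :=
      ((hf.comp (contDiff_id.add contDiff_const)).sub hf).sub
        ((hf.fderiv_right (m := ∞) (by simp)).clm_apply contDiff_const)
    have hg' : ContDiff ℝ ∞ (fun y => (fun y => f (y + h) - f y - fderiv ℝ f y h) (y + x)) :=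
      hg.comp (contDiff_id.add contDiff_const)
    have h1 := hb _ hg' (MM * ‖h‖ ^ 2)
      (mul_nonneg (Finset.sum_nonneg fun i _ => hM0 i) (by positivity)) (fun i hi y hy => by
        rw [iteratedFDeriv_comp_add_right (f := fun y => f (y + h) - f y - fderiv ℝ f y h)]
        refine (hM i (y + x) ?_ h hh).trans ?_
        · refine (norm_add_le _ _).trans ?_
          have := hr y hy
          linarith
        · refine mul_le_mul_of_nonneg_right ?_ (by positivity)
          exact Finset.single_le_sum (fun i _ => hM0 i) (Finset.mem_range_succ_iff.2 hi))
    convert h1 using 2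
    simp only [regularize, FunLike.coe_sum, Finset.sum_apply,
      FunLike.coe_smul, Pi.smul_apply, ContinuousLinearMap.proj_apply, smul_eq_mul]
    rw [← map_sub]
    simp_rw [mul_comm _ (h _), ← smul_eq_mul (h _), ← map_smul]
    rw [← map_sum, ← map_sub]
    congr 1
    ext y
    have hs : ∀ (v : Fin 4 → TestFn), (∑ μ, v μ) y = ∑ μ, v μ y := fun v => by
      simp [Fin.sum_univ_four]
    simp only [FunLike.coe_sub, Pi.sub_apply, hs, mulTest_apply, fderiv_apply_eq_sum_pd,
      FunLike.coe_smul, Pi.smul_apply, smul_eq_mul, mul_sub, Finset.mul_sum]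
    congr 1
    · rw [add_comm y x, add_right_comm]
    · refine Finset.sum_congr rfl fun μ _ => ?_
      rw [add_comm y x]; ring
  rw [hasFDerivAt_iff_isLittleO_nhds_zero]
  refine Asymptotics.IsBigO.trans_isLittleO (g := fun h : Spacetime => ‖h‖ ^ 2) ?_ ?_
  · refine Asymptotics.IsBigO.of_bound (C * MM) ?_
    filter_upwards [Metric.closedBall_mem_nhds (0 : Spacetime) one_pos] with h hh
    have := key h (by simpa using hh)
    simpa [mul_assoc] using this
  · exact (Asymptotics.isLittleO_norm_pow_id one_lt_two)

/-- The partial derivatives of a regularization are regularizations of partial derivatives, so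
smoothness follows by induction on the order with `f` varying. -/
lemma contDiff_regularize (T : Distr) (χ : TestFn) (f : Spacetime → ℝ) (hf : ContDiff ℝ ∞ f) :
    ContDiff ℝ ∞ (regularize T χ f hf) := by
  rw [contDiff_infty]
  intro n
  induction n generalizing f with
  | zero =>
    exact contDiff_zero.2 (continuous_iff_continuousAt.2 fun x =>
      (hasFDerivAt_regularize T χ f hf x).continuousAt)
  | succ n ih =>
    rw [Nat.cast_succ, contDiff_succ_iff_hasFDerivAt]
    refine ⟨_, ?_, fun x => hasFDerivAt_regularize T χ f hf x⟩
    exact ContDiff.sum fun μ _ => (ih _ (contDiff_pd hf μ)).smul contDiff_const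

lemma pd_regularize (T : Distr) (χ : TestFn) (f : Spacetime → ℝ) (hf : ContDiff ℝ ∞ f)
    (μ : Fin 4) : pd μ (regularize T χ f hf) = regularize T χ (pd μ f) (contDiff_pd hf μ) := by
  ext x
  rw [pd, (hasFDerivAt_regularize T χ f hf x).fderiv]
  simp [Pi.single_apply]

end StringYM

end

noncomputable section

namespace StringYM

open Metric TopologicalSpace Filter Topology

/-! ### The geometry of the string -/

lemma spaceNorm_eq (x : Spacetime) :
    spaceNorm x = ‖(WithLp.toLp 2 (fun i : Fin 3 => x i.succ) : EuclideanSpace ℝ (Fin 3))‖ := by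
  simp [spaceNorm, EuclideanSpace.norm_eq]

lemma continuous_spaceNorm : Continuous spaceNorm := by
  unfold spaceNorm; fun_prop

lemma spaceNorm_add_le (x y : Spacetime) : spaceNorm (x + y) ≤ spaceNorm x + spaceNorm y := by
  simp only [spaceNorm_eq]
  exact norm_add_le (WithLp.toLp 2 (fun i : Fin 3 => x i.succ) : EuclideanSpace ℝ (Fin 3))
    (WithLp.toLp 2 (fun i : Fin 3 => y i.succ))

lemma spaceNorm_neg (x : Spacetime) : spaceNorm (-x) = spaceNorm x := by
  simp [spaceNorm]

lemma spaceNorm_smul {t : ℝ} (ht : 0 ≤ t) (x : Spacetime) : spaceNorm (t • x) = t * spaceNorm x := by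
  simp only [spaceNorm, Pi.smul_apply, smul_eq_mul, mul_pow, ← Finset.mul_sum]
  rw [Real.sqrt_mul (by positivity), Real.sqrt_sq ht]

lemma abs_coord_le (x : Spacetime) (μ : Fin 4) : |x μ| ≤ ‖x‖ := norm_le_pi_norm x μ

lemma spaceNorm_le (x : Spacetime) : spaceNorm x ≤ 2 * ‖x‖ := by
  refine Real.sqrt_le_iff.2 ⟨by positivity, ?_⟩
  have h : ∀ i : Fin 3, x i.succ ^ 2 ≤ ‖x‖ ^ 2 := fun i =>
    sq_le_sq.2 (by rw [abs_norm]; exact abs_coord_le x _)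
  calc ∑ i : Fin 3, x i.succ ^ 2 ≤ ∑ _i : Fin 3, ‖x‖ ^ 2 := Finset.sum_le_sum fun i _ => h i
    _ ≤ (2 * ‖x‖) ^ 2 := by
      simp only [Finset.sum_const, Finset.card_univ, Fintype.card_fin, nsmul_eq_mul]
      push_cast
      nlinarith [sq_nonneg ‖x‖]

variable (c : StringFunction)

lemma StringFunction.add_mem {y z : Spacetime} (hy : y ∈ c.cone) (hz : z ∈ c.cone) :
    y + z ∈ c.cone := by
  have h := c.convex_cone hy hz (by norm_num : (0 : ℝ) ≤ 1 / 2) (by norm_num : (0 : ℝ) ≤ 1 / 2)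
    (by norm_num)
  convert c.smul_mem 2 (by norm_num) _ h using 1
  rw [smul_add, smul_smul, smul_smul]; norm_num

/-- A continuous function that is positive on the unit vectors of the cone is bounded below. -/
lemma StringFunction.exists_lower_bound {q : Spacetime → ℝ} (hq : Continuous q)
    (hpos : ∀ y ∈ c.cone, ‖y‖ = 1 → 0 < q y) :
    ∃ κ > 0, ∀ y ∈ c.cone, ‖y‖ = 1 → κ ≤ q y := by
  have hK : IsCompact (c.cone ∩ sphere 0 1) := (isCompact_sphere _ _).inter_left c.isClosed_cone
  rcases (c.cone ∩ sphere 0 1).eq_empty_or_nonempty with h | h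
  · refine ⟨1, one_pos, fun y hy hy1 => ?_⟩
    have : y ∈ c.cone ∩ sphere 0 1 := ⟨hy, by simpa using hy1⟩
    simp [h] at this
  · obtain ⟨y₀, hy₀, hmin⟩ := hK.exists_isMinOn h hq.continuousOn
    exact ⟨q y₀, hpos y₀ hy₀.1 (by simpa using hy₀.2), fun y hy hy1 =>
      hmin ⟨hy, by simpa using hy1⟩⟩

/-- Compactness of the unit vectors of the closed cone makes the strict spacelike inequality
uniform, and homogeneity extends it to the whole cone. -/
lemma StringFunction.exists_spacelike_bound :
    ∃ κ > 0, ∀ y ∈ c.cone, κ * ‖y‖ ≤ spaceNorm y - |y 0| := by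
  obtain ⟨κ, hκ, h⟩ := c.exists_lower_bound (q := fun y => spaceNorm y - |y 0|)
    (continuous_spaceNorm.sub (continuous_apply 0).abs)
    (fun y hy hy1 => sub_pos.2 (c.spacelike y hy (by rintro rfl; simp at hy1)))
  refine ⟨κ, hκ, fun y hy => ?_⟩
  rcases eq_or_ne y 0 with rfl | hy0
  · simp [spaceNorm]
  · have hn : 0 < ‖y‖ := norm_pos_iff.2 hy0
    have h1 := h (‖y‖⁻¹ • y) (c.smul_mem _ (by positivity) y hy)
      (by rw [norm_smul, norm_inv, norm_norm, inv_mul_cancel₀ hn.ne'])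
    rw [spaceNorm_smul (by positivity), Pi.smul_apply, smul_eq_mul, abs_mul, abs_inv, abs_norm,
      ← mul_sub, inv_mul_eq_div, le_div_iff₀ hn] at h1
    exact h1

/-- For a unit vector `y` of the cone, `-y` lies outside the closed cone and so at positive distance
from it, uniformly by compactness. Two vectors of the cone thus cannot cancel each other. -/
lemma StringFunction.exists_salient_bound :
    ∃ κ > 0, ∀ y ∈ c.cone, ∀ z ∈ c.cone, κ * ‖y‖ ≤ ‖y + z‖ := by
  have hne : c.cone.Nonempty := ⟨0, c.zero_mem⟩
  obtain ⟨κ, hκ, h⟩ := c.exists_lower_bound (q := fun y => infDist (-y) c.cone)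
    ((continuous_infDist_pt _).comp continuous_neg)
    (fun y hy hy1 => (c.isClosed_cone.notMem_iff_infDist_pos hne).1 fun hmem => by
      rw [c.salient y hy hmem] at hy1; simp at hy1)
  refine ⟨κ, hκ, fun y hy z hz => ?_⟩
  rcases eq_or_ne y 0 with rfl | hy0
  · simp
  · have hn : 0 < ‖y‖ := norm_pos_iff.2 hy0
    have h1 := h (‖y‖⁻¹ • y) (c.smul_mem _ (by positivity) y hy)
      (by rw [norm_smul, norm_inv, norm_norm, inv_mul_cancel₀ hn.ne'])
    have h2 := h1.trans (infDist_le_dist_of_mem (c.smul_mem ‖y‖⁻¹ (by positivity) z hz))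
    rw [dist_eq_norm, ← norm_neg, neg_sub, sub_neg_eq_add, ← smul_add, norm_smul, norm_inv,
      norm_norm, inv_mul_eq_div, le_div_iff₀ hn, add_comm z y] at h2
    exact h2

/-- This bounds the part of a string that meets the support of an admissible function. The vector `y
+ z` of the cone is spacelike by a margin proportional to its norm, so closeness to the causal
influence region bounds it, and salience passes the bound on to `y`. The shift `e` costs `2‖e‖` in
the spatial norm and `‖e‖` in time, hence `3 * r`. -/
lemma StringFunction.exists_norm_le (R r : ℝ) :
    ∃ L, ∀ e : Spacetime, ‖e‖ ≤ r → ∀ y ∈ c.cone, ∀ z ∈ c.cone,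
      spaceNorm (e + y + z) ≤ |(e + y + z) 0| + R → ‖y‖ ≤ L := by
  obtain ⟨κ₁, hκ₁, h₁⟩ := c.exists_spacelike_bound
  obtain ⟨κ₂, hκ₂, h₂⟩ := c.exists_salient_bound
  refine ⟨(R + 3 * r) / κ₁ / κ₂, fun e he y hy z hz h => ?_⟩
  have hw := h₁ _ (c.add_mem hy hz)
  have h3 : spaceNorm (y + z) ≤ spaceNorm (e + y + z) + 2 * ‖e‖ := by
    have : y + z = (e + y + z) + -e := by abel
    calc spaceNorm (y + z) = spaceNorm ((e + y + z) + -e) := by rw [← this]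
      _ ≤ _ := (spaceNorm_add_le _ _).trans
        (by rw [spaceNorm_neg]; linarith [spaceNorm_le e])
  have h4 : |(e + y + z) 0| ≤ |(y + z) 0| + ‖e‖ := by
    have : (e + y + z) 0 = (y + z) 0 + e 0 := by simp only [Pi.add_apply]; ring
    rw [this]
    exact (abs_add_le _ _).trans (by linarith [abs_coord_le e 0])
  rw [le_div_iff₀ hκ₂, le_div_iff₀ hκ₁]
  have h5 := mul_le_mul_of_nonneg_left (h₂ y hy z hz) hκ₁.le
  nlinarith

/-! ### Admissible functions -/

/-- Smooth functions supported in `J(B_R) - C` for a fixed radius. -/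
def AdmissibleWith (R : ℝ) (f : Spacetime → ℝ) : Prop :=
  ContDiff ℝ ∞ f ∧ ∀ x, f x ≠ 0 → ∃ y ∈ c.cone, spaceNorm (x + y) ≤ |(x + y) 0| + R

variable {c}

lemma Admissible.exists {f : Spacetime → ℝ} (hf : Admissible c f) : ∃ R, AdmissibleWith c R f :=
  let ⟨h, R, hR⟩ := hf; ⟨R, h, hR⟩

lemma AdmissibleWith.admissible {R : ℝ} {f : Spacetime → ℝ} (hf : AdmissibleWith c R f) :
    Admissible c f := ⟨hf.1, R, hf.2⟩

lemma AdmissibleWith.mono {R R' : ℝ} (h : R ≤ R') {f : Spacetime → ℝ}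
    (hf : AdmissibleWith c R f) : AdmissibleWith c R' f :=
  ⟨hf.1, fun x hx => let ⟨y, hy, h'⟩ := hf.2 x hx; ⟨y, hy, h'.trans (by linarith)⟩⟩

lemma Admissible.exists₂ {f g : Spacetime → ℝ} (hf : Admissible c f) (hg : Admissible c g) :
    ∃ R, AdmissibleWith c R f ∧ AdmissibleWith c R g :=
  let ⟨R₁, h₁⟩ := hf.exists
  let ⟨R₂, h₂⟩ := hg.exists
  ⟨max R₁ R₂, h₁.mono (le_max_left _ _), h₂.mono (le_max_right _ _)⟩

lemma AdmissibleWith.add {R : ℝ} {f g : Spacetime → ℝ} (hf : AdmissibleWith c R f)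
    (hg : AdmissibleWith c R g) : AdmissibleWith c R (f + g) := by
  refine ⟨hf.1.add hg.1, fun x hx => ?_⟩
  by_cases h : f x = 0
  · exact hg.2 x (by simpa [h] using hx)
  · exact hf.2 x h

lemma AdmissibleWith.smul {R : ℝ} {f : Spacetime → ℝ} (hf : AdmissibleWith c R f) (t : ℝ) :
    AdmissibleWith c R (t • f) :=
  ⟨hf.1.const_smul t, fun x hx => hf.2 x fun h => hx (by simp [h])⟩

lemma AdmissibleWith.mul {R : ℝ} {f g : Spacetime → ℝ} (hf : AdmissibleWith c R f)
    (hg : AdmissibleWith c R g) : AdmissibleWith c R (f * g) :=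
  ⟨hf.1.mul hg.1, fun x hx => hf.2 x fun h => hx (by simp [h])⟩

/-- A displacement of length at most one costs two in the spatial norm and one in time. This is the
source of the radius `R + 3` for derivatives and string integrals. -/
lemma exists_near_of_displaced {R : ℝ} {x y e : Spacetime} (he : ‖e‖ ≤ 1)
    (h : spaceNorm (x + e + y) ≤ |(x + e + y) 0| + R) :
    spaceNorm (x + y) ≤ |(x + y) 0| + (R + 3) := by
  have h3 : spaceNorm (x + y) ≤ spaceNorm (x + e + y) + 2 * ‖e‖ := by
    have : x + y = (x + e + y) + -e := by abel
    calc spaceNorm (x + y) = spaceNorm ((x + e + y) + -e) := by rw [← this]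
      _ ≤ _ := (spaceNorm_add_le _ _).trans
        (by rw [spaceNorm_neg]; linarith [spaceNorm_le e])
  have h4 : |(x + e + y) 0| ≤ |(x + y) 0| + ‖e‖ := by
    have : (x + e + y) 0 = (x + y) 0 + e 0 := by simp only [Pi.add_apply]; ring
    rw [this]
    exact (abs_add_le _ _).trans (by linarith [abs_coord_le e 0])
  linarith

lemma AdmissibleWith.pd {R : ℝ} {f : Spacetime → ℝ} (hf : AdmissibleWith c R f) (μ : Fin 4) :
    AdmissibleWith c (R + 3) (pd μ f) := by
  refine ⟨contDiff_pd hf.1 μ, fun x hx => ?_⟩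
  have hx' : x ∈ tsupport f := by
    by_contra h
    rw [notMem_tsupport_iff_eventuallyEq] at h
    refine hx ?_
    rw [StringYM.pd, h.fderiv_eq]
    simp
  obtain ⟨x', hx'0, hd⟩ := Metric.mem_closure_iff.1 hx' 1 one_pos
  obtain ⟨y, hy, h⟩ := hf.2 x' hx'0
  refine ⟨y, hy, exists_near_of_displaced (e := x' - x) ?_ ?_⟩
  · rw [← dist_eq_norm, dist_comm]; exact hd.le
  · rwa [add_sub_cancel]

lemma Admissible.contDiff {f : Spacetime → ℝ} (hf : Admissible c f) : ContDiff ℝ ∞ f := hf.1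

lemma Admissible.differentiable {f : Spacetime → ℝ} (hf : Admissible c f) : Differentiable ℝ f :=
  hf.1.differentiable (by simp)

lemma Admissible.zero : Admissible c (0 : Spacetime → ℝ) :=
  ⟨contDiff_const, 0, fun _ hx => absurd rfl hx⟩

lemma Admissible.add {f g : Spacetime → ℝ} (hf : Admissible c f) (hg : Admissible c g) :
    Admissible c (f + g) :=
  let ⟨_, h₁, h₂⟩ := hf.exists₂ hg; (h₁.add h₂).admissible

lemma Admissible.smul {f : Spacetime → ℝ} (hf : Admissible c f) (t : ℝ) : Admissible c (t • f) :=
  let ⟨_, h⟩ := hf.exists; (h.smul t).admissible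

lemma Admissible.mul {f g : Spacetime → ℝ} (hf : Admissible c f) (hg : Admissible c g) :
    Admissible c (f * g) :=
  let ⟨_, h₁, h₂⟩ := hf.exists₂ hg; (h₁.mul h₂).admissible

lemma Admissible.pd {f : Spacetime → ℝ} (hf : Admissible c f) (μ : Fin 4) :
    Admissible c (pd μ f) :=
  let ⟨_, h⟩ := hf.exists; (h.pd μ).admissible

lemma Admissible.sum {κ : Type*} (s : Finset κ) {f : κ → Spacetime → ℝ}
    (hf : ∀ i ∈ s, Admissible c (f i)) : Admissible c (∑ i ∈ s, f i) :=
  Finset.sum_induction f (Admissible c) (fun _ _ => Admissible.add) Admissible.zero hf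

/-! ### String integrals of admissible functions -/

/-- Two test functions that agree with `f` near the cone differ by one whose support avoids the
cone, where `c^μ` vanishes. Hence the choice made in the definition does not matter. -/
lemma StringFunction.pair_eq (μ : Fin 4) {f : Spacetime → ℝ} {φ : TestFn}
    (h : ∀ y ∈ c.cone, f =ᶠ[𝓝 y] φ) : c.pair μ f = c.c μ φ := by
  have key : ∀ ψ : TestFn, Disjoint c.cone (tsupport (f - ⇑ψ)) → ∀ y ∈ c.cone, f =ᶠ[𝓝 y] ψ := by
    intro ψ hψ y hy
    have := notMem_tsupport_iff_eventuallyEq.1 (Set.disjoint_left.1 hψ hy)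
    filter_upwards [this] with z hz
    simpa [sub_eq_zero] using hz
  have hex : ∃ ψ : TestFn, Disjoint c.cone (tsupport (f - ⇑ψ)) := by
    refine ⟨φ, Set.disjoint_left.2 fun y hy => notMem_tsupport_iff_eventuallyEq.2 ?_⟩
    filter_upwards [h y hy] with z hz
    simp [hz]
  rw [StringFunction.pair, dif_pos hex]
  have h1 := key _ hex.choose_spec
  rw [← sub_eq_zero, ← map_sub]
  refine c.supported μ _ fun y hy hyc => ?_
  refine absurd hy (notMem_tsupport_iff_eventuallyEq.2 ?_)
  filter_upwards [h1 y hyc, h y hyc] with z hz1 hz2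
  simp [← hz1, ← hz2]

variable (c) in
/-- A cutoff that serves all admissible functions of a given radius and all points in a ball. -/
lemma exists_cutoff (R r : ℝ) : ∃ χ : TestFn, ∀ f, AdmissibleWith c R f → ∀ x : Spacetime,
    ‖x‖ ≤ r → ∀ y ∈ c.cone, (fun z => f (x + z)) =ᶠ[𝓝 y] fun z => χ z * f (x + z) := by
  obtain ⟨L, hL⟩ := c.exists_norm_le R (r + 1)
  -- The bump has to equal one on unit balls around all relevant points of the cone, which
  -- themselves have norm at most `L`.
  let b : ContDiffBump (0 : Spacetime) := ⟨|L| + 1, |L| + 2, by positivity, by linarith⟩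
  refine ⟨⟨b, b.contDiff, b.hasCompactSupport, fun _ _ => trivial⟩, fun f hf x hx y hy => ?_⟩
  filter_upwards [ball_mem_nhds y one_pos] with z hz
  by_cases h0 : f (x + z) = 0
  · simp [h0]
  · obtain ⟨w, hw, h⟩ := hf.2 _ h0
    have hzy : ‖z - y‖ < 1 := by rwa [← dist_eq_norm]
    have h1 : ‖y‖ ≤ L := hL (x + (z - y)) ((norm_add_le _ _).trans (by linarith)) y hy w hw (by
      have : x + (z - y) + y + w = x + z + w := by abel
      rwa [this])
    have h2 : ‖z‖ ≤ |L| + 1 := by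
      have : z = y + (z - y) := by abel
      rw [this]
      exact (norm_add_le _ _).trans (by linarith [le_abs_self L])
    have h3 : b z = 1 := b.one_of_mem_closedBall (by simpa using h2)
    change f (x + z) = b z * f (x + z)
    rw [h3, one_mul]

variable (c) in
-- One cutoff works for a whole class of functions and for all points of a ball. Linearity and
-- differentiation of string integrals can therefore be checked on the regularizations, where no
-- choice is involved.
lemma exists_stringInt_eq_regularize (R r : ℝ) : ∃ χ : TestFn, ∀ f, ∀ hf : AdmissibleWith c R f,
    ∀ x : Spacetime, ‖x‖ ≤ r → ∀ μ, stringInt c μ f x = regularize (c.c μ) χ f hf.1 x := by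
  obtain ⟨χ, hχ⟩ := exists_cutoff c R r
  exact ⟨χ, fun f hf x hx μ => StringFunction.pair_eq μ fun y hy => hχ f hf x hx y hy⟩

/-- Smoothness is that of the regularizations, which is local in `x`. For the support, the cone is
closed under addition: a string that meets `J(B_R) - C` starts in that set up to an enlargement of
the radius, and otherwise the integrand agrees with the zero test function near the cone. -/
lemma AdmissibleWith.stringInt {R : ℝ} {f : Spacetime → ℝ} (hf : AdmissibleWith c R f)
    (μ : Fin 4) : AdmissibleWith c (R + 3) (stringInt c μ f) := by
  constructor
  · rw [contDiff_iff_contDiffAt]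
    intro x
    obtain ⟨χ, hχ⟩ := exists_stringInt_eq_regularize c R (‖x‖ + 1)
    refine (contDiff_regularize (c.c μ) χ f hf.1).contDiffAt.congr_of_eventuallyEq ?_
    filter_upwards [ball_mem_nhds x one_pos] with z hz
    refine hχ f hf z ?_ μ
    have h1 : ‖z - x‖ < 1 := by rwa [← dist_eq_norm]
    have : z = x + (z - x) := by abel
    rw [this]
    exact (norm_add_le _ _).trans (by linarith)
  · intro x hx
    by_contra! hcon
    refine hx ?_
    have : StringYM.stringInt c μ f x = c.c μ 0 := by
      refine StringFunction.pair_eq μ fun y hy => ?_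
      filter_upwards [ball_mem_nhds y one_pos] with z hz
      by_contra h0
      obtain ⟨w, hw, h⟩ := hf.2 _ h0
      refine absurd ?_ (not_le.2 (hcon (y + w) (c.add_mem hy hw)))
      refine exists_near_of_displaced (e := z - y) (by rw [← dist_eq_norm]; exact hz.le) ?_
      have : x + (z - y) + (y + w) = x + z + w := by abel
      rwa [this]
    rw [this, map_zero]

lemma Admissible.stringInt {f : Spacetime → ℝ} (hf : Admissible c f) (μ : Fin 4) :
    Admissible c (stringInt c μ f) :=
  let ⟨_, h⟩ := hf.exists; (h.stringInt μ).admissible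

lemma stringInt_add {f g : Spacetime → ℝ} (hf : Admissible c f) (hg : Admissible c g)
    (μ : Fin 4) : stringInt c μ (f + g) = stringInt c μ f + stringInt c μ g := by
  obtain ⟨R, h₁, h₂⟩ := hf.exists₂ hg
  ext x
  obtain ⟨χ, hχ⟩ := exists_stringInt_eq_regularize c R ‖x‖
  rw [Pi.add_apply, hχ _ h₁ x le_rfl, hχ _ h₂ x le_rfl, hχ _ (h₁.add h₂) x le_rfl, regularize,
    regularize, regularize, ← map_add]
  congr 1
  ext y
  simp [mul_add]

lemma stringInt_smul {f : Spacetime → ℝ} (hf : Admissible c f) (t : ℝ) (μ : Fin 4) :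
    stringInt c μ (t • f) = t • stringInt c μ f := by
  obtain ⟨R, h⟩ := hf.exists
  ext x
  obtain ⟨χ, hχ⟩ := exists_stringInt_eq_regularize c R ‖x‖
  rw [Pi.smul_apply, hχ _ h x le_rfl, hχ _ (h.smul t) x le_rfl, regularize, regularize, ← map_smul]
  congr 1
  ext y
  simp [mul_left_comm]

lemma stringInt_zero (μ : Fin 4) : stringInt c μ 0 = 0 := by
  simpa using stringInt_smul (c := c) Admissible.zero 0 μ

lemma stringInt_sum {κ : Type*} (s : Finset κ) {f : κ → Spacetime → ℝ}
    (hf : ∀ i ∈ s, Admissible c (f i)) (μ : Fin 4) :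
    stringInt c μ (∑ i ∈ s, f i) = ∑ i ∈ s, stringInt c μ (f i) := by
  classical
  induction s using Finset.induction_on with
  | empty => simp [stringInt_zero]
  | insert a s ha ih =>
    rw [Finset.sum_insert ha, Finset.sum_insert ha,
      stringInt_add (hf a (Finset.mem_insert_self _ _))
        (Admissible.sum s fun i hi => hf i (Finset.mem_insert_of_mem hi)),
      ih fun i hi => hf i (Finset.mem_insert_of_mem hi)]

lemma pd_stringInt {f : Spacetime → ℝ} (hf : Admissible c f) (μ ν : Fin 4) :
    pd ν (stringInt c μ f) = stringInt c μ (pd ν f) := by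
  obtain ⟨R, h⟩ := hf.exists
  ext x
  -- The same cutoff must serve `f` and its derivative, which is admissible only for the radius `R +
  -- 3`. The extra unit in the second argument allows differentiation at `x`.
  obtain ⟨χ, hχ⟩ := exists_stringInt_eq_regularize c (R + 3) (‖x‖ + 1)
  have h3 : AdmissibleWith c (R + 3) f := h.mono (by linarith)
  have he : stringInt c μ f =ᶠ[𝓝 x] regularize (c.c μ) χ f h.1 := by
    filter_upwards [ball_mem_nhds x one_pos] with z hz
    refine hχ f h3 z ?_ μ
    have h1 : ‖z - x‖ < 1 := by rwa [← dist_eq_norm]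
    have : z = x + (z - x) := by abel
    rw [this]
    exact (norm_add_le _ _).trans (by linarith)
  rw [hχ _ (h.pd ν) x (by linarith) μ, ← pd_regularize (c.c μ) χ f h.1, pd, pd, he.fderiv_eq]

lemma pd_comp_const_add {f : Spacetime → ℝ} (μ : Fin 4) (x y : Spacetime) :
    pd μ (fun z => f (x + z)) y = pd μ f (x + y) := by
  rw [pd, pd, fderiv_comp_add_left]

/-- The string integral inverts the divergence: `I_c^μ ∂_μ f = -f`. -/
lemma sum_stringInt_pd {f : Spacetime → ℝ} (hf : Admissible c f) :
    ∑ μ, stringInt c μ (pd μ f) = -f := by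
  obtain ⟨R, h⟩ := hf.exists
  ext x
  obtain ⟨χ, hχ⟩ := exists_cutoff c R ‖x‖
  set φ : TestFn := mulTest χ (fun y => f (x + y)) (h.1.comp (contDiff_const.add contDiff_id))
    with hφ
  have h1 : ∀ μ, stringInt c μ (pd μ f) x = c.c μ (∂_{coordVec μ} φ) := by
    intro μ
    refine StringFunction.pair_eq μ fun y hy => ?_
    have h2 := (hχ f h x le_rfl y hy).eventuallyEq_nhds
    filter_upwards [h2] with z hz
    rw [← pd_comp_const_add, pd, hz.fderiv_eq]
    rfl
  have h0 : φ 0 = f x := by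
    have := (hχ f h x le_rfl 0 c.zero_mem).eq_of_nhds
    simp only [add_zero] at this
    simp [hφ, ← this]
  -- The equation `∂_μ c^μ = δ` is paired with the translate of `f`, cut off away from the string.
  -- The minus sign comes from the distributional derivative.
  have h2 := congrArg (fun T : Distr => T φ) c.div_eq_delta
  simp only [Distribution.delta_apply, h0] at h2
  rw [Finset.sum_apply, Pi.neg_apply, ← h2]
  simp only [h1, Fin.sum_univ_four]
  simp only [FunLike.coe_add, Pi.add_apply, Distribution.lineDerivOp_apply_apply, map_neg]
  ring

/-- The test function that represents one integrand near the cone represents the other as well. -/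
lemma stringInt_congr {f g : Spacetime → ℝ} (hf : Admissible c f) {x : Spacetime} {ε : ℝ}
    (hε : 0 < ε) (h : ∀ z ∈ thickening ε ((fun y => x + y) '' c.cone), f z = g z) (μ : Fin 4) :
    stringInt c μ f x = stringInt c μ g x := by
  obtain ⟨R, hR⟩ := hf.exists
  obtain ⟨χ, hχ⟩ := exists_cutoff c R ‖x‖
  set φ : TestFn := mulTest χ (fun y => f (x + y)) (hR.1.comp (contDiff_const.add contDiff_id))
  have h1 : stringInt c μ f x = c.c μ φ :=
    StringFunction.pair_eq μ fun y hy => hχ f hR x le_rfl y hy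
  have h2 : stringInt c μ g x = c.c μ φ := by
    refine StringFunction.pair_eq μ fun y hy => ?_
    filter_upwards [hχ f hR x le_rfl y hy, ball_mem_nhds y hε] with z hz hzy
    refine Eq.trans (h _ ?_).symm hz
    refine mem_thickening_iff.2 ⟨x + y, ⟨y, hy, rfl⟩, ?_⟩
    simpa using hzy
  rw [h1, h2]

end StringYM

end

noncomputable section

namespace StringYM

open Metric TopologicalSpace Filter Topology

variable {ι : Type*} {c : StringFunction}

/-! ### Polynomial, string-localized fields -/

lemma pd_add {E : Type*} [NormedAddCommGroup E] [NormedSpace ℝ E] {f g : Spacetime → E}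
    (hf : Differentiable ℝ f) (hg : Differentiable ℝ g) (μ : Fin 4) :
    pd μ (f + g) = pd μ f + pd μ g := by
  ext1 x
  simp [pd, fderiv_add (hf x) (hg x)]

lemma pd_sub {E : Type*} [NormedAddCommGroup E] [NormedSpace ℝ E] {f g : Spacetime → E}
    (hf : Differentiable ℝ f) (hg : Differentiable ℝ g) (μ : Fin 4) :
    pd μ (f - g) = pd μ f - pd μ g := by
  ext1 x
  simp [pd, fderiv_sub (hf x) (hg x)]

lemma pd_smul {E : Type*} [NormedAddCommGroup E] [NormedSpace ℝ E] {f : Spacetime → E}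
    (hf : Differentiable ℝ f) (t : ℝ) (μ : Fin 4) : pd μ (t • f) = t • pd μ f := by
  ext1 x
  simp [pd, fderiv_const_smul (hf x)]

lemma pd_zero {E : Type*} [NormedAddCommGroup E] [NormedSpace ℝ E] (μ : Fin 4) :
    pd μ (0 : Spacetime → E) = 0 := by
  ext1 x
  simp [pd]

lemma pd_mul {f g : Spacetime → ℝ} (hf : Differentiable ℝ f) (hg : Differentiable ℝ g)
    (μ : Fin 4) : pd μ (f * g) = pd μ f * g + f * pd μ g := by
  ext1 x
  simp [pd, fderiv_mul (hf x) (hg x)]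
  ring

lemma pd_sum {E κ : Type*} [NormedAddCommGroup E] [NormedSpace ℝ E] (s : Finset κ)
    {f : κ → Spacetime → E} (hf : ∀ i ∈ s, Differentiable ℝ (f i)) (μ : Fin 4) :
    pd μ (∑ i ∈ s, f i) = ∑ i ∈ s, pd μ (f i) := by
  ext1 x
  simp [pd, fderiv_sum (fun i hi => hf i hi x)]

lemma pd_pd_comm {f : Spacetime → ℝ} (hf : ContDiff ℝ ∞ f) (μ ν : Fin 4) :
    pd μ (pd ν f) = pd ν (pd μ f) := by
  have hd : Differentiable ℝ (fderiv ℝ f) :=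
    (hf.fderiv_right (m := ∞) (by simp)).differentiable (by simp)
  have key : ∀ (μ ν : Fin 4) x, pd μ (pd ν f) x = fderiv ℝ (fderiv ℝ f) x (coordVec μ) (coordVec ν) := by
    intro μ ν x
    have h := (hd x).hasFDerivAt.clm_apply (hasFDerivAt_const (coordVec ν) x)
    change fderiv ℝ (fun z => fderiv ℝ f z (coordVec ν)) x (coordVec μ) = _
    rw [h.fderiv]
    simp
  ext x
  rw [key, key]
  exact (hf.contDiffAt.isSymmSndFDerivAt (by
    rw [minSmoothness_of_isRCLikeNormedField]
    exact WithTop.coe_le_coe.2 le_top)).eq _ _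

lemma add_smul_mem_configs {Φ Ψ : Conf ι} (hΦ : Φ ∈ configs ι c) (hΨ : Ψ ∈ configs ι c) (t : ℝ) :
    Φ + t • Ψ ∈ configs ι c :=
  ⟨fun μ a => (hΦ.1 μ a).add ((hΨ.1 μ a).smul t), fun a => (hΦ.2 a).add ((hΨ.2 a).smul t)⟩

lemma zero_mem_configs : (0 : Conf ι) ∈ configs ι c :=
  ⟨fun _ _ => Admissible.zero, fun _ => Admissible.zero⟩

/-- A polynomial in the line parameter with admissible coefficients. -/
def AdmissibleCoeffs (c : StringFunction) (p : Polynomial (Spacetime → ℝ)) : Prop :=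
  ∀ k, Admissible c (p.coeff k)

lemma AdmissibleCoeffs.add {p q : Polynomial (Spacetime → ℝ)} (hp : AdmissibleCoeffs c p)
    (hq : AdmissibleCoeffs c q) : AdmissibleCoeffs c (p + q) := fun k => by
  rw [Polynomial.coeff_add]; exact (hp k).add (hq k)

lemma AdmissibleCoeffs.smul {p : Polynomial (Spacetime → ℝ)} (hp : AdmissibleCoeffs c p) (t : ℝ) :
    AdmissibleCoeffs c (t • p) := fun k => by
  rw [Polynomial.coeff_smul]; exact (hp k).smul t

lemma AdmissibleCoeffs.mul {p q : Polynomial (Spacetime → ℝ)} (hp : AdmissibleCoeffs c p)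
    (hq : AdmissibleCoeffs c q) : AdmissibleCoeffs c (p * q) := fun k => by
  rw [Polynomial.coeff_mul]; exact Admissible.sum _ fun i _ => (hp i.1).mul (hq i.2)

/-- Evaluation at a real parameter. -/
def evalAt (t : ℝ) (p : Polynomial (Spacetime → ℝ)) : Spacetime → ℝ :=
  p.eval (algebraMap ℝ (Spacetime → ℝ) t)

lemma evalAt_eq_sum (t : ℝ) (p : Polynomial (Spacetime → ℝ)) :
    evalAt t p = ∑ k ∈ Finset.range (p.natDegree + 2), t ^ k • p.coeff k := by
  rw [evalAt, Polynomial.eval_eq_sum_range' (n := p.natDegree + 2) (by omega)]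
  refine Finset.sum_congr rfl fun k _ => ?_
  rw [← map_pow, mul_comm, ← Algebra.smul_def]

lemma evalAt_zero_eq (p : Polynomial (Spacetime → ℝ)) : evalAt 0 p = p.coeff 0 := by
  rw [evalAt, map_zero, Polynomial.coeff_zero_eq_eval_zero]

lemma deriv_evalAt (p : Polynomial (Spacetime → ℝ)) (x : Spacetime) :
    deriv (fun t => evalAt t p x) 0 = p.coeff 1 x := by
  have h : ∀ t, evalAt t p x = (p.map (Pi.evalRingHom (fun _ => ℝ) x)).eval t := by
    intro t
    rw [evalAt, ← Pi.evalRingHom_apply (fun _ : Spacetime => ℝ) x (p.eval _),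
      ← Polynomial.eval_map_apply]
    rfl
  simp only [h, Polynomial.deriv, ← Polynomial.coeff_zero_eq_eval_zero, Polynomial.coeff_derivative]
  simp

/-- An operator on functions that is linear on admissible functions and preserves them. -/
structure IsAdmissibleOp (c : StringFunction) (L : (Spacetime → ℝ) → Spacetime → ℝ) : Prop where
  adm : ∀ f, Admissible c f → Admissible c (L f)
  map_sum : ∀ (s : Finset ℕ) (f : ℕ → Spacetime → ℝ), (∀ i ∈ s, Admissible c (f i)) →
    L (∑ i ∈ s, f i) = ∑ i ∈ s, L (f i)
  map_smul : ∀ (t : ℝ) f, Admissible c f → L (t • f) = t • L f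

lemma isAdmissibleOp_pd (μ : Fin 4) : IsAdmissibleOp c (pd μ) where
  adm _ hf := hf.pd μ
  map_sum s _ hf := pd_sum s (fun i hi => (hf i hi).differentiable) μ
  map_smul t _ hf := pd_smul hf.differentiable t μ

lemma isAdmissibleOp_stringInt (μ : Fin 4) : IsAdmissibleOp c (stringInt c μ) where
  adm _ hf := hf.stringInt μ
  map_sum s _ hf := stringInt_sum s hf μ
  map_smul t _ hf := stringInt_smul hf t μ

/-- The operator is applied coefficientwise. It then commutes with extraction of the linear
coefficient, that is, with differentiation in the line parameter, and no interchange of limits is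
needed. -/
lemma IsAdmissibleOp.exists_poly {L : (Spacetime → ℝ) → Spacetime → ℝ} (hL : IsAdmissibleOp c L)
    {p : Polynomial (Spacetime → ℝ)} (hp : AdmissibleCoeffs c p) :
    ∃ q, AdmissibleCoeffs c q ∧ (∀ t, L (evalAt t p) = evalAt t q) ∧
      q.coeff 1 = L (p.coeff 1) := by
  set N := p.natDegree + 2
  have hL0 : L 0 = 0 := by simpa using hL.map_sum ∅ (fun _ => 0) (by simp)
  set q : Polynomial (Spacetime → ℝ) :=
    ∑ k ∈ Finset.range N, Polynomial.monomial k (L (p.coeff k)) with hq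
  have hcoeff : ∀ k, q.coeff k = L (p.coeff k) := by
    intro k
    simp only [hq, Polynomial.finsetSum_coeff, Polynomial.coeff_monomial, Finset.sum_ite_eq',
      Finset.mem_range]
    split_ifs with h
    · rfl
    · rw [Polynomial.coeff_eq_zero_of_natDegree_lt (by omega), hL0]
  refine ⟨q, fun k => ?_, fun t => ?_, hcoeff 1⟩
  · rw [hcoeff]; exact hL.adm _ (hp k)
  · rw [evalAt_eq_sum, hL.map_sum _ _ fun k _ => (hp k).smul _]
    simp only [evalAt, hq, Polynomial.eval_finsetSum, Polynomial.eval_monomial]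
    refine Finset.sum_congr rfl fun k _ => ?_
    rw [hL.map_smul _ _ (hp k), ← map_pow, mul_comm, ← Algebra.smul_def]

/-- A field is regular if it is polynomial along lines of configurations, with admissible
coefficients, and its value at `x` only depends on the potential near the string `x + C`. -/
structure IsRegular (c : StringFunction) (X : QField ι) : Prop where
  exists_poly : ∀ Φ ∈ configs ι c, ∀ Ψ ∈ configs ι c, ∃ p, AdmissibleCoeffs c p ∧
    ∀ t : ℝ, X (Φ + t • Ψ) = evalAt t p
  localized : ∀ x, ∀ ε > 0, ∀ Φ ∈ configs ι c, ∀ Ψ ∈ configs ι c,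
    (∀ z ∈ thickening ε ((fun y => x + y) '' c.cone), ∀ μ a, Φ.1 μ a z = Ψ.1 μ a z) → X Φ x = X Ψ x

lemma IsRegular.admissible {X : QField ι} (hX : IsRegular c X) {Φ : Conf ι}
    (hΦ : Φ ∈ configs ι c) : Admissible c (X Φ) := by
  obtain ⟨p, hp, h⟩ := hX.exists_poly Φ hΦ 0 zero_mem_configs
  have := h 0
  rw [smul_zero, add_zero, evalAt_zero_eq] at this
  rw [this]; exact hp 0

lemma isRegular_zero : IsRegular c (0 : QField ι) where
  exists_poly _ _ _ _ := ⟨0, fun _ => by simpa using Admissible.zero, fun t => by simp [evalAt]⟩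
  localized _ _ _ _ _ _ _ _ := rfl

lemma IsRegular.add {X Y : QField ι} (hX : IsRegular c X) (hY : IsRegular c Y) :
    IsRegular c (X + Y) where
  exists_poly Φ hΦ Ψ hΨ := by
    obtain ⟨p, hp, h⟩ := hX.exists_poly Φ hΦ Ψ hΨ
    obtain ⟨q, hq, h'⟩ := hY.exists_poly Φ hΦ Ψ hΨ
    exact ⟨p + q, hp.add hq, fun t => by simp [h, h', evalAt]⟩
  localized x ε hε Φ hΦ Ψ hΨ h :=
    congrArg₂ (· + ·) (hX.localized x ε hε Φ hΦ Ψ hΨ h) (hY.localized x ε hε Φ hΦ Ψ hΨ h)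

lemma IsRegular.smul {X : QField ι} (hX : IsRegular c X) (r : ℝ) : IsRegular c (r • X) where
  exists_poly Φ hΦ Ψ hΨ := by
    obtain ⟨p, hp, h⟩ := hX.exists_poly Φ hΦ Ψ hΨ
    exact ⟨r • p, hp.smul r, fun t => by simp [h, evalAt, Polynomial.eval_smul]⟩
  localized x ε hε Φ hΦ Ψ hΨ h := congrArg (r • ·) (hX.localized x ε hε Φ hΦ Ψ hΨ h)

lemma IsRegular.sub {X Y : QField ι} (hX : IsRegular c X) (hY : IsRegular c Y) :
    IsRegular c (X - Y) := by
  have := hX.add (hY.smul (-1))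
  rwa [neg_one_smul, ← sub_eq_add_neg] at this

lemma IsRegular.mul {X Y : QField ι} (hX : IsRegular c X) (hY : IsRegular c Y) :
    IsRegular c (X * Y) where
  exists_poly Φ hΦ Ψ hΨ := by
    obtain ⟨p, hp, h⟩ := hX.exists_poly Φ hΦ Ψ hΨ
    obtain ⟨q, hq, h'⟩ := hY.exists_poly Φ hΦ Ψ hΨ
    exact ⟨p * q, hp.mul hq, fun t => by simp [h, h', evalAt]⟩
  localized x ε hε Φ hΦ Ψ hΨ h :=
    congrArg₂ (· * ·) (hX.localized x ε hε Φ hΦ Ψ hΨ h) (hY.localized x ε hε Φ hΦ Ψ hΨ h)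

lemma IsRegular.sum {κ : Type*} (s : Finset κ) {X : κ → QField ι}
    (hX : ∀ i ∈ s, IsRegular c (X i)) : IsRegular c (∑ i ∈ s, X i) :=
  Finset.sum_induction X (IsRegular c) (fun _ _ => IsRegular.add) isRegular_zero hX

lemma isRegular_fieldA (μ : Fin 4) (a : ι) : IsRegular c (fieldA μ a) where
  exists_poly Φ hΦ Ψ hΨ := by
    refine ⟨Polynomial.C (Φ.1 μ a) + Polynomial.C (Ψ.1 μ a) * Polynomial.X, ?_, fun t => ?_⟩
    · intro k
      simp only [Polynomial.coeff_add, Polynomial.coeff_C, Polynomial.coeff_C_mul,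
        Polynomial.coeff_X]
      refine Admissible.add ?_ ?_
      · split_ifs
        exacts [hΦ.1 μ a, Admissible.zero]
      · split_ifs
        · rw [mul_one]; exact hΨ.1 μ a
        · rw [mul_zero]; exact Admissible.zero
    · simp only [evalAt, Polynomial.eval_add, Polynomial.eval_C, Polynomial.eval_mul,
        Polynomial.eval_X]
      rw [mul_comm, ← Algebra.smul_def]
      rfl
  localized x ε hε Φ _ Ψ _ h := by
    refine h x ?_ μ a
    exact mem_thickening_iff.2 ⟨x, ⟨0, c.zero_mem, by simp⟩, by simpa using hε⟩

/-- As the cone is closed under addition, strings that start near a string stay near it.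
Localization thereby survives nested string integrals, at the price of halving `ε`. -/
lemma thickening_string_subset {x z : Spacetime} {ε : ℝ}
    (hz : z ∈ thickening (ε / 2) ((fun y => x + y) '' c.cone)) :
    thickening (ε / 2) ((fun y => z + y) '' c.cone) ⊆ thickening ε ((fun y => x + y) '' c.cone) := by
  intro w hw
  obtain ⟨_, ⟨y, hy, rfl⟩, h1⟩ := mem_thickening_iff.1 hz
  obtain ⟨_, ⟨y', hy', rfl⟩, h2⟩ := mem_thickening_iff.1 hw
  refine mem_thickening_iff.2 ⟨x + (y + y'), ⟨y + y', c.add_mem hy hy', rfl⟩, ?_⟩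
  calc dist w (x + (y + y')) ≤ dist w (z + y') + dist (z + y') (x + (y + y')) := dist_triangle _ _ _
    _ = dist w (z + y') + dist z (x + y) := by rw [← add_assoc, dist_add_right]
    _ < ε := by linarith

lemma IsRegular.fieldPd {X : QField ι} (hX : IsRegular c X) (μ : Fin 4) :
    IsRegular c (fieldPd μ X) where
  exists_poly Φ hΦ Ψ hΨ := by
    obtain ⟨p, hp, h⟩ := hX.exists_poly Φ hΦ Ψ hΨ
    obtain ⟨q, hq, h', -⟩ := (isAdmissibleOp_pd μ).exists_poly hp
    exact ⟨q, hq, fun t => by rw [StringYM.fieldPd, h, h']⟩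
  localized x ε hε Φ hΦ Ψ hΨ h := by
    -- A derivative at `x` needs agreement of the values at all nearby points, so the configurations
    -- must agree on a neighbourhood of the string and not merely on it.
    have : X Φ =ᶠ[𝓝 x] X Ψ := by
      filter_upwards [ball_mem_nhds x (half_pos hε)] with z hz
      refine hX.localized z (ε / 2) (half_pos hε) Φ hΦ Ψ hΨ fun w hw => h w ?_
      exact thickening_string_subset
        (mem_thickening_iff.2 ⟨x, ⟨0, c.zero_mem, by simp⟩, hz⟩) hw
    rw [StringYM.fieldPd, StringYM.fieldPd, pd, pd, this.fderiv_eq]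

lemma IsRegular.fieldInt {X : QField ι} (hX : IsRegular c X) (μ : Fin 4) :
    IsRegular c (fieldInt c μ X) where
  exists_poly Φ hΦ Ψ hΨ := by
    obtain ⟨p, hp, h⟩ := hX.exists_poly Φ hΦ Ψ hΨ
    obtain ⟨q, hq, h', -⟩ := (isAdmissibleOp_stringInt μ).exists_poly hp
    exact ⟨q, hq, fun t => by rw [StringYM.fieldInt, h, h']⟩
  localized x ε hε Φ hΦ Ψ hΨ h :=
    stringInt_congr (hX.admissible hΦ) (half_pos hε) (fun z hz =>
      hX.localized z (ε / 2) (half_pos hε) Φ hΦ Ψ hΨ fun w hw =>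
        h w (thickening_string_subset hz hw)) μ

/-! ### Functional derivatives -/

/-- The functional derivative of `X` in the direction of a field variation `δA_μ = v_μ`. -/
def dirDeriv (v : Fin 4 → ι → QField ι) (X : QField ι) : QField ι :=
  fun Φ x => deriv (fun t : ℝ => X (Φ + t • ((fun μ a => v μ a Φ, 0) : Conf ι)) x) 0

/-- A variation that preserves the space of configurations. -/
def IsVariation (c : StringFunction) (v : Fin 4 → ι → QField ι) : Prop :=
  ∀ μ a, ∀ Φ ∈ configs ι c, Admissible c (v μ a Φ)

variable {v : Fin 4 → ι → QField ι}

lemma IsVariation.mem (hv : IsVariation c v) {Φ : Conf ι} (hΦ : Φ ∈ configs ι c) :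
    ((fun μ a => v μ a Φ, 0) : Conf ι) ∈ configs ι c :=
  ⟨fun μ a => hv μ a Φ hΦ, fun _ => Admissible.zero⟩

lemma dirDeriv_eq_coeff {X : QField ι} {Φ : Conf ι} {p : Polynomial (Spacetime → ℝ)}
    (h : ∀ t : ℝ, X (Φ + t • ((fun μ a => v μ a Φ, 0) : Conf ι)) = evalAt t p) :
    dirDeriv v X Φ = p.coeff 1 := by
  ext x
  simp only [dirDeriv, h]
  exact deriv_evalAt p x

/-- The variation is frozen at `Φ` along the line, so the functional derivative is the linear
coefficient of a polynomial. The sum rule, the Leibniz rule and the commutation with `∂_μ` and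
`I_c^μ` all become identities between coefficients. -/
lemma IsRegular.exists_dirDeriv (hv : IsVariation c v) {X : QField ι} (hX : IsRegular c X)
    {Φ : Conf ι} (hΦ : Φ ∈ configs ι c) :
    ∃ p, AdmissibleCoeffs c p ∧
      (∀ t : ℝ, X (Φ + t • ((fun μ a => v μ a Φ, 0) : Conf ι)) = evalAt t p) ∧
      X Φ = p.coeff 0 ∧ dirDeriv v X Φ = p.coeff 1 := by
  obtain ⟨p, hp, h⟩ := hX.exists_poly Φ hΦ _ (hv.mem hΦ)
  refine ⟨p, hp, h, ?_, dirDeriv_eq_coeff h⟩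
  have := h 0
  rwa [zero_smul, add_zero, evalAt_zero_eq] at this

lemma dirDeriv_congr (hv : IsVariation c v) {X Y : QField ι} (h : Set.EqOn X Y (configs ι c)) :
    Set.EqOn (dirDeriv v X) (dirDeriv v Y) (configs ι c) := by
  intro Φ hΦ
  ext x
  simp only [dirDeriv, fun t => h (add_smul_mem_configs hΦ (hv.mem hΦ) t)]

lemma dirDeriv_zero_left (X : QField ι) : dirDeriv 0 X = 0 := by
  ext Φ x
  change deriv (fun t : ℝ => X (Φ + t • (0 : Conf ι)) x) 0 = 0
  simp

lemma dirDeriv_zero (v : Fin 4 → ι → QField ι) : dirDeriv v 0 = 0 := by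
  ext Φ x
  simp [dirDeriv]

lemma dirDeriv_fieldA (v : Fin 4 → ι → QField ι) (μ : Fin 4) (a : ι) :
    dirDeriv v (fieldA μ a) = v μ a := by
  ext Φ x
  simp only [dirDeriv, fieldA]
  have h : (fun t : ℝ => (Φ + t • ((fun μ a => v μ a Φ, 0) : Conf ι)).1 μ a x) =
      fun t => Φ.1 μ a x + t * v μ a Φ x := rfl
  rw [h, deriv_const_add, deriv_mul_const differentiableAt_id]
  simp

lemma dirDeriv_fieldN (v : Fin 4 → ι → QField ι) (a : ι) : dirDeriv v (fieldN a) = 0 := by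
  ext Φ x
  simp [dirDeriv, fieldN]

lemma dirDeriv_fieldPd_fieldN (v : Fin 4 → ι → QField ι) (κ : Fin 4) (a : ι) :
    dirDeriv v (fieldPd κ (fieldN a)) = 0 := by
  ext Φ x
  simp [dirDeriv, fieldN, fieldPd]

lemma dirDeriv_add (hv : IsVariation c v) {X Y : QField ι} (hX : IsRegular c X)
    (hY : IsRegular c Y) :
    Set.EqOn (dirDeriv v (X + Y)) (dirDeriv v X + dirDeriv v Y) (configs ι c) := by
  intro Φ hΦ
  obtain ⟨p, -, h, -, h1⟩ := hX.exists_dirDeriv hv hΦ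
  obtain ⟨q, -, h', -, h1'⟩ := hY.exists_dirDeriv hv hΦ
  rw [Pi.add_apply, h1, h1', ← Polynomial.coeff_add]
  exact dirDeriv_eq_coeff fun t => by rw [Pi.add_apply, h, h', evalAt, evalAt, evalAt, Polynomial.eval_add]

lemma dirDeriv_smul (hv : IsVariation c v) {X : QField ι} (hX : IsRegular c X) (r : ℝ) :
    Set.EqOn (dirDeriv v (r • X)) (r • dirDeriv v X) (configs ι c) := by
  intro Φ hΦ
  obtain ⟨p, -, h, -, h1⟩ := hX.exists_dirDeriv hv hΦ
  rw [Pi.smul_apply, h1, ← Polynomial.coeff_smul]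
  exact dirDeriv_eq_coeff fun t => by rw [Pi.smul_apply, h, evalAt, evalAt, Polynomial.eval_smul]

lemma dirDeriv_sum (hv : IsVariation c v) {κ : Type*} (s : Finset κ) {X : κ → QField ι}
    (hX : ∀ i ∈ s, IsRegular c (X i)) :
    Set.EqOn (dirDeriv v (∑ i ∈ s, X i)) (∑ i ∈ s, dirDeriv v (X i)) (configs ι c) := by
  classical
  induction s using Finset.induction_on with
  | empty => intro Φ _; simp [dirDeriv_zero]
  | insert i s hi ih =>
    intro Φ hΦ
    have hs : ∀ j ∈ s, IsRegular c (X j) := fun j hj => hX j (Finset.mem_insert_of_mem hj)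
    rw [Finset.sum_insert hi, Finset.sum_insert hi,
      dirDeriv_add hv (hX i (Finset.mem_insert_self _ _)) (IsRegular.sum s hs) hΦ, Pi.add_apply,
      Pi.add_apply, ih hs hΦ]

lemma dirDeriv_mul (hv : IsVariation c v) {X Y : QField ι} (hX : IsRegular c X)
    (hY : IsRegular c Y) :
    Set.EqOn (dirDeriv v (X * Y)) (dirDeriv v X * Y + X * dirDeriv v Y) (configs ι c) := by
  intro Φ hΦ
  obtain ⟨p, -, h, h0, h1⟩ := hX.exists_dirDeriv hv hΦ
  obtain ⟨q, -, h', h0', h1'⟩ := hY.exists_dirDeriv hv hΦ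
  rw [Pi.add_apply, Pi.mul_apply, Pi.mul_apply, h1, h1', h0, h0', add_comm,
    ← Polynomial.mul_coeff_one]
  exact dirDeriv_eq_coeff fun t => by rw [Pi.mul_apply, h, h', evalAt, evalAt, evalAt, Polynomial.eval_mul]

lemma dirDeriv_fieldPd (hv : IsVariation c v) {X : QField ι} (hX : IsRegular c X) (μ : Fin 4) :
    Set.EqOn (dirDeriv v (fieldPd μ X)) (fieldPd μ (dirDeriv v X)) (configs ι c) := by
  intro Φ hΦ
  obtain ⟨p, hp, h, h0, h1⟩ := hX.exists_dirDeriv hv hΦ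
  obtain ⟨q, hq, h', hq1⟩ := (isAdmissibleOp_pd μ).exists_poly hp
  rw [fieldPd, h1, ← hq1]
  exact dirDeriv_eq_coeff fun t => by rw [fieldPd, h, h']

lemma dirDeriv_fieldInt (hv : IsVariation c v) {X : QField ι} (hX : IsRegular c X) (μ : Fin 4) :
    Set.EqOn (dirDeriv v (fieldInt c μ X)) (fieldInt c μ (dirDeriv v X)) (configs ι c) := by
  intro Φ hΦ
  obtain ⟨p, hp, h, h0, h1⟩ := hX.exists_dirDeriv hv hΦ
  obtain ⟨q, hq, h', hq1⟩ := (isAdmissibleOp_stringInt μ).exists_poly hp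
  rw [fieldInt, h1, ← hq1]
  exact dirDeriv_eq_coeff fun t => by rw [fieldInt, h, h']

lemma sum_stringInt_pd_field {X : QField ι} (hX : IsRegular c X) {Φ : Conf ι}
    (hΦ : Φ ∈ configs ι c) : (∑ ν, fieldInt c ν (fieldPd ν X)) Φ = -X Φ := by
  rw [Finset.sum_apply]
  exact sum_stringInt_pd (hX.admissible hΦ)

lemma fieldInt_add_apply {X Y : QField ι} (hX : IsRegular c X) (hY : IsRegular c Y) {Φ : Conf ι}
    (hΦ : Φ ∈ configs ι c) (ν : Fin 4) :
    fieldInt c ν (X + Y) Φ = fieldInt c ν X Φ + fieldInt c ν Y Φ :=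
  stringInt_add (hX.admissible hΦ) (hY.admissible hΦ) ν

lemma fieldInt_smul_apply {X : QField ι} (hX : IsRegular c X) {Φ : Conf ι}
    (hΦ : Φ ∈ configs ι c) (t : ℝ) (ν : Fin 4) : fieldInt c ν (t • X) Φ = t • fieldInt c ν X Φ :=
  stringInt_smul (hX.admissible hΦ) t ν

end StringYM

end

noncomputable section

namespace StringYM

variable {ι : Type*} [Fintype ι]

/-! ### The adjoint action -/

section Ad

variable {R R' : Type*} [CommRing R] [Algebra ℝ R] [CommRing R'] [Algebra ℝ R']
  (f : ι → ι → ι → ℝ)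

lemma adField_add_right (s v w : ι → R) :
    adField f s (v + w) = adField f s v + adField f s w := by
  ext k
  simp [adField, mul_add, smul_add, Finset.sum_add_distrib]

lemma adField_smul_right (t : ℝ) (s v : ι → R) : adField f s (t • v) = t • adField f s v := by
  ext k
  simp only [adField, Pi.smul_apply, Algebra.mul_smul_comm, Finset.smul_sum]
  refine Finset.sum_congr rfl fun a _ => Finset.sum_congr rfl fun b _ => smul_comm _ _ _

lemma adField_zero_right (s : ι → R) : adField f s 0 = 0 := by
  ext k
  simp [adField]

lemma map_adField (φ : R →ₐ[ℝ] R') (s v : ι → R) (k : ι) :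
    φ (adField f s v k) = adField f (fun a => φ (s a)) (fun a => φ (v a)) k := by
  simp [adField, map_sum, map_smul, map_mul]

end Ad

variable {f : ι → ι → ι → ℝ} {c : StringFunction}

lemma IsRegular.adField {s v : ι → QField ι} (hs : ∀ a, IsRegular c (s a))
    (hv : ∀ a, IsRegular c (v a)) (k : ι) : IsRegular c (adField f s v k) :=
  IsRegular.sum _ fun a _ => IsRegular.sum _ fun b _ => ((hs a).mul (hv b)).smul _

lemma IsRegular.adList {l : List (ι → QField ι)} (hl : ∀ s ∈ l, ∀ a, IsRegular c (s a))
    {v : ι → QField ι} (hv : ∀ a, IsRegular c (v a)) (k : ι) : IsRegular c (adList f l v k) := by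
  induction l generalizing k with
  | nil => exact hv k
  | cons s l ih =>
    exact IsRegular.adField (hl s (by simp)) (ih fun s hs => hl s (by simp [hs])) k

lemma dirDeriv_adField {v : Fin 4 → ι → QField ι} (hv : IsVariation c v) {s u : ι → QField ι}
    (hs : ∀ a, IsRegular c (s a)) (hu : ∀ a, IsRegular c (u a)) (k : ι) :
    Set.EqOn (dirDeriv v (adField f s u k))
      (adField f (fun a => dirDeriv v (s a)) u k + adField f s (fun a => dirDeriv v (u a)) k)
      (configs ι c) := by
  intro Φ hΦ
  unfold adField
  rw [dirDeriv_sum hv _ (fun a _ => IsRegular.sum _ fun b _ => ((hs a).mul (hu b)).smul _) hΦ,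
    ← Finset.sum_add_distrib, Finset.sum_apply, Finset.sum_apply]
  refine Finset.sum_congr rfl fun a _ => ?_
  rw [dirDeriv_sum hv _ (fun b _ => ((hs a).mul (hu b)).smul _) hΦ,
    ← Finset.sum_add_distrib, Finset.sum_apply, Finset.sum_apply]
  refine Finset.sum_congr rfl fun b _ => ?_
  rw [dirDeriv_smul hv ((hs a).mul (hu b)) _ hΦ, Pi.smul_apply,
    dirDeriv_mul hv (hs a) (hu b) hΦ, ← smul_add]
  rfl

lemma adField_eqOn {s s' u u' : ι → QField ι} {Φ : Conf ι} (hs : ∀ a, s a Φ = s' a Φ)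
    (hu : ∀ a, u a Φ = u' a Φ) (k : ι) : adField f s u k Φ = adField f s' u' k Φ := by
  simp only [adField, Finset.sum_apply, Pi.smul_apply, Pi.mul_apply, hs, hu]

/-! ### The spaces `𝒮` and `𝒱` -/

lemma spaceS_int_A (l : List (ι → QField ι)) (hl : ∀ s ∈ l, s ∈ spaceS f c) :
    (fun a => ∑ ν, fieldInt c ν (adList f l (fieldA ν) a)) ∈ spaceS f c := by
  rw [spaceS, Submodule.mem_sInf]
  intro p hp
  exact hp.1 l fun s hs => (Submodule.mem_sInf.1 (hl s hs)) p hp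

lemma spaceS_int_ds (l : List (ι → QField ι)) (hl0 : l ≠ []) (hl : ∀ s ∈ l, s ∈ spaceS f c)
    (s₀ : ι → QField ι) (hs₀ : s₀ ∈ spaceS f c) :
    (fun a => ∑ ν, fieldInt c ν (adList f l (fun b => fieldPd ν (s₀ b)) a)) ∈ spaceS f c := by
  rw [spaceS, Submodule.mem_sInf]
  intro p hp
  exact hp.2 l hl0 (fun s hs => (Submodule.mem_sInf.1 (hl s hs)) p hp) s₀
    (Submodule.mem_sInf.1 hs₀ p hp)

variable (ι c) in
/-- The Lie-algebra-valued fields with regular components. -/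
def regularSubmodule : Submodule ℝ (ι → QField ι) where
  carrier := {s | ∀ a, IsRegular c (s a)}
  add_mem' hs ht a := (hs a).add (ht a)
  zero_mem' _ := isRegular_zero
  smul_mem' r _ hs a := (hs a).smul r

/-- By minimality of `𝒮` it suffices that the regular fields form a subspace with the defining
closure properties. -/
lemma isRegular_of_mem_spaceS {s : ι → QField ι} (hs : s ∈ spaceS f c) (a : ι) :
    IsRegular c (s a) := by
  have h : spaceS f c ≤ regularSubmodule ι c := by
    refine sInf_le ⟨fun l hl a => ?_, fun l _ hl s₀ hs₀ a => ?_⟩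
    · exact IsRegular.sum _ fun ν _ =>
        (IsRegular.adList hl (fun b => isRegular_fieldA ν b) a).fieldInt ν
    · exact IsRegular.sum _ fun ν _ =>
        (IsRegular.adList hl (fun b => (hs₀ b).fieldPd ν) a).fieldInt ν
  exact h hs a

/-- The letters of an element of `𝒮`. -/
def sLetter (σ : spaceS f c) : ι → Wick f c := fun a => MvPolynomial.X (Letter.s σ a)

@[simp]
lemma wickField_sLetter (σ : spaceS f c) (a : ι) : wickField (sLetter σ a) = σ.1 a := by
  simp [wickField, sLetter, Letter.toField]

/-- The element `A_ν` of `𝒱`. -/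
def vecA : Fin 4 → ι → Wick f c := fun ν a => MvPolynomial.X (Letter.A ν a)

/-- The element `∂_ν s` of `𝒱`. -/
def vecDs (σ : spaceS f c) : Fin 4 → ι → Wick f c := fun ν a => MvPolynomial.X (Letter.ds ν σ a)

@[simp]
lemma wickField_vecA (ν : Fin 4) (a : ι) : wickField (vecA (f := f) (c := c) ν a) = fieldA ν a := by
  simp [wickField, vecA, Letter.toField]

@[simp]
lemma wickField_vecDs (σ : spaceS f c) (ν : Fin 4) (a : ι) :
    wickField (vecDs σ ν a) = fieldPd ν (σ.1 a) := by
  simp [wickField, vecDs, Letter.toField]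

/-- `ad_{is}` on vector-valued Wick polynomials. -/
def adVec (σ : spaceS f c) (u : Fin 4 → ι → Wick f c) : Fin 4 → ι → Wick f c :=
  fun ν => adField f (sLetter σ) (u ν)

lemma wickField_adVec (σ : spaceS f c) (u : Fin 4 → ι → Wick f c) (ν : Fin 4) (a : ι) :
    wickField (adVec σ u ν a) = adField f σ.1 (fun b => wickField (u ν b)) a := by
  rw [adVec, map_adField]
  simp

lemma vecA_mem : vecA ∈ spaceV f c := Submodule.subset_span (Or.inl ⟨[], rfl⟩)

lemma vecDs_mem (σ : spaceS f c) : vecDs σ ∈ spaceV f c :=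
  Submodule.subset_span (Or.inr ⟨[], σ, rfl⟩)

lemma adVec_add (σ : spaceS f c) (u w : Fin 4 → ι → Wick f c) :
    adVec σ (u + w) = adVec σ u + adVec σ w := by
  ext1 ν; exact adField_add_right f _ _ _

lemma adVec_smul (σ : spaceS f c) (t : ℝ) (u : Fin 4 → ι → Wick f c) :
    adVec σ (t • u) = t • adVec σ u := by
  ext1 ν; exact adField_smul_right f _ _ _

lemma adVec_zero (σ : spaceS f c) : adVec σ 0 = 0 := by
  ext1 ν; exact adField_zero_right f _

lemma adVec_mem (σ : spaceS f c) {u : Fin 4 → ι → Wick f c} (hu : u ∈ spaceV f c) :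
    adVec σ u ∈ spaceV f c := by
  induction hu using Submodule.span_induction with
  | mem u hu =>
    rcases hu with ⟨l, rfl⟩ | ⟨l, σ₀, rfl⟩
    · exact Submodule.subset_span (Or.inl ⟨σ :: l, rfl⟩)
    · exact Submodule.subset_span (Or.inr ⟨σ :: l, σ₀, rfl⟩)
  | zero => rw [adVec_zero]; exact zero_mem _
  | add u w _ _ hu hw => rw [adVec_add]; exact add_mem hu hw
  | smul t u _ hu => rw [adVec_smul]; exact Submodule.smul_mem _ t hu

/-- Induction over `𝒱`. -/
lemma spaceV_induction {P : (u : Fin 4 → ι → Wick f c) → u ∈ spaceV f c → Prop}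
    (hA : P vecA vecA_mem) (hds : ∀ σ, P (vecDs σ) (vecDs_mem σ))
    (had : ∀ σ u hu, P u hu → P (adVec σ u) (adVec_mem σ hu)) (h0 : P 0 (zero_mem _))
    (hadd : ∀ u w hu hw, P u hu → P w hw → P (u + w) (add_mem hu hw))
    (hsmul : ∀ (t : ℝ) u hu, P u hu → P (t • u) (Submodule.smul_mem _ t hu))
    {u : Fin 4 → ι → Wick f c} (hu : u ∈ spaceV f c) : P u hu := by
  induction hu using Submodule.span_induction with
  | mem u hu =>
    rcases hu with ⟨l, rfl⟩ | ⟨l, σ₀, rfl⟩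
    · induction l with
      | nil => exact hA
      | cons σ l ih => exact had σ _ (Submodule.subset_span (Or.inl ⟨l, rfl⟩)) ih
    · induction l with
      | nil => exact hds σ₀
      | cons σ l ih => exact had σ _ (Submodule.subset_span (Or.inr ⟨l, σ₀, rfl⟩)) ih
  | zero => exact h0
  | add u w h₁ h₂ hu hw => exact hadd u w h₁ h₂ hu hw
  | smul t u h₁ hu => exact hsmul t u h₁ hu

lemma isRegular_wickField {u : Fin 4 → ι → Wick f c} (hu : u ∈ spaceV f c) (ν : Fin 4) (a : ι) :
    IsRegular c (wickField (u ν a)) := by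
  induction hu using spaceV_induction generalizing a with
  | hA => rw [wickField_vecA]; exact isRegular_fieldA ν a
  | hds σ => rw [wickField_vecDs]; exact (isRegular_of_mem_spaceS σ.2 a).fieldPd ν
  | had σ u _ hu =>
    rw [wickField_adVec]; exact IsRegular.adField (isRegular_of_mem_spaceS σ.2) hu a
  | h0 => rw [Pi.zero_apply, Pi.zero_apply, map_zero]; exact isRegular_zero
  | hadd u w _ _ hu hw => rw [Pi.add_apply, Pi.add_apply, map_add]; exact (hu a).add (hw a)
  | hsmul t u _ hu => rw [Pi.smul_apply, Pi.smul_apply, map_smul]; exact (hu a).smul t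

lemma isVariation_wickField {u : Fin 4 → ι → Wick f c} (hu : u ∈ spaceV f c) :
    IsVariation c fun ν a => wickField (u ν a) :=
  fun ν a _ hΦ => (isRegular_wickField hu ν a).admissible hΦ

/-- The string integral `I_c^ν v_ν` of `v ∈ 𝒱` belongs to `𝒮`. -/
lemma exists_spaceS_eq_int {u : Fin 4 → ι → Wick f c} (hu : u ∈ spaceV f c) :
    ∃ s ∈ spaceS f c, ∀ a, Set.EqOn (s a) (∑ ν, fieldInt c ν (wickField (u ν a)))
      (configs ι c) := by
  have hlist : ∀ l : List (spaceS f c), ∀ s ∈ l.map Subtype.val, s ∈ spaceS f c := by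
    intro l s hs
    obtain ⟨σ, -, rfl⟩ := List.mem_map.1 hs
    exact σ.2
  have hmap : ∀ (l : List (spaceS f c)) (v : ι → Wick f c) (a : ι),
      wickField (adList f (l.map fun σ a => MvPolynomial.X (Letter.s σ a)) v a) =
        adList f (l.map Subtype.val) (fun b => wickField (v b)) a := by
    intro l v
    induction l with
    | nil => intro a; rfl
    | cons σ l ih =>
      intro a
      change wickField (adField f (sLetter σ) _ a) = adField f σ.1 _ a
      rw [map_adField]
      congr 1
      · ext1 b; exact wickField_sLetter σ b
      · ext1 b; exact ih b
  induction hu using Submodule.span_induction with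
  | mem u hu =>
    rcases hu with ⟨l, rfl⟩ | ⟨l, σ₀, rfl⟩
    · refine ⟨_, spaceS_int_A (l.map Subtype.val) (hlist l), fun a Φ _ => ?_⟩
      simp only [hmap]
      congr! with ν _
      exact (wickField_vecA ν _).symm
    -- Without brackets the string integral of `∂_ν s₀` is not among the generators of `𝒮`; it
    -- equals `-s₀`.
    · rcases eq_or_ne l [] with rfl | hl
      · refine ⟨-σ₀.1, neg_mem σ₀.2, fun a Φ hΦ => ?_⟩
        have := sum_stringInt_pd_field (isRegular_of_mem_spaceS σ₀.2 a) hΦ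
        rw [Pi.neg_apply, Pi.neg_apply, ← this]
        congr! with ν _
        exact (wickField_vecDs σ₀ ν a).symm
      · refine ⟨_, spaceS_int_ds (l.map Subtype.val) (by simpa only [ne_eq, List.map_eq_nil_iff] using hl) (hlist l) σ₀.1 σ₀.2,
          fun a Φ _ => ?_⟩
        simp only [hmap]
        congr! with ν _
        exact (wickField_vecDs σ₀ ν _).symm
  | zero =>
    refine ⟨0, zero_mem _, fun a Φ _ => ?_⟩
    simp only [Pi.zero_apply, map_zero, Finset.sum_apply]
    exact (Finset.sum_eq_zero fun ν _ => stringInt_zero ν).symm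
  | add u w h₁ h₂ hu hw =>
    obtain ⟨s, hs, h⟩ := hu
    obtain ⟨s', hs', h'⟩ := hw
    refine ⟨s + s', add_mem hs hs', fun a Φ hΦ => ?_⟩
    rw [Pi.add_apply, Pi.add_apply, h a hΦ, h' a hΦ, Finset.sum_apply, Finset.sum_apply,
      Finset.sum_apply, ← Finset.sum_add_distrib]
    refine Finset.sum_congr rfl fun ν _ => ?_
    rw [Pi.add_apply, Pi.add_apply, map_add]
    exact (fieldInt_add_apply (isRegular_wickField h₁ ν a) (isRegular_wickField h₂ ν a) hΦ ν).symm
  | smul t u h₁ hu =>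
    obtain ⟨s, hs, h⟩ := hu
    refine ⟨t • s, Submodule.smul_mem _ t hs, fun a Φ hΦ => ?_⟩
    rw [Pi.smul_apply, Pi.smul_apply, h a hΦ, Finset.sum_apply, Finset.sum_apply, Finset.smul_sum]
    refine Finset.sum_congr rfl fun ν _ => ?_
    rw [Pi.smul_apply, Pi.smul_apply, map_smul]
    exact (fieldInt_smul_apply (isRegular_wickField h₁ ν a) hΦ t ν).symm

/-! ### Functional derivatives on `𝒮` and `𝒱` -/

/-- `w ∈ 𝒱` is the derivative of `u ∈ 𝒱` in the direction `v`. -/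
def IsDerivV (v u w : Fin 4 → ι → Wick f c) : Prop :=
  ∀ ν a, Set.EqOn (dirDeriv (fun ν a => wickField (v ν a)) (wickField (u ν a)))
    (wickField (w ν a)) (configs ι c)

/-- `s'` is the derivative of `s` in the direction `v`. -/
def IsDerivS (v : Fin 4 → ι → Wick f c) (s s' : ι → QField ι) : Prop :=
  ∀ a, Set.EqOn (dirDeriv (fun ν a => wickField (v ν a)) (s a)) (s' a) (configs ι c)

variable {v : Fin 4 → ι → Wick f c}

lemma isDerivV_vecA : IsDerivV v vecA v := by
  intro ν a Φ _
  rw [wickField_vecA, dirDeriv_fieldA]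

lemma IsDerivS.vecDs (hv : v ∈ spaceV f c) {σ σ' : spaceS f c} (h : IsDerivS v σ.1 σ'.1) :
    IsDerivV v (vecDs σ) (vecDs σ') := by
  intro ν a Φ hΦ
  rw [wickField_vecDs, wickField_vecDs,
    dirDeriv_fieldPd (isVariation_wickField hv) (isRegular_of_mem_spaceS σ.2 a) ν hΦ]
  rw [fieldPd, fieldPd, h a hΦ]

lemma IsDerivS.adVec (hv : v ∈ spaceV f c) {σ σ' : spaceS f c} (h : IsDerivS v σ.1 σ'.1)
    {u w : Fin 4 → ι → Wick f c} (hu : u ∈ spaceV f c) (huw : IsDerivV v u w) :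
    IsDerivV v (adVec σ u) (adVec σ' u + adVec σ w) := by
  intro ν a Φ hΦ
  rw [Pi.add_apply, Pi.add_apply, map_add, wickField_adVec, wickField_adVec, wickField_adVec,
    dirDeriv_adField (isVariation_wickField hv) (isRegular_of_mem_spaceS σ.2)
      (isRegular_wickField hu ν) a hΦ, Pi.add_apply, Pi.add_apply]
  congr 1
  · exact adField_eqOn (fun b => h b hΦ) (fun b => rfl) a
  · exact adField_eqOn (fun b => rfl) (fun b => huw ν b hΦ) a

lemma IsDerivV.exists_int (hv : v ∈ spaceV f c) {u w : Fin 4 → ι → Wick f c}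
    (hu : u ∈ spaceV f c) (hw : w ∈ spaceV f c) (huw : IsDerivV v u w) :
    ∃ s' ∈ spaceS f c, IsDerivS v (fun a => ∑ ν, fieldInt c ν (wickField (u ν a))) s' := by
  obtain ⟨s', hs', h⟩ := exists_spaceS_eq_int hw
  refine ⟨s', hs', fun a Φ hΦ => ?_⟩
  rw [h a hΦ, dirDeriv_sum (isVariation_wickField hv) _
    (fun ν _ => (isRegular_wickField hu ν a).fieldInt ν) hΦ, Finset.sum_apply, Finset.sum_apply]
  refine Finset.sum_congr rfl fun ν _ => ?_
  rw [dirDeriv_fieldInt (isVariation_wickField hv) (isRegular_wickField hu ν a) ν hΦ, fieldInt,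
    fieldInt, huw ν a hΦ]

/-- The elements of `𝒮` whose derivative in the direction `v` belongs to `𝒮`. -/
def derivableSubmodule (hv : v ∈ spaceV f c) : Submodule ℝ (ι → QField ι) where
  carrier := {s | s ∈ spaceS f c ∧ ∃ s' ∈ spaceS f c, IsDerivS v s s'}
  add_mem' := by
    rintro s t ⟨hs, s', hs', h⟩ ⟨ht, t', ht', h'⟩
    refine ⟨add_mem hs ht, s' + t', add_mem hs' ht', fun a Φ hΦ => ?_⟩
    rw [Pi.add_apply, dirDeriv_add (isVariation_wickField hv) (isRegular_of_mem_spaceS hs a)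
      (isRegular_of_mem_spaceS ht a) hΦ, Pi.add_apply, h a hΦ, h' a hΦ]
    rfl
  zero_mem' := ⟨zero_mem _, 0, zero_mem _, fun a Φ _ => by
    rw [Pi.zero_apply, dirDeriv_zero]⟩
  smul_mem' := by
    rintro r s ⟨hs, s', hs', h⟩
    refine ⟨Submodule.smul_mem _ r hs, r • s', Submodule.smul_mem _ r hs', fun a Φ hΦ => ?_⟩
    rw [Pi.smul_apply, dirDeriv_smul (isVariation_wickField hv) (isRegular_of_mem_spaceS hs a) r hΦ,
      Pi.smul_apply, h a hΦ]
    rfl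

/-- The Leibniz rule is carried through nested brackets. A representative `u` in `𝒱` is kept along
with the field, because both the derivative and the later string integral are taken on
representatives. -/
lemma exists_adList_derivable (hv : v ∈ spaceV f c) {l : List (ι → QField ι)}
    (hl : ∀ s ∈ l, s ∈ derivableSubmodule hv) {b : Fin 4 → ι → QField ι}
    (hb : ∃ u ∈ spaceV f c, (∃ w ∈ spaceV f c, IsDerivV v u w) ∧
      ∀ ν a, wickField (u ν a) = b ν a) :
    ∃ u ∈ spaceV f c, (∃ w ∈ spaceV f c, IsDerivV v u w) ∧
      ∀ ν a, wickField (u ν a) = adList f l (b ν) a := by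
  induction l with
  | nil => exact hb
  | cons s l ih =>
    obtain ⟨u, hu, ⟨w, hw, huw⟩, hub⟩ := ih fun s hs => hl s (by simp [hs])
    obtain ⟨hs, s', hs', h⟩ := hl s (by simp)
    refine ⟨adVec ⟨s, hs⟩ u, adVec_mem _ hu, ⟨_, add_mem (adVec_mem ⟨s', hs'⟩ hu)
      (adVec_mem ⟨s, hs⟩ hw), IsDerivS.adVec (σ := ⟨s, hs⟩) (σ' := ⟨s', hs'⟩) hv h hu huw⟩,
      fun ν a => ?_⟩
    rw [wickField_adVec]
    simp only [hub]
    rfl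

/-- The space `𝒮` is closed under functional derivatives in directions of `𝒱`. -/
lemma exists_isDerivS (hv : v ∈ spaceV f c) {s : ι → QField ι} (hs : s ∈ spaceS f c) :
    ∃ s' ∈ spaceS f c, IsDerivS v s s' := by
  -- The comparison space consists of elements of `𝒮` only, so that elements already known to be
  -- derivable can be used as letters of Wick polynomials. Minimality of `𝒮` does the rest.
  have key : spaceS f c ≤ derivableSubmodule hv := by
    refine sInf_le ⟨fun l hl => ?_, fun l hl0 hl s₀ hs₀ => ?_⟩
    · obtain ⟨u, hu, ⟨w, hw, huw⟩, hub⟩ := exists_adList_derivable hv hl (b := fieldA)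
        ⟨vecA, vecA_mem, ⟨v, hv, isDerivV_vecA⟩, wickField_vecA⟩
      refine ⟨spaceS_int_A l fun s hs => (hl s hs).1, ?_⟩
      simp only [← hub]
      exact huw.exists_int hv hu hw
    · obtain ⟨hs₀', s', hs', h⟩ := hs₀
      obtain ⟨u, hu, ⟨w, hw, huw⟩, hub⟩ := exists_adList_derivable hv hl
        (b := fun ν b => fieldPd ν (s₀ b))
        ⟨vecDs ⟨s₀, hs₀'⟩, vecDs_mem _, ⟨vecDs ⟨s', hs'⟩, vecDs_mem _,
          IsDerivS.vecDs (σ := ⟨s₀, hs₀'⟩) (σ' := ⟨s', hs'⟩) hv h⟩, wickField_vecDs _⟩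
      refine ⟨spaceS_int_ds l hl0 (fun s hs => (hl s hs).1) s₀ hs₀', ?_⟩
      simp only [← hub]
      exact huw.exists_int hv hu hw
  exact (key hs).2

/-- The space `𝒱` is closed under functional derivatives in directions of `𝒱`. -/
lemma exists_isDerivV (hv : v ∈ spaceV f c) {u : Fin 4 → ι → Wick f c} (hu : u ∈ spaceV f c) :
    ∃ w ∈ spaceV f c, IsDerivV v u w := by
  induction hu using spaceV_induction with
  | hA => exact ⟨v, hv, isDerivV_vecA⟩
  | hds σ =>
    obtain ⟨s', hs', h⟩ := exists_isDerivS hv σ.2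
    exact ⟨vecDs ⟨s', hs'⟩, vecDs_mem _, IsDerivS.vecDs (σ' := ⟨s', hs'⟩) hv h⟩
  | had σ u hu ih =>
    obtain ⟨w, hw, h⟩ := ih
    obtain ⟨s', hs', h'⟩ := exists_isDerivS hv σ.2
    exact ⟨_, add_mem (adVec_mem ⟨s', hs'⟩ hu) (adVec_mem σ hw),
      IsDerivS.adVec (σ' := ⟨s', hs'⟩) hv h' hu h⟩
  | h0 => exact ⟨0, zero_mem _, fun ν a Φ _ => by
      rw [Pi.zero_apply, Pi.zero_apply, map_zero, dirDeriv_zero]⟩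
  | hadd u w hu hw ihu ihw =>
    obtain ⟨u', hu', h⟩ := ihu
    obtain ⟨w', hw', h'⟩ := ihw
    refine ⟨u' + w', add_mem hu' hw', fun ν a Φ hΦ => ?_⟩
    rw [Pi.add_apply, Pi.add_apply, Pi.add_apply, Pi.add_apply, map_add, map_add,
      dirDeriv_add (isVariation_wickField hv) (isRegular_wickField hu ν a)
        (isRegular_wickField hw ν a) hΦ, Pi.add_apply, Pi.add_apply, h ν a hΦ, h' ν a hΦ]
  | hsmul t u hu ih =>
    obtain ⟨u', hu', h⟩ := ih
    refine ⟨t • u', Submodule.smul_mem _ t hu', fun ν a Φ hΦ => ?_⟩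
    rw [Pi.smul_apply, Pi.smul_apply, Pi.smul_apply, Pi.smul_apply, map_smul, map_smul,
      dirDeriv_smul (isVariation_wickField hv) (isRegular_wickField hu ν a) t hΦ, Pi.smul_apply,
      Pi.smul_apply, h ν a hΦ]

end StringYM

end

noncomputable section

namespace StringYM

variable {ι : Type*}

/-! ### Two-point obstructions -/

section TwoPoint

open MvPolynomial

/-- The propagators as linear maps. -/
def propagatorLin (φ : Base ι) : LinField →ₗ[DiffPoly] DiffPoly where
  toFun χ := propagator χ φ
  map_add' χ χ' := by
    cases φ
    · simp only [propagator, Prod.fst_add, Prod.snd_add, Pi.add_apply]; ring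
    · simp only [propagator, Prod.fst_add, Pi.add_apply, add_mul, Finset.sum_add_distrib]
  map_smul' p χ := by
    cases φ
    · simp only [propagator, Prod.smul_fst, Prod.smul_snd, Pi.smul_apply, smul_eq_mul,
        RingHom.id_apply]; ring
    · simp only [propagator, Prod.smul_fst, Pi.smul_apply, smul_eq_mul, RingHom.id_apply,
        Finset.mul_sum, mul_assoc]

lemma propagatorLin_apply (φ : Base ι) (χ : LinField) : propagatorLin φ χ = propagator χ φ := rfl

lemma propagatorLin_real_smul (φ : Base ι) (r : ℝ) (χ : LinField) :
    propagatorLin φ (r • χ) = C r * propagatorLin φ χ := by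
  rw [← smul_eq_mul, ← map_smul]
  congr 1
  refine Prod.ext (funext fun ν => ?_) ?_ <;> simp [MvPolynomial.smul_eq_C_mul]

lemma propagatorLin_linPd (φ : Base ι) (μ : Fin 4) (χ : LinField) :
    propagatorLin φ (linPd μ χ) = X μ * propagatorLin φ χ := by
  rw [linPd, map_smul, smul_eq_mul]

lemma propagatorLin_linA_A (ν κ : Fin 4) (b : ι) :
    propagatorLin (.A κ b) (linA ν) = -C (metric ν κ) := by
  simp only [propagatorLin_apply, propagator, linA, metric, Pi.single_apply, zero_mul, sub_zero]
  by_cases h : κ = ν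
  · subst h; simp
  · simp [h, Ne.symm h]

lemma propagatorLin_linA_N (ν : Fin 4) (b : ι) : propagatorLin (.N b) (linA ν) = X ν := by
  simp [propagatorLin_apply, propagator, linA, Pi.single_apply]

lemma propagatorLin_linN_A (κ : Fin 4) (b : ι) : propagatorLin (.A κ b) linN = -X κ := by
  simp [propagatorLin_apply, propagator, linN]

lemma propagatorLin_linN_N (b : ι) : propagatorLin (.N b) linN = 0 := by
  simp [propagatorLin_apply, propagator, linN]

lemma sum_sgn_X_metric (κ : Fin 4) :
    ∑ μ, (C (sgn μ) * (X μ * C (metric μ κ)) : DiffPoly) = X κ := by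
  rw [Finset.sum_eq_single κ]
  · rw [mul_left_comm, ← C_mul]
    have : sgn κ * metric κ κ = 1 := by simp only [metric, sgn]; split_ifs <;> norm_num
    rw [this, C_1, mul_one]
  · intro μ _ h
    simp [metric, h]
  · simp

/-- The longitudinal part `X ν * X κ` produced by `∂^μ F_{μν}` is cancelled by the mixed propagator
of `N` and `A`. A pure contact term remains, which is the only source of a nonzero obstruction with
`A`. -/
lemma propagatorLin_linGauss_A (ν κ : Fin 4) (b : ι) :
    propagatorLin (.A κ b) (linGauss ν) = C (metric ν κ) * box := by
  have h : ∀ μ, propagatorLin (.A κ b) (sgn μ • linPd μ (linF μ ν)) =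
      -(C (metric ν κ) * (C (sgn μ) * X μ ^ 2)) + X ν * (C (sgn μ) * (X μ * C (metric μ κ))) := by
    intro μ
    rw [propagatorLin_real_smul, propagatorLin_linPd, linF, map_sub, propagatorLin_linPd,
      propagatorLin_linPd, propagatorLin_linA_A, propagatorLin_linA_A]
    ring
  rw [linGauss, map_sub, map_neg, map_sum, propagatorLin_linPd, propagatorLin_linN_A]
  simp only [h, Finset.sum_add_distrib, Finset.sum_neg_distrib, ← Finset.mul_sum,
    sum_sgn_X_metric]
  rw [box]
  ring

lemma propagatorLin_linGauss_N (ν : Fin 4) (b : ι) : propagatorLin (.N b) (linGauss ν) = 0 := by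
  have h : ∀ μ, propagatorLin (.N b) (sgn μ • linPd μ (linF μ ν)) = 0 := by
    intro μ
    rw [propagatorLin_real_smul, propagatorLin_linPd, linF, map_sub, propagatorLin_linPd,
      propagatorLin_linPd, propagatorLin_linA_N, propagatorLin_linA_N]
    ring
  rw [linGauss, map_sub, map_neg, map_sum, propagatorLin_linPd, propagatorLin_linN_N]
  simp [h]

lemma propagatorLin_linNull_A (κ : Fin 4) (b : ι) : propagatorLin (.A κ b) linNull = 0 := by
  have h : ∀ μ, propagatorLin (.A κ b) (sgn μ • linPd μ (linA μ)) =
      -(C (sgn μ) * (X μ * C (metric μ κ))) := by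
    intro μ
    rw [propagatorLin_real_smul, propagatorLin_linPd, propagatorLin_linA_A]
    ring
  rw [linNull, map_sub, map_sum, propagatorLin_linN_A]
  simp only [h, Finset.sum_neg_distrib, sum_sgn_X_metric]
  ring

lemma propagatorLin_linNull_N (b : ι) : propagatorLin (.N b) linNull = -box := by
  have h : ∀ μ, propagatorLin (.N b) (sgn μ • linPd μ (linA μ)) = C (sgn μ) * X μ ^ 2 := by
    intro μ
    rw [propagatorLin_real_smul, propagatorLin_linPd, propagatorLin_linA_N]
    ring
  rw [linNull, map_sub, map_sum, propagatorLin_linN_N]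
  simp only [h, box, zero_sub]

lemma box_ne_zero : box ≠ 0 := by
  intro h
  have := congrArg (MvPolynomial.eval (Pi.single 0 1 : Fin 4 → ℝ)) h
  simp [box, Fin.sum_univ_four, sgn] at this

/-- The polynomial ring is a domain and `box` is nonzero, so the quotient by `box` is unique. -/
lemma deltaCoeff_C_mul_box (k : ℝ) : deltaCoeff (C k * box) = C k := by
  have h : box ∣ C k * box := ⟨C k, mul_comm _ _⟩
  rw [deltaCoeff, dif_pos h]
  exact mul_left_cancel₀ box_ne_zero (h.choose_spec.symm.trans (mul_comm _ _))

lemma smear_C (k : ℝ) (Z : Spacetime → ℝ) : smear (C k) Z = k • Z := by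
  classical
  ext x
  by_cases hk : k = 0
  · simp [smear, hk]
  · have : (C k : DiffPoly).support = {0} := by
      rw [C_apply, support_monomial, if_neg hk]
    simp [smear, this, iterPd]

/-- Up to multiples of the Gauss combination, the representative of `∂_μ F_{κλ}` is the plain
derivative, whose contribution cancels in the obstruction. Only the contact terms of the Gauss
combination are left. -/
lemma obstruction_F_A (μ κ l ρ : Fin 4) (b : ι) :
    obstruction μ (linF κ l) (redF μ κ l) (.A ρ b) =
      C ((1 / 3) * (metric μ κ * metric l ρ - metric μ l * metric κ ρ)) * box := by
  rw [obstruction, ← propagatorLin_apply, ← propagatorLin_apply, redF, map_add,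
    propagatorLin_linPd, propagatorLin_real_smul, map_sub, propagatorLin_real_smul,
    propagatorLin_real_smul, propagatorLin_linGauss_A, propagatorLin_linGauss_A, C_mul, C_sub,
    C_mul, C_mul]
  ring

lemma obstruction_F_N (μ κ l : Fin 4) (b : ι) :
    obstruction μ (linF κ l) (redF μ κ l) (.N b) = C 0 * box := by
  rw [obstruction, ← propagatorLin_apply, ← propagatorLin_apply, redF, map_add,
    propagatorLin_linPd, propagatorLin_real_smul, map_sub, propagatorLin_real_smul,
    propagatorLin_real_smul, propagatorLin_linGauss_N, propagatorLin_linGauss_N, C_0]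
  ring

lemma obstruction_A_A (μ ν ρ : Fin 4) (b : ι) :
    obstruction μ (linA ν) (redA μ ν) (.A ρ b) = C 0 * box := by
  rw [obstruction, ← propagatorLin_apply, ← propagatorLin_apply, redA, map_add,
    propagatorLin_linPd, propagatorLin_real_smul, propagatorLin_linNull_A, C_0]
  ring

/-- The obstruction does not vanish, but it is proportional to the metric and therefore drops out
when contracted with an antisymmetric tensor. -/
lemma obstruction_A_N (μ ν : Fin 4) (b : ι) :
    obstruction μ (linA ν) (redA μ ν) (.N b) = C (-(1 / 4 * metric μ ν)) * box := by
  rw [obstruction, ← propagatorLin_apply, ← propagatorLin_apply, redA, map_add,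
    propagatorLin_linPd, propagatorLin_real_smul, propagatorLin_linNull_N, C_neg]
  ring

lemma obstruction_N (μ : Fin 4) (φ : Base ι) :
    obstruction μ linN (linPd μ linN) φ = C 0 * box := by
  rw [obstruction, ← propagatorLin_apply, ← propagatorLin_apply, propagatorLin_linPd, C_0]
  ring

end TwoPoint

/-! ### The contraction of a Wick polynomial -/

section Contraction

variable {S : Submodule ℝ (ι → QField ι)}

/-- The coefficient of the `δ` function in the contraction of `F_{κλ}`. -/
def coeffF (μ κ l : Fin 4) : Base ι → ℝ
  | .A ρ _ => (1 / 3) * (metric μ κ * metric l ρ - metric μ l * metric κ ρ)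
  | .N _ => 0

/-- The coefficient of the `δ` function in the contraction of `A_ν`. -/
def coeffA (μ ν : Fin 4) : Base ι → ℝ
  | .A _ _ => 0
  | .N _ => -(1 / 4 * metric μ ν)

open Classical in
/-- The contraction of a generator as a linear map in the smearing function. -/
def contractLin (τ : Renormalization ι S) (μ : Fin 4) (φ : Base ι) (Φ : Conf ι) :
    Letter ι S → (Spacetime → ℝ) →ₗ[ℝ] (Spacetime → ℝ)
  | .F κ l a => if a = φ.colour then coeffF μ κ l φ • LinearMap.id else 0
  | .A ν a => if a = φ.colour then coeffA μ ν φ • LinearMap.id else 0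
  | .N _ => 0
  | .s _ _ => 0
  | .ds ν σ a => τ.val σ μ ν a φ Φ

lemma contract_eq (τ : Renormalization ι S) (μ : Fin 4) (φ : Base ι) (Φ : Conf ι)
    (Z : Spacetime → ℝ) (χ : Letter ι S) : contract τ μ φ Φ Z χ = contractLin τ μ φ Φ χ Z := by
  cases χ with
  | F κ l a =>
    cases φ <;> simp only [contract, contractLin, coeffF, obstruction_F_A, obstruction_F_N,
      deltaCoeff_C_mul_box, smear_C] <;> split_ifs <;> rfl
  | A ν a =>
    cases φ <;> simp only [contract, contractLin, coeffA, obstruction_A_A, obstruction_A_N,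
      deltaCoeff_C_mul_box, smear_C] <;> split_ifs <;> rfl
  | N a =>
    simp only [contract, contractLin, obstruction_N, deltaCoeff_C_mul_box, smear_C, zero_smul,
      ite_self]
    rfl
  | s σ a => rfl
  | ds ν σ a => rfl

lemma fieldF_antisymm (μ ν : Fin 4) (a : ι) : fieldF μ ν a = -fieldF ν μ a := by
  simp [fieldF]

/-- The trace is `(4 - 1) / 3 = 1`. The factor `1 / 3` is what the condition `∂^μ F_{μν} = -∂_ν N`
on the representatives requires, and it makes the induced variation of `A` exactly `α`. -/
lemma sum_coeffF (ρ : Fin 4) (b : ι) (Y : Fin 4 → Spacetime → ℝ) :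
    ∑ μ, ∑ ν, (sgn μ * sgn ν) • coeffF μ μ ν (.A ρ b) • Y ν = Y ρ := by
  ext x
  simp only [Finset.sum_apply, Pi.smul_apply, smul_eq_mul, coeffF]
  fin_cases ρ <;> simp [Fin.sum_univ_four, sgn, metric] <;> ring

variable [Fintype ι] {f : ι → ι → ι → ℝ} {c : StringFunction}

/-- The universal derivation of Wick polynomials. -/
def wickD : Derivation ℝ (Wick f c) (Letter ι (spaceS f c) →₀ Wick f c) :=
  MvPolynomial.mkDerivation ℝ fun χ => Finsupp.single χ 1

lemma wickD_apply (p : Wick f c) (χ : Letter ι (spaceS f c)) :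
    wickD p χ = MvPolynomial.pderiv χ p := by
  classical
  have h : (Finsupp.lapply χ : _ →ₗ[Wick f c] Wick f c).compDer wickD =
      MvPolynomial.pderiv χ := by
    refine MvPolynomial.derivation_ext fun χ' => ?_
    simp [wickD, MvPolynomial.mkDerivation_X, MvPolynomial.pderiv_X, Finsupp.single_apply,
      Pi.single_apply, eq_comm]
  exact congrArg (fun D : Derivation ℝ (Wick f c) (Wick f c) => D p) h

lemma support_wickD_subset (p : Wick f c) : (wickD p).support ⊆ p.vars := by
  intro χ hχ
  by_contra h
  rw [Finsupp.mem_support_iff, wickD_apply] at hχ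
  exact hχ (MvPolynomial.pderiv_eq_zero_of_notMem_vars h)

/-- The sum of the contractions of the generators, with a spectator `Z`. -/
def contraction (Φ : Conf ι)
    (k : Letter ι (spaceS f c) → (Spacetime → ℝ) →ₗ[ℝ] (Spacetime → ℝ)) (Z : Spacetime → ℝ) :
    (Letter ι (spaceS f c) →₀ Wick f c) →ₗ[ℝ] (Spacetime → ℝ) :=
  Finsupp.lsum ℝ fun χ => k χ ∘ₗ LinearMap.mulLeft ℝ Z ∘ₗ LinearMap.proj Φ ∘ₗ
    (wickField (f := f) (c := c)).toLinearMap

variable {Φ : Conf ι} {k : Letter ι (spaceS f c) → (Spacetime → ℝ) →ₗ[ℝ] (Spacetime → ℝ)}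

lemma contraction_single (Z : Spacetime → ℝ) (χ : Letter ι (spaceS f c)) (p : Wick f c) :
    contraction Φ k Z (Finsupp.single χ p) = k χ (Z * wickField p Φ) := by
  simp [contraction]

lemma contraction_smul (Z : Spacetime → ℝ) (p : Wick f c)
    (w : Letter ι (spaceS f c) →₀ Wick f c) :
    contraction Φ k Z (p • w) = contraction Φ k (Z * wickField p Φ) w := by
  induction w using Finsupp.induction_linear with
  | zero => simp
  | add w w' h h' => rw [smul_add, map_add, map_add, h, h']
  | single χ q =>
    rw [Finsupp.smul_single, contraction_single, contraction_single, smul_eq_mul,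
      map_mul wickField, Pi.mul_apply, mul_assoc]

lemma contraction_add_left (Z Z' : Spacetime → ℝ) (w : Letter ι (spaceS f c) →₀ Wick f c) :
    contraction Φ k (Z + Z') w = contraction Φ k Z w + contraction Φ k Z' w := by
  induction w using Finsupp.induction_linear with
  | zero => simp
  | add w w' h h' => rw [map_add, map_add, map_add, h, h']; abel
  | single χ q => simp only [contraction_single, add_mul, map_add]

lemma contraction_smul_left (r : ℝ) (Z : Spacetime → ℝ)
    (w : Letter ι (spaceS f c) →₀ Wick f c) :
    contraction Φ k (r • Z) w = r • contraction Φ k Z w := by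
  induction w using Finsupp.induction_linear with
  | zero => simp
  | add w w' h h' => rw [map_add, map_add, h, h', smul_add]
  | single χ q => simp only [contraction_single, smul_mul_assoc, map_smul]

lemma contraction_sum_left {κ : Type*} (s : Finset κ) (Z : κ → Spacetime → ℝ)
    (w : Letter ι (spaceS f c) →₀ Wick f c) :
    contraction Φ k (∑ i ∈ s, Z i) w = ∑ i ∈ s, contraction Φ k (Z i) w := by
  classical
  induction s using Finset.induction_on with
  | empty => simpa using contraction_smul_left (Φ := Φ) (k := k) 0 0 w
  | insert i s hi ih => rw [Finset.sum_insert hi, Finset.sum_insert hi, contraction_add_left, ih]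

lemma contraction_wickD_X (Z : Spacetime → ℝ) (χ : Letter ι (spaceS f c)) :
    contraction Φ k Z (wickD (MvPolynomial.X χ)) = k χ Z := by
  have h : wickField (1 : Wick f c) Φ = 1 := by rw [map_one]; rfl
  rw [wickD, MvPolynomial.mkDerivation_X, contraction_single, h, mul_one]

lemma contraction_wickD_mul (Z : Spacetime → ℝ) (p q : Wick f c) :
    contraction Φ k Z (wickD (p * q)) =
      contraction Φ k (Z * wickField p Φ) (wickD q) +
        contraction Φ k (Z * wickField q Φ) (wickD p) := by
  rw [Derivation.leibniz, map_add, contraction_smul, contraction_smul]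

lemma contraction_wickD_smul (Z : Spacetime → ℝ) (r : ℝ) (p : Wick f c) :
    contraction Φ k Z (wickD (r • p)) = r • contraction Φ k Z (wickD p) := by
  rw [← map_smul]
  exact congrArg _ (map_smul (wickD (f := f) (c := c)).toLinearMap r p)

/-- The sum over the variables of `U μ` becomes a linear functional of the universal derivation, so
linearity and the Leibniz rule apply without keeping track of which variables occur. -/
lemma variation_eq_contraction (τ : Renormalization ι (spaceS f c)) (U : Fin 4 → Wick f c)
    (φ : Base ι) (Φ : Conf ι) :
    variation τ U φ Φ = ∑ μ, contraction Φ (contractLin τ μ φ Φ) 1 (wickD (U μ)) := by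
  refine Finset.sum_congr rfl fun μ _ => ?_
  rw [contraction, Finsupp.lsum_apply, Finsupp.sum_of_support_subset _ (support_wickD_subset _) _
    (fun _ _ => map_zero _)]
  refine Finset.sum_congr rfl fun χ _ => ?_
  rw [contract_eq, wickD_apply]
  simp

/-- The contractions of the generators in `𝒱` drop out with an antisymmetric tensor. -/
lemma sum_contraction_eq_zero (τ : Renormalization ι (spaceS f c)) (φ : Base ι) (Φ : Conf ι)
    {u : Fin 4 → ι → Wick f c} (hu : u ∈ spaceV f c) (Z : Fin 4 → Fin 4 → ι → Spacetime → ℝ)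
    (hZ : ∀ μ ν a, Z μ ν a = -Z ν μ a) :
    ∑ μ, ∑ ν, ∑ a, contraction Φ (contractLin τ μ φ Φ) (Z μ ν a) (wickD (u ν a)) = 0 := by
  induction hu using spaceV_induction generalizing Z with
  | hA =>
    refine Finset.sum_eq_zero fun μ _ => Finset.sum_eq_zero fun ν _ =>
      Finset.sum_eq_zero fun a _ => ?_
    rw [vecA, contraction_wickD_X, contractLin]
    split_ifs
    · cases φ
      · simp [coeffA]
      · by_cases h : μ = ν
        · subst h
          have h0 : Z μ μ a = 0 := self_eq_neg.1 (hZ μ μ a)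
          simp [h0]
        · simp [coeffA, metric, h]
    · rfl
  | hds σ =>
    simp only [vecDs, contraction_wickD_X, contractLin]
    set T := ∑ μ, ∑ ν, ∑ a, τ.val σ μ ν a φ Φ (Z μ ν a) with hT
    -- Exchanging the two Lorentz indices leaves the renormalization freedom unchanged and reverses
    -- the sign of the spectator tensor.
    have h : T = -T := by
      conv_lhs => rw [hT, Finset.sum_comm]
      rw [hT, ← Finset.sum_neg_distrib]
      refine Finset.sum_congr rfl fun μ _ => ?_
      rw [← Finset.sum_neg_distrib]
      refine Finset.sum_congr rfl fun ν _ => ?_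
      rw [← Finset.sum_neg_distrib]
      refine Finset.sum_congr rfl fun a _ => ?_
      rw [τ.symm, hZ ν μ a, map_neg]
    exact self_eq_neg.1 h
  | had σ u hu ih =>
    -- Since `s` is inert, the derivation passes it by. Its value and the structure constants are
    -- absorbed into a new spectator tensor, which is again antisymmetric in the Lorentz indices.
    have key := ih (fun μ ν b => ∑ k, ∑ a, f a b k • (Z μ ν k * σ.1 a Φ)) (fun μ ν b => by
      rw [← Finset.sum_neg_distrib]
      refine Finset.sum_congr rfl fun k _ => ?_
      rw [← Finset.sum_neg_distrib]
      refine Finset.sum_congr rfl fun a _ => ?_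
      rw [hZ μ ν k, neg_mul, smul_neg])
    rw [← key]
    refine Finset.sum_congr rfl fun μ _ => Finset.sum_congr rfl fun ν _ => ?_
    have h : ∀ k, contraction Φ (contractLin τ μ φ Φ) (Z μ ν k) (wickD (adVec σ u ν k)) =
        ∑ b, ∑ a, f a b k • contraction Φ (contractLin τ μ φ Φ) (Z μ ν k * σ.1 a Φ)
          (wickD (u ν b)) := by
      intro k
      rw [Finset.sum_comm]
      simp only [adVec, adField, map_sum, contraction_wickD_smul]
      refine Finset.sum_congr rfl fun a _ => Finset.sum_congr rfl fun b _ => ?_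
      have h0 : ∀ Z', contraction Φ (contractLin τ μ φ Φ) Z' (wickD (sLetter σ a)) = 0 := by
        intro Z'; rw [sLetter, contraction_wickD_X]; rfl
      rw [contraction_wickD_mul, h0, add_zero, wickField_sLetter]
    simp only [h, contraction_sum_left, contraction_smul_left]
    rw [Finset.sum_comm]
  | h0 => simp
  | hadd u w _ _ hu hw =>
    simp only [Pi.add_apply, map_add, Finset.sum_add_distrib, hu Z hZ, hw Z hZ, add_zero]
  | hsmul t u _ hu =>
    simp only [Pi.smul_apply, contraction_wickD_smul, ← Finset.smul_sum, hu Z hZ, smul_zero]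

/-- By the product rule either a letter of `α` or the factor `F` is contracted. The contractions of
`α` cancel against the antisymmetric spectator `F`, and with them every dependence on `τ`. -/
lemma variation_mediator (τ : Renormalization ι (spaceS f c)) (α : ℕ → Fin 4 → ι → Wick f c)
    (n : ℕ) (hα : α n ∈ spaceV f c) (φ : Base ι) (Φ : Conf ι) :
    variation τ (mediator α n) φ Φ =
      ∑ μ, ∑ ν, (sgn μ * sgn ν) • coeffF μ μ ν φ • wickField (α n ν φ.colour) Φ := by
  classical
  have h0 := sum_contraction_eq_zero τ φ Φ hα
    (fun μ ν a => (sgn μ * sgn ν) • fieldF μ ν a Φ) (fun μ ν a => by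
      rw [fieldF_antisymm μ ν a, mul_comm (sgn ν), Pi.neg_apply, smul_neg])
  rw [variation_eq_contraction, ← add_zero (∑ μ, ∑ ν, _), ← h0, ← Finset.sum_add_distrib]
  refine Finset.sum_congr rfl fun μ _ => ?_
  rw [← Finset.sum_add_distrib]
  simp only [mediator, map_sum, contraction_wickD_smul]
  refine Finset.sum_congr rfl fun ν _ => ?_
  have hF : ∀ a, wickField (MvPolynomial.X (Letter.F μ ν a) : Wick f c) = fieldF μ ν a := fun a => by
    simp [wickField, Letter.toField]
  simp only [contraction_wickD_mul, contraction_wickD_X, one_mul, hF, smul_add,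
    Finset.sum_add_distrib, contraction_smul_left]
  rw [add_comm]
  congr 1
  simp only [contractLin]
  rw [Finset.sum_eq_single φ.colour]
  · simp
  · intro a _ ha
    simp [ha]
  · simp

lemma variation_mediator_A (τ : Renormalization ι (spaceS f c)) (α : ℕ → Fin 4 → ι → Wick f c)
    (n : ℕ) (hα : α n ∈ spaceV f c) (ρ : Fin 4) (b : ι) :
    variation τ (mediator α n) (.A ρ b) = wickField (α n ρ b) := by
  ext1 Φ
  rw [variation_mediator τ α n hα]
  exact sum_coeffF ρ b fun ν => wickField (α n ν b) Φ

lemma variation_mediator_N (τ : Renormalization ι (spaceS f c)) (α : ℕ → Fin 4 → ι → Wick f c)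
    (n : ℕ) (hα : α n ∈ spaceV f c) (b : ι) : variation τ (mediator α n) (.N b) = 0 := by
  ext1 Φ
  rw [variation_mediator τ α n hα]
  simp [coeffF]

/-- The obstruction map of the mediator field is the functional derivative along `δA_ν = α_ν`. -/
lemma omega_mediator (τ : Renormalization ι (spaceS f c)) (α : ℕ → Fin 4 → ι → Wick f c)
    (n : ℕ) (hα : α n ∈ spaceV f c) (X : QField ι) :
    omega τ (mediator α n) X = dirDeriv (fun ν a => wickField (α n ν a)) X := by
  ext Φ x
  simp only [omega, dirDeriv, variation_mediator_A τ α n hα, variation_mediator_N τ α n hα]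
  rfl

end Contraction

end StringYM

end

noncomputable section

namespace StringYM

/-! ### Exponentials of power series -/

section Order

open Finset PowerSeries

variable {R : Type*} [Ring R]

/-- Agreement of power series up to the order `n`. -/
def EqUpTo (n : ℕ) (y z : R⟦X⟧) : Prop := ∀ m ≤ n, coeff m y = coeff m z

lemma EqUpTo.refl (n : ℕ) (y : R⟦X⟧) : EqUpTo n y y := fun _ _ => rfl

lemma EqUpTo.mul {n : ℕ} {y y' z z' : R⟦X⟧} (hy : EqUpTo n y y') (hz : EqUpTo n z z') :
    EqUpTo n (y * z) (y' * z') := by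
  intro m hm
  rw [coeff_mul, coeff_mul]
  refine sum_congr rfl fun p hp => ?_
  have := mem_antidiagonal.1 hp
  rw [hy p.1 (by omega), hz p.2 (by omega)]

/-- The power series has no terms of order less than `k`. -/
def OrderGE (k : ℕ) (y : R⟦X⟧) : Prop := ∀ m < k, coeff m y = 0

lemma orderGE_zero (y : R⟦X⟧) : OrderGE 0 y := fun _ h => absurd h (Nat.not_lt_zero _)

lemma OrderGE.mul {k l : ℕ} {y z : R⟦X⟧} (hy : OrderGE k y) (hz : OrderGE l z) :
    OrderGE (k + l) (y * z) := by
  intro m hm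
  rw [coeff_mul]
  refine sum_eq_zero fun p hp => ?_
  have := mem_antidiagonal.1 hp
  by_cases h : p.1 < k
  · rw [hy _ h, zero_mul]
  · rw [hz _ (by omega), mul_zero]

lemma OrderGE.neg {k : ℕ} {y : R⟦X⟧} (hy : OrderGE k y) : OrderGE k (-y) := by
  intro m hm
  rw [map_neg, hy m hm, neg_zero]

lemma coeff_sum_range_eq {b : ℕ → R⟦X⟧} (hb : ∀ k, OrderGE k (b k)) {m n : ℕ} (h : m ≤ n) :
    ∑ k ∈ range (m + 1), coeff m (b k) = ∑ k ∈ range (n + 1), coeff m (b k) := by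
  refine sum_subset (range_subset_range.2 (by omega)) fun k _ hk => ?_
  exact hb k m (by simpa using hk)

lemma OrderGE.pow {y : R⟦X⟧} (hy : OrderGE 1 y) (k : ℕ) : OrderGE k (y ^ k) := by
  induction k with
  | zero => exact orderGE_zero _
  | succ k ih => rw [pow_succ]; exact ih.mul hy

end Order

section Exp

open Finset PowerSeries

variable {R : Type*} [Ring R] [Algebra ℝ R]

/-- The commutator with `Y`. -/
def comm (Y Z : R) : R := Y * Z - Z * Y

/-- The divided power `Y^k / k!`. -/
def divPow (Y : R) (k : ℕ) : R := ((k.factorial : ℝ)⁻¹) • Y ^ k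

lemma succ_smul_divPow (Y : R) (k : ℕ) :
    ((k : ℝ) + 1) • divPow Y (k + 1) = Y * divPow Y k := by
  rw [divPow, divPow, smul_smul, mul_smul_comm, ← pow_succ', Nat.factorial_succ, Nat.cast_mul,
    mul_inv, ← mul_assoc, Nat.cast_succ, mul_inv_cancel₀ (by positivity), one_mul]

lemma mul_divPow_comm (Y : R) (k : ℕ) : Y * divPow Y k = divPow Y k * Y := by
  rw [divPow, mul_smul_comm, smul_mul_assoc, ← pow_succ', ← pow_succ]

/-- Writing the degree `n + 1` as the sum of the two degrees is an algebraic substitute for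
differentiating a product of exponentials in a scaling parameter. -/
lemma succ_smul_sum_antidiagonal (g : ℕ → ℕ → R) (n : ℕ) :
    ((n : ℝ) + 1) • ∑ p ∈ antidiagonal (n + 1), g p.1 p.2 =
      ∑ p ∈ antidiagonal n, ((p.1 : ℝ) + 1) • g (p.1 + 1) p.2 +
        ∑ p ∈ antidiagonal n, ((p.2 : ℝ) + 1) • g p.1 (p.2 + 1) := by
  have h : ((n : ℝ) + 1) • ∑ p ∈ antidiagonal (n + 1), g p.1 p.2 =
      ∑ p ∈ antidiagonal (n + 1), (p.1 : ℝ) • g p.1 p.2 +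
        ∑ p ∈ antidiagonal (n + 1), (p.2 : ℝ) • g p.1 p.2 := by
    rw [smul_sum, ← sum_add_distrib]
    refine sum_congr rfl fun p hp => ?_
    rw [← add_smul]
    congr 1
    have := mem_antidiagonal.1 hp
    exact_mod_cast this.symm
  rw [h, Finset.Nat.sum_antidiagonal_succ (f := fun p => (p.1 : ℝ) • g p.1 p.2),
    Finset.Nat.sum_antidiagonal_succ' (f := fun p => (p.2 : ℝ) • g p.1 p.2)]
  simp

/-- This is the homogeneous part of degree `n` of `e^Y Z e^{-Y} = e^{ad Y} Z`. Multiplication by the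
degree brings out one commutator, which is absorbed into `Z`; hence the induction over all `Z`. -/
lemma sum_divPow_conj (Y : R) (n : ℕ) : ∀ Z : R,
    ∑ p ∈ antidiagonal n, divPow Y p.1 * Z * divPow (-Y) p.2 =
      ((n.factorial : ℝ)⁻¹) • (comm Y)^[n] Z := by
  induction n with
  | zero => intro Z; simp [divPow]
  | succ n ih =>
    intro Z
    have h1 : ((n : ℝ) + 1) • ∑ p ∈ antidiagonal (n + 1), divPow Y p.1 * Z * divPow (-Y) p.2 =
        ∑ p ∈ antidiagonal n, divPow Y p.1 * comm Y Z * divPow (-Y) p.2 := by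
      rw [succ_smul_sum_antidiagonal (fun i j => divPow Y i * Z * divPow (-Y) j),
        ← sum_add_distrib]
      refine sum_congr rfl fun p _ => ?_
      rw [← smul_mul_assoc, ← smul_mul_assoc, succ_smul_divPow, ← mul_smul_comm, succ_smul_divPow,
        mul_divPow_comm, comm]
      noncomm_ring
    rw [ih, ← Function.iterate_succ_apply] at h1
    have h2 : ((n : ℝ) + 1) ≠ 0 := by positivity
    rw [← smul_right_inj h2, h1, smul_smul, Nat.factorial_succ, Nat.cast_mul, mul_inv, ← mul_assoc,
      Nat.cast_succ, mul_inv_cancel₀ h2, one_mul]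

/-- Here `d j` plays the role of the derivative of the divided powers of `-Y`, with `Y'` that of
`Y`, and `hd` is the Leibniz rule for them. Multiplying by the degree makes the terms with `d`
cancel and leaves the conjugation of `Y'`. -/
lemma sum_divPow_deriv (Y Y' : R) (d : ℕ → R)
    (hd : ∀ j : ℕ, ((j : ℝ) + 1) • d (j + 1) = -(Y' * divPow (-Y) j + Y * d j)) (n : ℕ) :
    ∑ p ∈ antidiagonal (n + 1), divPow Y p.1 * d p.2 =
      -(((n + 1).factorial : ℝ)⁻¹ • (comm Y)^[n] Y') := by
  have h1 : ((n : ℝ) + 1) • ∑ p ∈ antidiagonal (n + 1), divPow Y p.1 * d p.2 =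
      -∑ p ∈ antidiagonal n, divPow Y p.1 * Y' * divPow (-Y) p.2 := by
    rw [succ_smul_sum_antidiagonal (fun i j => divPow Y i * d j), ← sum_add_distrib,
      ← sum_neg_distrib]
    refine sum_congr rfl fun p _ => ?_
    rw [← smul_mul_assoc, succ_smul_divPow, ← mul_smul_comm, hd, mul_divPow_comm]
    noncomm_ring
  have h2 : ((n : ℝ) + 1) ≠ 0 := by positivity
  rw [← smul_right_inj h2, h1, sum_divPow_conj, smul_neg, smul_smul, Nat.factorial_succ,
    Nat.cast_mul, mul_inv, ← mul_assoc, Nat.cast_succ, mul_inv_cancel₀ h2, one_mul]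

lemma OrderGE.smul {k : ℕ} {y : R⟦X⟧} (hy : OrderGE k y) (r : ℝ) : OrderGE k (r • y) := by
  intro m hm
  rw [coeff_smul, hy m hm, smul_zero]

lemma OrderGE.divPow {y : R⟦X⟧} (hy : OrderGE 1 y) (k : ℕ) : OrderGE k (divPow y k) :=
  (hy.pow k).smul _

lemma expSeries_eqUpTo {y : R⟦X⟧} (hy : OrderGE 1 y) (n : ℕ) :
    EqUpTo n (expSeries y) (∑ k ∈ range (n + 1), divPow y k) := by
  intro m hm
  rw [expSeries, coeff_mk, map_sum, ← coeff_sum_range_eq (fun k => hy.divPow k) hm]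
  rfl

lemma sum_range_range_eq_antidiagonal {M : Type*} [AddCommMonoid M] (g : ℕ → ℕ → M) (n : ℕ)
    (hg : ∀ i j, n < i + j → g i j = 0) :
    ∑ i ∈ range (n + 1), ∑ j ∈ range (n + 1), g i j =
      ∑ m ∈ range (n + 1), ∑ p ∈ antidiagonal m, g p.1 p.2 := by
  have h : ∀ m, ∑ p ∈ antidiagonal m, g p.1 p.2 = ∑ k ∈ range (m + 1), g k (m - k) := fun m =>
    Finset.Nat.sum_antidiagonal_eq_sum_range_succ g m
  simp only [h, Finset.sum_range_diag_flip]
  refine sum_congr rfl fun i hi => ?_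
  symm
  refine sum_subset (range_subset_range.2 (by omega)) fun j _ hj => hg i j ?_
  simp only [mem_range, not_lt] at hj hi
  omega

/-- Without constant term in `y`, each order sees finitely many divided powers. The resulting square
of double indices reduces to the triangle of total degree at most `n`. -/
lemma coeff_conj_expSeries {y : R⟦X⟧} (hy : OrderGE 1 y) (z : R⟦X⟧) (n : ℕ) :
    coeff n (expSeries y * z * expSeries (-y)) =
      ∑ m ∈ range (n + 1), ((m.factorial : ℝ)⁻¹) • coeff n ((comm y)^[m] z) := by
  have h := ((expSeries_eqUpTo hy n).mul (EqUpTo.refl n z)).mul (expSeries_eqUpTo hy.neg n) n le_rfl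
  rw [h, sum_mul, sum_mul, map_sum]
  simp only [mul_sum, map_sum]
  rw [sum_range_range_eq_antidiagonal (fun i j => coeff n (divPow y i * z * divPow (-y) j))]
  · refine sum_congr rfl fun m _ => ?_
    rw [← map_sum, sum_divPow_conj, coeff_smul]
  · intro i j hij
    exact (((hy.divPow i).mul (orderGE_zero z)).mul (hy.neg.divPow j)) n (by omega)

/-- The derivative enters only through the family `d`, since the entrywise derivative obeys the
product rule only on differentiable entries. As `d 0 = 0`, the degrees start at one and the sum has
`n` terms. -/
lemma coeff_expSeries_mul_deriv {y y' e : R⟦X⟧} (hy : OrderGE 1 y) (d : ℕ → R⟦X⟧)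
    (hd0 : d 0 = 0) (hd : ∀ j : ℕ, ((j : ℝ) + 1) • d (j + 1) = -(y' * divPow (-y) j + y * d j))
    (hdo : ∀ j, OrderGE j (d j)) (he : ∀ n, EqUpTo n e (∑ j ∈ range (n + 1), d j)) (n : ℕ) :
    coeff n (expSeries y * e) =
      -∑ m ∈ range n, (((m + 1).factorial : ℝ)⁻¹) • coeff n ((comm y)^[m] y') := by
  have h := (expSeries_eqUpTo hy n).mul (he n) n le_rfl
  rw [h, sum_mul, map_sum]
  simp only [mul_sum, map_sum]
  rw [sum_range_range_eq_antidiagonal (fun i j => coeff n (divPow y i * d j)), sum_range_succ']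
  · rw [← sum_neg_distrib]
    simp only [Finset.Nat.antidiagonal_zero, sum_singleton, hd0, mul_zero, map_zero, add_zero]
    refine sum_congr rfl fun m _ => ?_
    rw [← map_sum, sum_divPow_deriv y y' d hd, map_neg, coeff_smul]
  · intro i j hij
    exact ((hy.divPow i).mul (hdo j)) n (by omega)

/-- This is the conjugation of `1`, for which all commutators vanish. -/
lemma expSeries_mul_neg {y : R⟦X⟧} (hy : OrderGE 1 y) : expSeries y * expSeries (-y) = 1 := by
  ext n
  have h := coeff_conj_expSeries hy 1 n
  rw [mul_one] at h
  rw [h, sum_range_succ']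
  have h0 : ∀ m, (comm y)^[m] (0 : R⟦X⟧) = 0 := fun m => by
    induction m with
    | zero => rfl
    | succ m ih => rw [Function.iterate_succ_apply]; simpa [comm] using ih
  have h1 : ∀ m, (comm y)^[m + 1] (1 : R⟦X⟧) = 0 := fun m => by
    rw [Function.iterate_succ_apply]
    simpa [comm] using h0 m
  simp [h1]

lemma map_expSeries {R' : Type*} [Ring R'] [Algebra ℝ R'] (φ : R →ₐ[ℝ] R') (y : R⟦X⟧) :
    PowerSeries.map (φ : R →+* R') (expSeries y) = expSeries (PowerSeries.map (φ : R →+* R') y) := by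
  ext n
  simp only [expSeries, coeff_map, coeff_mk, ← map_pow, RingHom.coe_coe, map_sum, map_smul]

end Exp

end StringYM

end

noncomputable section

namespace StringYM

open PowerSeries

variable {ι : Type*} [Fintype ι]

/-! ### Matrix-valued functions -/

/-- Matrices of functions on spacetime. -/
abbrev MatFn (d : ℕ) := Matrix (Fin d) (Fin d) (Spacetime → ℂ)

section Matrices

variable {d : ℕ}

/-- The entrywise derivative of a series of matrix-valued functions. -/
def pdSeries (μ : Fin 4) (Z : (MatFn d)⟦X⟧) : (MatFn d)⟦X⟧ :=
  PowerSeries.mk fun n => (coeff n Z).map (pd μ)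

/-- All entries are differentiable. -/
def DiffEntries (Z : (MatFn d)⟦X⟧) : Prop := ∀ n i j, Differentiable ℝ (coeff n Z i j)

lemma pd_mul_complex {f g : Spacetime → ℂ} (hf : Differentiable ℝ f) (hg : Differentiable ℝ g)
    (μ : Fin 4) : pd μ (f * g) = pd μ f * g + f * pd μ g := by
  ext1 x
  simp [pd, fderiv_mul (hf x) (hg x)]
  ring

lemma DiffEntries.smul_real {Z : (MatFn d)⟦X⟧} (hZ : DiffEntries Z) (r : ℝ) :
    DiffEntries (r • Z) := fun n i j => by
  rw [coeff_smul]; exact (hZ n i j).const_smul r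

lemma DiffEntries.smul_complex {Z : (MatFn d)⟦X⟧} (hZ : DiffEntries Z) (r : ℂ) :
    DiffEntries (r • Z) := fun n i j => by
  rw [coeff_smul]; exact (hZ n i j).const_smul r

lemma DiffEntries.neg {Z : (MatFn d)⟦X⟧} (hZ : DiffEntries Z) : DiffEntries (-Z) := fun n i j => by
  rw [map_neg]; exact (hZ n i j).neg

lemma coeff_mul_apply_eq_sum (Y Z : (MatFn d)⟦X⟧) (n : ℕ) (i j : Fin d) :
    coeff n (Y * Z) i j =
      ∑ p ∈ Finset.HasAntidiagonal.antidiagonal n, ∑ k, coeff p.1 Y i k * coeff p.2 Z k j := by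
  rw [coeff_mul, Matrix.sum_apply]
  rfl

lemma DiffEntries.mul {Y Z : (MatFn d)⟦X⟧} (hY : DiffEntries Y) (hZ : DiffEntries Z) :
    DiffEntries (Y * Z) := fun n i j => by
  rw [coeff_mul_apply_eq_sum]
  exact Differentiable.sum fun p _ => Differentiable.sum fun k _ => (hY _ _ _).mul (hZ _ _ _)

lemma DiffEntries.one : DiffEntries (1 : (MatFn d)⟦X⟧) := fun n i j => by
  classical
  rw [coeff_one]
  split_ifs
  · rw [Matrix.one_apply]
    split_ifs
    · exact differentiable_const 1
    · exact differentiable_const 0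
  · exact differentiable_const 0

lemma DiffEntries.divPow {Y : (MatFn d)⟦X⟧} (hY : DiffEntries Y) (k : ℕ) :
    DiffEntries (divPow Y k) := by
  refine DiffEntries.smul_real ?_ _
  induction k with
  | zero => exact DiffEntries.one
  | succ k ih => rw [pow_succ]; exact ih.mul hY

lemma pdSeries_mul {Y Z : (MatFn d)⟦X⟧} (hY : DiffEntries Y) (hZ : DiffEntries Z) (μ : Fin 4) :
    pdSeries μ (Y * Z) = pdSeries μ Y * Z + Y * pdSeries μ Z := by
  ext1 n
  ext1 i j
  rw [map_add, Matrix.add_apply, coeff_mul_apply_eq_sum, coeff_mul_apply_eq_sum,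
    ← Finset.sum_add_distrib]
  simp only [pdSeries, coeff_mk, Matrix.map_apply]
  rw [coeff_mul_apply_eq_sum, pd_sum _ (fun p _ => Differentiable.sum fun k _ =>
    (hY _ _ _).mul (hZ _ _ _))]
  refine Finset.sum_congr rfl fun p _ => ?_
  rw [pd_sum _ (fun k _ => (hY _ _ _).mul (hZ _ _ _)), ← Finset.sum_add_distrib]
  exact Finset.sum_congr rfl fun k _ => pd_mul_complex (hY _ _ _) (hZ _ _ _) μ

lemma pdSeries_smul_real {Z : (MatFn d)⟦X⟧} (hZ : DiffEntries Z) (r : ℝ) (μ : Fin 4) :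
    pdSeries μ (r • Z) = r • pdSeries μ Z := by
  ext1 n
  ext1 i j
  simp only [pdSeries, coeff_mk, coeff_smul, Matrix.map_apply, Matrix.smul_apply]
  exact pd_smul (hZ n i j) r μ

lemma pdSeries_smul_complex {Z : (MatFn d)⟦X⟧} (hZ : DiffEntries Z) (r : ℂ) (μ : Fin 4) :
    pdSeries μ (r • Z) = r • pdSeries μ Z := by
  ext1 n
  ext1 i j
  simp only [pdSeries, coeff_mk, coeff_smul, Matrix.map_apply, Matrix.smul_apply]
  ext x
  simp [pd, fderiv_const_smul (hZ n i j x)]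

lemma pdSeries_neg {Z : (MatFn d)⟦X⟧} (hZ : DiffEntries Z) (μ : Fin 4) :
    pdSeries μ (-Z) = -pdSeries μ Z := by
  simpa using pdSeries_smul_real hZ (-1) μ

lemma pdSeries_one (μ : Fin 4) : pdSeries μ (1 : (MatFn d)⟦X⟧) = 0 := by
  classical
  ext1 n
  ext1 i j
  simp only [pdSeries, coeff_mk, Matrix.map_apply, coeff_one, map_zero, Matrix.zero_apply]
  have h1 : pd μ (1 : Spacetime → ℂ) = 0 := by
    ext x
    exact congrArg (fun L : Spacetime →L[ℝ] ℂ => L (coordVec μ)) (fderiv_const_apply (𝕜 := ℝ) (1 : ℂ))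
  split_ifs
  · rw [Matrix.one_apply]
    split_ifs
    · exact h1
    · exact pd_zero μ
  · exact pd_zero μ

lemma OrderGE.pdSeries {k : ℕ} {Z : (MatFn d)⟦X⟧} (hZ : OrderGE k Z) (μ : Fin 4) :
    OrderGE k (pdSeries μ Z) := by
  intro m hm
  ext1 i j
  simp only [StringYM.pdSeries, coeff_mk, hZ m hm, Matrix.map_apply, Matrix.zero_apply]
  exact pd_zero μ

/-- The derivative of an exponential. -/
lemma coeff_expSeries_mul_pdSeries {y : (MatFn d)⟦X⟧} (hy : OrderGE 1 y) (hd : DiffEntries y)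
    (μ : Fin 4) (n : ℕ) :
    coeff n (expSeries y * pdSeries μ (expSeries (-y))) =
      -∑ m ∈ Finset.range n, (((m + 1).factorial : ℝ)⁻¹) •
        coeff n ((comm y)^[m] (pdSeries μ y)) := by
  refine coeff_expSeries_mul_deriv hy (fun j => pdSeries μ (divPow (-y) j)) ?_ ?_ ?_ ?_ n
  · simp [divPow, pdSeries_one]
  · intro j
    rw [← pdSeries_smul_real (hd.neg.divPow _), succ_smul_divPow,
      pdSeries_mul hd.neg (hd.neg.divPow j), pdSeries_neg hd]
    noncomm_ring
  · exact fun j => (hy.neg.divPow j).pdSeries μ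
  · intro n m hm
    have h := expSeries_eqUpTo hy.neg n m hm
    ext1 i j
    rw [map_sum, Matrix.sum_apply]
    simp only [pdSeries, coeff_mk, Matrix.map_apply, h]
    rw [map_sum, Matrix.sum_apply, pd_sum _ (fun k _ => hd.neg.divPow k m i j)]

end Matrices

/-! ### Representations of Lie-algebra-valued functions -/

section Rep

variable {𝔤 : Type*} [LieRing 𝔤] [LieAlgebra ℝ 𝔤] {d : ℕ} (π : HermitianRep 𝔤 d)
  (ξ : Module.Basis ι ℝ 𝔤)

/-- The matrix-valued function `∑_a w_a π(ξ_a)`. -/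
def repMat : (ι → Spacetime → ℝ) →ₗ[ℝ] MatFn d where
  toFun w := Matrix.of fun i j x => ∑ a, ((w a x : ℝ) : ℂ) * π.toFun (ξ a) i j
  map_add' w w' := by
    ext i j x
    simp [add_mul, Finset.sum_add_distrib]
  map_smul' r w := by
    ext i j x
    simp [Finset.mul_sum, mul_assoc]

lemma repMat_apply (w : ι → Spacetime → ℝ) (i j : Fin d) (x : Spacetime) :
    repMat π ξ w i j x = π.toFun (∑ a, w a x • ξ a) i j := by
  simp [repMat, map_sum, Matrix.sum_apply]

lemma repMat_mul_apply (s w : ι → Spacetime → ℝ) (i j : Fin d) (x : Spacetime) :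
    (repMat π ξ s * repMat π ξ w) i j x =
      (π.toFun (∑ a, s a x • ξ a) * π.toFun (∑ a, w a x • ξ a)) i j := by
  rw [Matrix.mul_apply, Finset.sum_apply, Matrix.mul_apply]
  simp only [Pi.mul_apply, repMat_apply]

/-- At each point this is `π.map_lie` for the Lie algebra elements with the given components,
expanded in structure constants. -/
lemma repMat_adField (s w : ι → Spacetime → ℝ) :
    repMat π ξ (adField (strConst ξ) s w) =
      Complex.I • (repMat π ξ s * repMat π ξ w - repMat π ξ w * repMat π ξ s) := by
  ext i j x
  have h : ∑ k, adField (strConst ξ) s w k x • ξ k = ⁅∑ a, s a x • ξ a, ∑ b, w b x • ξ b⁆ := by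
    rw [sum_lie]
    simp only [lie_sum, smul_lie, lie_smul]
    have h1 : ∀ a b, ⁅ξ a, ξ b⁆ = ∑ k, strConst ξ a b k • ξ k := fun a b => (ξ.sum_repr _).symm
    simp only [h1, adField, Finset.sum_apply, Pi.smul_apply, Pi.mul_apply, Finset.sum_smul,
      Finset.smul_sum]
    rw [Finset.sum_comm]
    refine Finset.sum_congr rfl fun a _ => ?_
    rw [Finset.sum_comm]
    refine Finset.sum_congr rfl fun b _ => Finset.sum_congr rfl fun k _ => ?_
    rw [smul_smul, smul_smul, smul_eq_mul]
    congr 1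
    ring
  rw [repMat_apply, h, π.map_lie, Matrix.smul_apply, Matrix.smul_apply, Pi.smul_apply,
    Matrix.sub_apply, Matrix.sub_apply, Pi.sub_apply, repMat_mul_apply, repMat_mul_apply]

lemma repMat_pd {w : ι → Spacetime → ℝ} (hw : ∀ a, Differentiable ℝ (w a)) (μ : Fin 4) :
    (repMat π ξ w).map (pd μ) = repMat π ξ fun a => pd μ (w a) := by
  ext i j x
  have h : ∀ a, HasFDerivAt (fun x => ((w a x : ℝ) : ℂ) * π.toFun (ξ a) i j)
      ((π.toFun (ξ a) i j) • (Complex.ofRealCLM ∘L fderiv ℝ (w a) x)) x := fun a =>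
    (Complex.ofRealCLM.hasFDerivAt.comp x (hw a x).hasFDerivAt).mul_const _
  have h2 := HasFDerivAt.fun_sum fun a (_ : a ∈ Finset.univ) => h a
  change fderiv ℝ (fun x => ∑ a, ((w a x : ℝ) : ℂ) * π.toFun (ξ a) i j) x (coordVec μ) = _
  rw [h2.fderiv]
  simp [repMat, pd, mul_comm]

lemma differentiable_repMat {w : ι → Spacetime → ℝ} (hw : ∀ a, Differentiable ℝ (w a))
    (i j : Fin d) : Differentiable ℝ (repMat π ξ w i j) := by
  change Differentiable ℝ fun x => ∑ a, ((w a x : ℝ) : ℂ) * π.toFun (ξ a) i j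
  refine Differentiable.fun_sum fun a _ => ?_
  exact (Complex.ofRealCLM.differentiable.comp (hw a)).mul_const _

/-- The series of matrix-valued functions of a series of Lie-algebra-valued functions. -/
def repFnSeries (W : ι → (Spacetime → ℝ)⟦X⟧) : (MatFn d)⟦X⟧ :=
  PowerSeries.mk fun n => repMat π ξ fun a => coeff n (W a)

lemma coeff_adField {R : Type*} [CommRing R] [Algebra ℝ R] (f : ι → ι → ι → ℝ)
    (s w : ι → R⟦X⟧) (n : ℕ) (k : ι) :
    coeff n (adField f s w k) = ∑ p ∈ Finset.HasAntidiagonal.antidiagonal n,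
      adField f (fun a => coeff p.1 (s a)) (fun a => coeff p.2 (w a)) k := by
  simp only [adField, map_sum, coeff_smul, coeff_mul, Finset.smul_sum]
  conv_lhs => enter [2, a]; rw [Finset.sum_comm]
  rw [Finset.sum_comm]

/-- The factor `i` converts commutators with `iγ` into the adjoint action, so conjugation by
`e^{iγ}` can be computed in the Lie algebra, independently of `π`. -/
lemma comm_repFnSeries (s w : ι → (Spacetime → ℝ)⟦X⟧) :
    comm (Complex.I • repFnSeries π ξ s) (repFnSeries π ξ w) =
      repFnSeries π ξ (adField (strConst ξ) s w) := by
  ext1 n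
  rw [comm, smul_mul_assoc, mul_smul_comm, ← smul_sub, coeff_smul, map_sub, coeff_mul, coeff_mul,
    ← Finset.Nat.sum_antidiagonal_swap (f := fun p => coeff p.1 (repFnSeries π ξ w) *
      coeff p.2 (repFnSeries π ξ s)), ← Finset.sum_sub_distrib, Finset.smul_sum]
  simp only [repFnSeries, coeff_mk, coeff_adField, Prod.fst_swap, Prod.snd_swap, ← repMat_adField]
  rw [← map_sum]
  congr 1
  ext1 a
  simp

lemma iterate_comm_repFnSeries (s w : ι → (Spacetime → ℝ)⟦X⟧) (m : ℕ) :
    (comm (Complex.I • repFnSeries π ξ s))^[m] (repFnSeries π ξ w) =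
      repFnSeries π ξ ((adField (strConst ξ) s)^[m] w) := by
  induction m generalizing w with
  | zero => rfl
  | succ m ih => rw [Function.iterate_succ_apply, comm_repFnSeries, ih, Function.iterate_succ_apply]

lemma iterate_comm_smul (y z : (MatFn d)⟦X⟧) (r : ℂ) (m : ℕ) :
    (comm y)^[m] (r • z) = r • (comm y)^[m] z := by
  induction m generalizing z with
  | zero => rfl
  | succ m ih =>
    rw [Function.iterate_succ_apply, Function.iterate_succ_apply, ← ih]
    congr 1
    rw [comm, comm, mul_smul_comm, smul_mul_assoc, smul_sub]

end Rep

end StringYM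

end

noncomputable section

namespace StringYM

open PowerSeries

variable {ι : Type*}

/-! ### The dressing factor -/

/-- The power series with given coefficients. -/
def seriesOf (γ : ℕ → ι → QField ι) : ι → (QField ι)⟦X⟧ := fun a => PowerSeries.mk fun n => γ n a

/-- Evaluation of matrix-valued fields at a configuration. -/
def evMat (d : ℕ) (Φ : Conf ι) : MatField ι d →ₐ[ℝ] MatFn d :=
  (Pi.evalAlgHom ℝ (fun _ : Conf ι => Spacetime → ℂ) Φ).mapMatrix

/-- Evaluation of matrix-valued fields at a configuration and a point. -/
def evMatAt (d : ℕ) (Φ : Conf ι) (x : Spacetime) : MatField ι d →ₐ[ℝ] Matrix (Fin d) (Fin d) ℂ :=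
  ((Pi.evalAlgHom ℝ (fun _ : Spacetime => ℂ) x).comp
    (Pi.evalAlgHom ℝ (fun _ : Conf ι => Spacetime → ℂ) Φ)).mapMatrix

/-- Evaluation of series of fields at a configuration. -/
def evSeries (Φ : Conf ι) : (QField ι)⟦X⟧ →ₐ[ℝ] (Spacetime → ℝ)⟦X⟧ :=
  PowerSeries.mapAlgHom (Pi.evalAlgHom ℝ (fun _ : Conf ι => Spacetime → ℝ) Φ)

@[simp]
lemma coeff_evSeries (Φ : Conf ι) (Y : (QField ι)⟦X⟧) (n : ℕ) :
    coeff n (evSeries Φ Y) = coeff n Y Φ := by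
  rw [evSeries, mapAlgHom_apply, coeff_map]
  rfl

lemma map_evMat_smul_I {d : ℕ} (Φ : Conf ι) (Y : (MatField ι d)⟦X⟧) :
    PowerSeries.map (evMat d Φ : MatField ι d →+* MatFn d) (Complex.I • Y) =
      Complex.I • PowerSeries.map (evMat d Φ : MatField ι d →+* MatFn d) Y := by
  ext n i j x
  rfl

lemma map_evMat_matPd {d : ℕ} (Φ : Conf ι) (μ : Fin 4) (Y : (MatField ι d)⟦X⟧) :
    PowerSeries.map (evMat d Φ : MatField ι d →+* MatFn d) (matPd μ Y) =
      pdSeries μ (PowerSeries.map (evMat d Φ : MatField ι d →+* MatFn d) Y) := by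
  ext n i j x
  simp only [coeff_map, matPd, pdSeries, coeff_mk]
  rfl

variable [Fintype ι]

/-- The order `n` of the gauge transform `e^{iγ} (g A_μ + i ∂_μ) e^{-iγ}`. -/
def gaugeCoeff (f : ι → ι → ι → ℝ) (γ : ℕ → ι → QField ι) (μ : Fin 4) (n : ℕ) (a : ι) : QField ι :=
  ∑ m ∈ Finset.range (n + 1), ((m.factorial : ℝ)⁻¹) •
      coeff n ((adField f (seriesOf γ))^[m] (fun b => X * C (fieldA μ b)) a) +
    ∑ m ∈ Finset.range n, (((m + 1).factorial : ℝ)⁻¹) •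
      coeff n ((adField f (seriesOf γ))^[m] (seriesOf fun n b => fieldPd μ (γ n b)) a)

lemma map_iterate_adField {R R' : Type*} [CommRing R] [Algebra ℝ R] [CommRing R'] [Algebra ℝ R']
    (f : ι → ι → ι → ℝ) (φ : R →ₐ[ℝ] R') (s v : ι → R) (m : ℕ) :
    (fun a => φ ((adField f s)^[m] v a)) =
      (adField f fun a => φ (s a))^[m] fun a => φ (v a) := by
  induction m with
  | zero => rfl
  | succ m ih =>
    rw [Function.iterate_succ_apply', Function.iterate_succ_apply', ← ih]
    ext1 a
    exact map_adField f φ _ _ a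

variable {𝔤 : Type*} [LieRing 𝔤] [LieAlgebra ℝ 𝔤] {d : ℕ} (π : HermitianRep 𝔤 d)
  (ξ : Module.Basis ι ℝ 𝔤)

lemma coeff_repSeries_apply (Y : ι → (QField ι)⟦X⟧) (n : ℕ) (i j : Fin d) (Φ : Conf ι) :
    coeff n (repSeries π ξ Y) i j Φ = repMat π ξ (fun a => coeff n (Y a) Φ) i j := by
  rw [repSeries, coeff_mk]
  rfl

lemma map_evMat_repSeries (Φ : Conf ι) (Y : ι → (QField ι)⟦X⟧) :
    PowerSeries.map (evMat d Φ : MatField ι d →+* MatFn d) (repSeries π ξ Y) =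
      repFnSeries π ξ fun a => evSeries Φ (Y a) := by
  ext1 n
  rw [coeff_map, repFnSeries, coeff_mk]
  simp only [coeff_evSeries]
  ext1 i j
  exact coeff_repSeries_apply π ξ Y n i j Φ

lemma repSeries_X_mul (Y : ι → (QField ι)⟦X⟧) :
    X * repSeries π ξ Y = repSeries π ξ fun a => X * Y a := by
  ext n i j Φ x
  cases n with
  | zero => simp [repSeries]
  | succ n => simp [repSeries, coeff_succ_X_mul]

lemma map_evMat_dressingFactor (γ : ℕ → ι → QField ι) (Φ : Conf ι) :
    PowerSeries.map (evMat d Φ : MatField ι d →+* MatFn d) (dressingFactor π ξ γ) =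
      expSeries (Complex.I • repFnSeries π ξ fun a => evSeries Φ (seriesOf γ a)) := by
  rw [dressingFactor, map_expSeries, map_evMat_smul_I, map_evMat_repSeries]
  rfl

lemma dressingFactor_neg (γ : ℕ → ι → QField ι) :
    dressingFactor π ξ (-γ) =
      expSeries (-(Complex.I • repSeries π ξ fun a => PowerSeries.mk fun n => γ n a)) := by
  rw [dressingFactor, ← smul_neg]
  congr 2
  ext n i j Φ x
  simp [repSeries]

lemma map_evMat_dressingFactor_neg (γ : ℕ → ι → QField ι) (Φ : Conf ι) :
    PowerSeries.map (evMat d Φ : MatField ι d →+* MatFn d) (dressingFactor π ξ (-γ)) =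
      expSeries (-(Complex.I • repFnSeries π ξ fun a => evSeries Φ (seriesOf γ a))) := by
  rw [dressingFactor_neg, map_expSeries, map_neg, map_evMat_smul_I, map_evMat_repSeries]
  rfl

lemma dressingFactor_mul_neg {γ : ℕ → ι → QField ι} (hγ : γ 0 = 0) :
    dressingFactor π ξ γ * dressingFactor π ξ (-γ) = 1 := by
  rw [dressingFactor_neg, dressingFactor]
  refine expSeries_mul_neg ?_
  intro m hm
  obtain rfl : m = 0 := by omega
  ext i j Φ x
  simp [repSeries, hγ]

/-- Evaluation at a configuration and a point is an algebra homomorphism and commutes with the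
exponential. The dressing factor at `x` therefore depends only on the values of `γ` at `x`, which
are localized. -/
lemma stringLocalized_dressingFactor {c : StringFunction} {γ : ℕ → ι → QField ι}
    (hγ : ∀ n a, IsRegular c (γ n a)) : StringLocalized c (dressingFactor π ξ γ) := by
  intro n i j x ε hε Φ hΦ Ψ hΨ h
  have key : ∀ Φ : Conf ι, coeff n (dressingFactor π ξ γ) i j Φ x =
      coeff n (expSeries (PowerSeries.mk fun m => Complex.I • Matrix.of fun i j =>
        ∑ a, ((γ m a Φ x : ℝ) : ℂ) * π.toFun (ξ a) i j)) i j := by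
    intro Φ
    have h1 : PowerSeries.map (evMatAt d Φ x : MatField ι d →+* _) (Complex.I • repSeries π ξ
        fun a => PowerSeries.mk fun n => γ n a) = PowerSeries.mk fun m => Complex.I •
          Matrix.of fun i j => ∑ a, ((γ m a Φ x : ℝ) : ℂ) * π.toFun (ξ a) i j := by
      ext n i j
      simp only [coeff_map, coeff_smul, coeff_mk, repSeries]
      rfl
    rw [← h1, ← map_expSeries, coeff_map]
    rfl
  rw [key, key]
  simp only [(hγ _ _).localized x ε hε Φ hΦ Ψ hΨ h]

/-- The gauge transform in terms of the adjoint action. -/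
lemma coeff_gaugeTransform {γ : ℕ → ι → QField ι} (hγ : γ 0 = 0) {Φ : Conf ι}
    (hd : ∀ n a, Differentiable ℝ (γ n a Φ)) (μ : Fin 4) (n : ℕ) (i j : Fin d) :
    (coeff n (dressingFactor π ξ γ * (X * repSeries π ξ fun a => C (fieldA μ a)) *
        dressingFactor π ξ (-γ) +
      Complex.I • (dressingFactor π ξ γ * matPd μ (dressingFactor π ξ (-γ)))) :
        MatField ι d) i j Φ =
      repMat π ξ (fun a => gaugeCoeff (strConst ξ) γ μ n a Φ) i j := by
  set y := repFnSeries π ξ fun a => evSeries Φ (seriesOf γ a) with hy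
  have hyo : OrderGE 1 (Complex.I • y) := by
    intro m hm
    obtain rfl : m = 0 := by omega
    have : (fun a => coeff 0 (evSeries Φ (seriesOf γ a))) = 0 := by
      ext1 a
      rw [coeff_evSeries, seriesOf, coeff_mk, hγ]
      rfl
    rw [coeff_smul, hy, repFnSeries, coeff_mk, this, map_zero, smul_zero]
  have hyd : DiffEntries y := by
    intro m i j
    rw [hy, repFnSeries, coeff_mk]
    refine differentiable_repMat π ξ (fun a => ?_) i j
    rw [coeff_evSeries, seriesOf, coeff_mk]
    exact hd m a
  have hpd : pdSeries μ y =
      repFnSeries π ξ fun a => evSeries Φ (seriesOf (fun n b => fieldPd μ (γ n b)) a) := by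
    ext1 m
    rw [pdSeries, coeff_mk, hy, repFnSeries, coeff_mk, repFnSeries, coeff_mk, repMat_pd]
    · simp only [coeff_evSeries, seriesOf, coeff_mk]
      rfl
    · intro a
      rw [coeff_evSeries, seriesOf, coeff_mk]
      exact hd m a
  -- The comparison is made after evaluation at `Φ`, since differentiability, which the derivative
  -- of the exponential needs, is available only on configurations.
  suffices h : coeff n (PowerSeries.map (evMat d Φ : MatField ι d →+* MatFn d)
      (dressingFactor π ξ γ * (X * repSeries π ξ fun a => C (fieldA μ a)) *
        dressingFactor π ξ (-γ) +
      Complex.I • (dressingFactor π ξ γ * matPd μ (dressingFactor π ξ (-γ))))) =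
      repMat π ξ (fun a => gaugeCoeff (strConst ξ) γ μ n a Φ) by
    rw [← h, coeff_map]
    rfl
  rw [repSeries_X_mul, map_add, map_mul, map_mul, map_evMat_smul_I, map_mul, map_evMat_matPd,
    map_evMat_dressingFactor, map_evMat_dressingFactor_neg, map_evMat_repSeries,
    ← hy, map_add, coeff_smul, coeff_conj_expSeries hyo,
    coeff_expSeries_mul_pdSeries hyo (hyd.smul_complex _), pdSeries_smul_complex hyd, hpd]
  simp only [iterate_comm_smul]
  simp only [hy, iterate_comm_repFnSeries, ← map_iterate_adField]
  simp only [coeff_smul, repFnSeries, coeff_mk, coeff_evSeries]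
  -- The two factors `i`, one in front of the derivative and one in the exponent, turn the minus
  -- sign of the exponential formula into the plus sign of `gaugeCoeff`.
  rw [smul_neg, Finset.smul_sum]
  simp only [smul_comm Complex.I (_ : ℝ) (_ : MatFn d), smul_smul Complex.I Complex.I, Complex.I_mul_I,
    neg_smul, one_smul, smul_neg, Finset.sum_neg_distrib, neg_neg]
  simp only [← map_smul, ← map_sum, ← map_add]
  congr 1
  ext1 a
  simp [gaugeCoeff, Finset.sum_apply]

end StringYM

end

noncomputable section

namespace StringYM

open PowerSeries

/-! ### Recursive choice -/

/-- The sequence defined by a recursion on its initial segments. -/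
def recSeq {M : Type*} [Zero M] (F : ℕ → (ℕ → M) → M) : ℕ → M
  | n => F n fun j => if _ : j < n then recSeq F j else 0

/-- The step at `n` sees the sequence truncated below `n` and padded with zeros. Each application
has to show afterwards that the truncation is harmless. -/
lemma exists_seq_of_step {M : Type*} [Zero M] (Q : ℕ → (ℕ → M) → M → Prop)
    (h : ∀ n a, ∃ x, Q n a x) :
    ∃ s : ℕ → M, ∀ n, Q n (fun j => if j < n then s j else 0) (s n) := by
  choose F hF using h
  refine ⟨recSeq F, fun n => ?_⟩
  have h1 : recSeq F n = F n fun j => if j < n then recSeq F j else 0 := by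
    rw [recSeq]
    simp
  conv => arg 3; rw [h1]
  exact hF n _

/-! ### The gauge parameter -/

section Gamma

variable {ι : Type*} [Fintype ι] {f : ι → ι → ι → ℝ} {c : StringFunction}

/-- The fields of vector-valued Wick polynomials. -/
def wickVec : (Fin 4 → ι → Wick f c) →ₗ[ℝ] (Fin 4 → ι → QField ι) where
  toFun u ν a := wickField (u ν a)
  map_add' u w := by ext1 ν; ext1 a; exact map_add wickField _ _
  map_smul' r u := by ext1 ν; ext1 a; exact map_smul wickField _ _

variable (f c) in
/-- The vector fields that are represented by elements of `𝒱`. -/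
def fieldV : Submodule ℝ (Fin 4 → ι → QField ι) := (spaceV f c).map wickVec

lemma fieldV_isRegular {w : Fin 4 → ι → QField ι} (hw : w ∈ fieldV f c) (ν : Fin 4) (a : ι) :
    IsRegular c (w ν a) := by
  obtain ⟨u, hu, rfl⟩ := hw
  exact isRegular_wickField hu ν a

lemma fieldA_mem_fieldV : fieldA ∈ fieldV f c :=
  ⟨vecA, vecA_mem, by ext1 ν; ext1 a; exact wickField_vecA ν a⟩

lemma fieldPd_mem_fieldV {s : ι → QField ι} (hs : s ∈ spaceS f c) :
    (fun ν a => fieldPd ν (s a)) ∈ fieldV f c :=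
  ⟨vecDs ⟨s, hs⟩, vecDs_mem _, by ext1 ν; ext1 a; exact wickField_vecDs _ ν a⟩

lemma adField_mem_fieldV {s : ι → QField ι} (hs : s ∈ spaceS f c) {w : Fin 4 → ι → QField ι}
    (hw : w ∈ fieldV f c) : (fun ν => adField f s (w ν)) ∈ fieldV f c := by
  obtain ⟨u, hu, rfl⟩ := hw
  exact ⟨adVec ⟨s, hs⟩ u, adVec_mem _ hu, by ext1 ν; ext1 a; exact wickField_adVec _ u ν a⟩

lemma iterate_adField_mem_fieldV {γ : ℕ → ι → QField ι} (hγ : ∀ n, γ n ∈ spaceS f c)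
    {w : Fin 4 → ι → (QField ι)⟦X⟧} (hw : ∀ n, (fun ν a => coeff n (w ν a)) ∈ fieldV f c)
    (m n : ℕ) :
    (fun ν a => coeff n ((adField f (seriesOf γ))^[m] (w ν) a)) ∈ fieldV f c := by
  induction m generalizing n with
  | zero => exact hw n
  | succ m ih =>
    have h : (fun ν a => coeff n ((adField f (seriesOf γ))^[m + 1] (w ν) a)) =
        ∑ p ∈ Finset.HasAntidiagonal.antidiagonal n, fun ν => adField f (γ p.1)
          fun a => coeff p.2 ((adField f (seriesOf γ))^[m] (w ν) a) := by
      ext1 ν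
      ext1 a
      rw [Function.iterate_succ_apply', coeff_adField, Finset.sum_apply, Finset.sum_apply]
      simp only [seriesOf, coeff_mk]
    rw [h]
    exact Submodule.sum_mem _ fun p _ => adField_mem_fieldV (hγ p.1) (ih p.2)

/-- The order `n + 1` of the gauge transform, without the term `∂_μ γ_{n+1}`. -/
def gaugeRest (f : ι → ι → ι → ℝ) (γ : ℕ → ι → QField ι) (μ : Fin 4) (n : ℕ) (a : ι) : QField ι :=
  ∑ m ∈ Finset.range (n + 2), ((m.factorial : ℝ)⁻¹) •
      coeff (n + 1) ((adField f (seriesOf γ))^[m] (fun b => X * C (fieldA μ b)) a) +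
    ∑ m ∈ Finset.range n, (((m + 2).factorial : ℝ)⁻¹) • coeff (n + 1)
      ((adField f (seriesOf γ))^[m + 1] (seriesOf fun n b => fieldPd μ (γ n b)) a)

/-- The split-off term is the one without brackets in the second sum, with weight `1 / 1!`. It is
the term that fixes `γ (n + 1)`. -/
lemma gaugeCoeff_succ (γ : ℕ → ι → QField ι) (μ : Fin 4) (n : ℕ) (a : ι) :
    gaugeCoeff f γ μ (n + 1) a = gaugeRest f γ μ n a + fieldPd μ (γ (n + 1) a) := by
  rw [gaugeCoeff, gaugeRest, Finset.sum_range_succ' _ n]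
  simp only [seriesOf, coeff_mk, Function.iterate_zero, id_eq, zero_add, Nat.factorial_one,
    Nat.cast_one, inv_one, one_smul]
  exact (add_assoc _ _ _).symm

lemma gaugeCoeff_zero {γ : ℕ → ι → QField ι} (μ : Fin 4) (a : ι) :
    gaugeCoeff f γ μ 0 a = 0 := by
  simp [gaugeCoeff]

lemma gaugeRest_mem_fieldV {γ : ℕ → ι → QField ι} (hγ : ∀ n, γ n ∈ spaceS f c) (n : ℕ) :
    (fun μ a => gaugeRest f γ μ n a) ∈ fieldV f c := by
  have hA : ∀ n, (fun (ν : Fin 4) (a : ι) => coeff n (X * C (fieldA ν a))) ∈ fieldV f c := by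
    intro n
    match n with
    | 0 =>
      have h : (fun (ν : Fin 4) (a : ι) => coeff 0 (X * C (fieldA ν a))) = 0 := by
        ext1 ν
        ext1 a
        simp
      rw [h]
      exact zero_mem _
    | 1 =>
      have h : (fun (ν : Fin 4) (a : ι) => coeff 1 (X * C (fieldA ν a))) = fieldA := by
        ext1 ν
        ext1 a
        rw [← zero_add 1, coeff_succ_X_mul, coeff_zero_C]
      rw [h]
      exact fieldA_mem_fieldV
    | n + 2 =>
      have h : (fun (ν : Fin 4) (a : ι) => coeff (n + 2) (X * C (fieldA ν a))) = 0 := by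
        ext1 ν
        ext1 a
        rw [coeff_succ_X_mul, coeff_C, if_neg (by omega)]
        rfl
      rw [h]
      exact zero_mem _
  have hS : ∀ n, (fun (ν : Fin 4) (a : ι) =>
      coeff n (seriesOf (fun n b => fieldPd ν (γ n b)) a)) ∈ fieldV f c := by
    intro n
    simpa [seriesOf] using fieldPd_mem_fieldV (hγ n)
  have h : (fun μ a => gaugeRest f γ μ n a) = ∑ m ∈ Finset.range (n + 2), ((m.factorial : ℝ)⁻¹) •
        (fun ν a => coeff (n + 1) ((adField f (seriesOf γ))^[m] (fun b => X * C (fieldA ν b)) a)) +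
      ∑ m ∈ Finset.range n, (((m + 2).factorial : ℝ)⁻¹) • (fun ν a => coeff (n + 1)
        ((adField f (seriesOf γ))^[m + 1] (seriesOf fun n b => fieldPd ν (γ n b)) a)) := by
    ext1 μ
    ext1 a
    simp [gaugeRest, Finset.sum_apply]
  rw [h]
  exact add_mem
    (Submodule.sum_mem _ fun m _ => Submodule.smul_mem _ _ (iterate_adField_mem_fieldV hγ hA _ _))
    (Submodule.sum_mem _ fun m _ => Submodule.smul_mem _ _ (iterate_adField_mem_fieldV hγ hS _ _))

lemma gaugeCoeff_mem_fieldV {γ : ℕ → ι → QField ι} (hγ : ∀ n, γ n ∈ spaceS f c) (n : ℕ) :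
    (fun μ a => gaugeCoeff f γ μ n a) ∈ fieldV f c := by
  cases n with
  | zero =>
    simp only [gaugeCoeff_zero]
    exact zero_mem _
  | succ n =>
    simp only [gaugeCoeff_succ]
    exact add_mem (gaugeRest_mem_fieldV hγ n) (fieldPd_mem_fieldV (hγ (n + 1)))

/-! ### Dependence of the gauge transform on the lower orders of the gauge parameter -/

variable {R : Type*} [CommRing R] [Algebra ℝ R]

lemma OrderGE.adField {s v : ι → R⟦X⟧} (hs : ∀ a, OrderGE 1 (s a)) (k : ι) :
    OrderGE 1 (adField f s v k) := by
  intro m hm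
  simp only [StringYM.adField, map_sum, coeff_smul]
  refine Finset.sum_eq_zero fun a _ => Finset.sum_eq_zero fun b _ => ?_
  rw [((hs a).mul (orderGE_zero (v b))) m (by omega), smul_zero]

/-- Both entries of the bracket start at order one, so its order `n + 1` involves each of them only
up to order `n`. One order is gained. -/
lemma EqUpTo.adField_succ {n : ℕ} {s s' v v' : ι → R⟦X⟧} (hs : ∀ a, OrderGE 1 (s a))
    (hs' : ∀ a, OrderGE 1 (s' a)) (hv : ∀ a, OrderGE 1 (v a)) (hv' : ∀ a, OrderGE 1 (v' a))
    (hss : ∀ a, EqUpTo n (s a) (s' a)) (hvv : ∀ a, EqUpTo n (v a) (v' a)) (k : ι) :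
    EqUpTo (n + 1) (adField f s v k) (adField f s' v' k) := by
  intro m hm
  simp only [adField, map_sum, coeff_smul, coeff_mul]
  refine Finset.sum_congr rfl fun a _ => Finset.sum_congr rfl fun b _ => ?_
  congr 1
  refine Finset.sum_congr rfl fun p hp => ?_
  have h := Finset.HasAntidiagonal.mem_antidiagonal.1 hp
  by_cases h1 : p.1 = 0
  · rw [hs a p.1 (by omega), hs' a p.1 (by omega), zero_mul, zero_mul]
  by_cases h2 : p.2 = 0
  · rw [hv b p.2 (by omega), hv' b p.2 (by omega), mul_zero, mul_zero]
  rw [hss a p.1 (by omega), hvv b p.2 (by omega)]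

lemma iterate_adField_eqUpTo {n : ℕ} {s s' v v' : ι → R⟦X⟧} (hs : ∀ a, OrderGE 1 (s a))
    (hs' : ∀ a, OrderGE 1 (s' a)) (hv : ∀ a, OrderGE 1 (v a)) (hv' : ∀ a, OrderGE 1 (v' a))
    (hss : ∀ a, EqUpTo n (s a) (s' a)) (hvv : ∀ a, EqUpTo n (v a) (v' a)) (m : ℕ) :
    (∀ k, EqUpTo n ((adField f s)^[m] v k) ((adField f s')^[m] v' k)) ∧
      ∀ k, EqUpTo (n + 1) ((adField f s)^[m + 1] v k) ((adField f s')^[m + 1] v' k) := by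
  have ho : ∀ {s v : ι → R⟦X⟧}, (∀ a, OrderGE 1 (s a)) → (∀ a, OrderGE 1 (v a)) → ∀ m k,
      OrderGE 1 ((adField f s)^[m] v k) := by
    intro s v hs hv m
    cases m with
    | zero => exact hv
    | succ m =>
      intro k
      rw [Function.iterate_succ_apply']
      exact OrderGE.adField hs k
  induction m with
  | zero => exact ⟨hvv, fun k => EqUpTo.adField_succ hs hs' hv hv' hss hvv k⟩
  | succ m ih =>
    have h : ∀ k, EqUpTo n ((adField f s)^[m + 1] v k) ((adField f s')^[m + 1] v' k) :=
      fun k l hl => ih.2 k l (by omega)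
    refine ⟨h, fun k => ?_⟩
    rw [Function.iterate_succ_apply', Function.iterate_succ_apply' (adField f s')]
    exact EqUpTo.adField_succ hs hs' (ho hs hv _) (ho hs' hv' _) hss h k

/-- The order `n + 1` of the gauge transform only involves `γ_1, …, γ_n` besides `∂_μ γ_{n+1}`. -/
lemma gaugeRest_congr {γ γ' : ℕ → ι → QField ι} (h0 : γ 0 = 0) (h0' : γ' 0 = 0) {n : ℕ}
    (h : ∀ j ≤ n, γ j = γ' j) (μ : Fin 4) (a : ι) :
    gaugeRest f γ μ n a = gaugeRest f γ' μ n a := by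
  have hs : ∀ {γ : ℕ → ι → QField ι}, γ 0 = 0 → ∀ a, OrderGE 1 (seriesOf γ a) := by
    intro γ h0 a m hm
    obtain rfl : m = 0 := by omega
    rw [seriesOf, coeff_mk, h0]
    rfl
  have hds : ∀ {γ : ℕ → ι → QField ι}, γ 0 = 0 →
      ∀ a, OrderGE 1 (seriesOf (fun n b => fieldPd μ (γ n b)) a) := by
    intro γ h0 a m hm
    obtain rfl : m = 0 := by omega
    rw [seriesOf, coeff_mk, h0]
    ext1 Φ
    exact pd_zero μ
  have hX : ∀ a, OrderGE 1 (X * C (fieldA μ a) : (QField ι)⟦X⟧) := by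
    intro a m hm
    obtain rfl : m = 0 := by omega
    simp
  have hss : ∀ a, EqUpTo n (seriesOf γ a) (seriesOf γ' a) := fun a m hm => by
    rw [seriesOf, seriesOf, coeff_mk, coeff_mk, h m hm]
  have hdd : ∀ a, EqUpTo n (seriesOf (fun n b => fieldPd μ (γ n b)) a)
      (seriesOf (fun n b => fieldPd μ (γ' n b)) a) := fun a m hm => by
    rw [seriesOf, seriesOf, coeff_mk, coeff_mk, h m hm]
  unfold gaugeRest
  congr 1
  · refine Finset.sum_congr rfl fun m _ => ?_
    cases m with
    | zero => rfl
    | succ m =>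
      rw [(iterate_adField_eqUpTo (f := f) (hs h0) (hs h0') hX hX hss
        (fun a => EqUpTo.refl n _) m).2 a (n + 1) le_rfl]
  · refine Finset.sum_congr rfl fun m _ => ?_
    rw [(iterate_adField_eqUpTo (f := f) (hs h0) (hs h0') (hds h0) (hds h0') hss hdd m).2 a
      (n + 1) le_rfl]

lemma gaugeRest_zero {γ : ℕ → ι → QField ι} (h0 : γ 0 = 0) (μ : Fin 4) (a : ι) :
    gaugeRest f γ μ 0 a = fieldA μ a := by
  have h1 : coeff 1 (adField f (seriesOf γ) (fun b => X * C (fieldA μ b)) a) = 0 := by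
    simp only [adField, map_sum, coeff_smul, coeff_mul, Finset.Nat.antidiagonal_succ]
    simp [seriesOf, h0]
  simp [gaugeRest, Finset.sum_range_succ, h1]

variable (f c) in
/-- The gauge parameter that brings the potential into the axial gauge of the string. -/
lemma exists_gauge_parameter : ∃ γ : ℕ → ι → QField ι, γ 0 = 0 ∧ (∀ n, γ n ∈ spaceS f c) ∧
    ∀ n a, Set.EqOn (γ (n + 1) a) (∑ ν, fieldInt c ν (gaugeRest f γ ν n a)) (configs ι c) := by
  obtain ⟨s, hs⟩ := exists_seq_of_step (M := spaceS f c)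
    (fun n γ σ => (n = 0 → σ = 0) ∧ ∀ k, n = k + 1 → ∀ a, Set.EqOn (σ.1 a)
      (∑ ν, fieldInt c ν (gaugeRest f (fun n => (γ n).1) ν k a)) (configs ι c)) (by
    intro n γ
    cases n with
    | zero => exact ⟨0, fun _ => rfl, fun k hk => by omega⟩
    | succ n =>
      obtain ⟨u, hu, hu'⟩ := gaugeRest_mem_fieldV (f := f) (c := c) (fun n => (γ n).2) n
      obtain ⟨σ, hσ, h⟩ := exists_spaceS_eq_int hu
      refine ⟨⟨σ, hσ⟩, fun h => by omega, fun k hk a => ?_⟩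
      obtain rfl : n = k := by omega
      have h1 : ∀ ν, wickField (u ν a) = gaugeRest f (fun n => (γ n).1) ν n a := fun ν =>
        congrFun (congrFun hu' ν) a
      simpa only [h1] using h a)
  have h0 : s 0 = 0 := (hs 0).1 rfl
  refine ⟨fun n => (s n).1, by simp [h0], fun n => (s n).2, fun n a => ?_⟩
  -- The truncation below `n + 1` is invisible because this expression only involves the orders up
  -- to `n`.
  have h : ∀ ν, gaugeRest f (fun n => (s n).1) ν n a =
      gaugeRest f (fun j => (if j < n + 1 then s j else 0 : spaceS f c).1) ν n a := fun ν =>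
    gaugeRest_congr (congrArg Subtype.val h0) (by simp [h0])
      (fun j hj => by rw [if_pos (by omega)]) ν a
  simp only [h]
  exact (hs (n + 1)).2 n rfl a

end Gamma

end StringYM

end

noncomputable section

namespace StringYM

open PowerSeries

/-! ### The flow of a series of variations -/

section Flow

variable {ι : Type*} {c : StringFunction}

lemma IsRegular.congr {X Y : QField ι} (hX : IsRegular c X) (h : Set.EqOn X Y (configs ι c)) :
    IsRegular c Y where
  exists_poly Φ hΦ Ψ hΨ := by
    obtain ⟨p, hp, hp'⟩ := hX.exists_poly Φ hΦ Ψ hΨ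
    exact ⟨p, hp, fun t => by rw [← h (add_smul_mem_configs hΦ hΨ t), hp']⟩
  localized x ε hε Φ hΦ Ψ hΨ hΦΨ := by
    rw [← h hΦ, ← h hΨ]
    exact hX.localized x ε hε Φ hΦ Ψ hΨ hΦΨ

/-- The functional derivative of a series of fields in the direction of a series of variations. -/
def dSeries (w : ℕ → Fin 4 → ι → QField ι) (Y : (QField ι)⟦X⟧) : (QField ι)⟦X⟧ :=
  PowerSeries.mk fun n => ∑ p ∈ Finset.HasAntidiagonal.antidiagonal n,
    dirDeriv (w p.1) (coeff p.2 Y)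

/-- The order `n` of the `k`-fold functional derivative of `X`. -/
def flowCoeff (w : ℕ → Fin 4 → ι → QField ι) (X : QField ι) (k n : ℕ) : QField ι :=
  coeff n ((dSeries w)^[k] (C X))

/-- The order `n` of the flow of `X`. -/
def expFlow (w : ℕ → Fin 4 → ι → QField ι) (X : QField ι) (n : ℕ) : QField ι :=
  ∑ k ∈ Finset.range (n + 1), ((k.factorial : ℝ)⁻¹) • flowCoeff w X k n

variable {w w' : ℕ → Fin 4 → ι → QField ι}

lemma flowCoeff_zero (X : QField ι) (n : ℕ) : flowCoeff w X 0 n = if n = 0 then X else 0 := by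
  rw [flowCoeff, Function.iterate_zero, id, coeff_C]

lemma flowCoeff_succ (X : QField ι) (k n : ℕ) : flowCoeff w X (k + 1) n =
    ∑ p ∈ Finset.HasAntidiagonal.antidiagonal n, dirDeriv (w p.1) (flowCoeff w X k p.2) := by
  rw [flowCoeff, Function.iterate_succ_apply', dSeries, coeff_mk]
  rfl

lemma flowCoeff_one (X : QField ι) (n : ℕ) : flowCoeff w X 1 n = dirDeriv (w n) X := by
  rw [flowCoeff_succ, Finset.sum_eq_single (n, 0)]
  · rw [flowCoeff_zero, if_pos rfl]
  · intro p hp hne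
    have h := Finset.HasAntidiagonal.mem_antidiagonal.1 hp
    rw [flowCoeff_zero, if_neg, dirDeriv_zero]
    intro h2
    exact hne (Prod.ext (by simp; omega) h2)
  · intro h
    exact absurd (Finset.HasAntidiagonal.mem_antidiagonal.2 (add_zero n)) h

/-- As `w 0 = 0`, each derivation raises the order by at least one. This justifies the truncated sum
in the definition of the flow. -/
lemma flowCoeff_eq_zero (hw : w 0 = 0) (X : QField ι) {k n : ℕ} (h : n < k) :
    flowCoeff w X k n = 0 := by
  induction k generalizing n with
  | zero => omega
  | succ k ih =>
    rw [flowCoeff_succ]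
    refine Finset.sum_eq_zero fun p hp => ?_
    have h' := Finset.HasAntidiagonal.mem_antidiagonal.1 hp
    by_cases h0 : p.1 = 0
    · rw [h0, hw, dirDeriv_zero_left]
    · rw [ih (by omega), dirDeriv_zero]

lemma flowCoeff_congr (X : QField ι) {n : ℕ} (h : ∀ j < n, w j = w' j) (k : ℕ) {m : ℕ}
    (hm : m < n) : flowCoeff w X k m = flowCoeff w' X k m := by
  induction k generalizing m with
  | zero => rw [flowCoeff_zero, flowCoeff_zero]
  | succ k ih =>
    rw [flowCoeff_succ, flowCoeff_succ]
    refine Finset.sum_congr rfl fun p hp => ?_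
    have h' := Finset.HasAntidiagonal.mem_antidiagonal.1 hp
    rw [h _ (by omega), ih (by omega)]

/-- When at least two derivations, each of order at least one, share the total order `n`, none of
them has order `n`. So `w n` enters the order `n` of the flow only through the single derivation. -/
lemma flowCoeff_add_two_congr (hw : w 0 = 0) (hw' : w' 0 = 0) (X : QField ι) {n : ℕ}
    (h : ∀ j < n, w j = w' j) (k : ℕ) :
    flowCoeff w X (k + 2) n = flowCoeff w' X (k + 2) n := by
  rw [flowCoeff_succ, flowCoeff_succ]
  refine Finset.sum_congr rfl fun p hp => ?_
  have h' := Finset.HasAntidiagonal.mem_antidiagonal.1 hp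
  by_cases h0 : p.1 = 0
  · rw [h0, hw, hw', dirDeriv_zero_left, dirDeriv_zero_left]
  by_cases h1 : p.2 = 0
  · rw [h1, flowCoeff_eq_zero hw X (by omega), flowCoeff_eq_zero hw' X (by omega), dirDeriv_zero,
      dirDeriv_zero]
  rw [h _ (by omega), flowCoeff_congr X h (k + 1) (by omega)]

lemma expFlow_zero (X : QField ι) : expFlow w X 0 = X := by
  simp [expFlow, flowCoeff_zero]

/-- On `A` the isolated first term is `w (n + 1)` itself, which makes the flow equation solvable
order by order. -/
lemma expFlow_succ (X : QField ι) (n : ℕ) :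
    expFlow w X (n + 1) = dirDeriv (w (n + 1)) X +
      ∑ k ∈ Finset.range n, (((k + 2).factorial : ℝ)⁻¹) • flowCoeff w X (k + 2) (n + 1) := by
  rw [expFlow, Finset.sum_range_succ', Finset.sum_range_succ', flowCoeff_zero,
    if_neg (Nat.succ_ne_zero n), smul_zero, add_zero, add_comm, zero_add, flowCoeff_one,
    Nat.factorial_one, Nat.cast_one, inv_one, one_smul]

/-! ### Linear operations on vector fields -/

/-- A linear operation that commutes with functional derivatives. -/
structure IsLinOp (c : StringFunction) (L : (Fin 4 → QField ι) → QField ι) : Prop where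
  regular : ∀ {Y}, (∀ ν, IsRegular c (Y ν)) → IsRegular c (L Y)
  congr : ∀ {Y Z}, (∀ ν, Set.EqOn (Y ν) (Z ν) (configs ι c)) → Set.EqOn (L Y) (L Z) (configs ι c)
  add : ∀ {Y Z}, (∀ ν, IsRegular c (Y ν)) → (∀ ν, IsRegular c (Z ν)) →
    Set.EqOn (L (Y + Z)) (L Y + L Z) (configs ι c)
  smul : ∀ {Y}, (∀ ν, IsRegular c (Y ν)) → ∀ r : ℝ,
    Set.EqOn (L (r • Y)) (r • L Y) (configs ι c)
  deriv : ∀ {v Y}, IsVariation c v → (∀ ν, IsRegular c (Y ν)) →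
    Set.EqOn (dirDeriv v (L Y)) (L fun ν => dirDeriv v (Y ν)) (configs ι c)

lemma isLinOp_proj (ν : Fin 4) : IsLinOp c fun Y : Fin 4 → QField ι => Y ν where
  regular hY := hY ν
  congr h := h ν
  add _ _ _ _ := rfl
  smul _ _ _ _ := rfl
  deriv _ _ _ _ := rfl

variable {L M : (Fin 4 → QField ι) → QField ι}

lemma IsLinOp.fieldPd (hL : IsLinOp c L) (μ : Fin 4) : IsLinOp c fun Y => fieldPd μ (L Y) where
  regular hY := (hL.regular hY).fieldPd μ
  congr h Φ hΦ := by simp only [StringYM.fieldPd, hL.congr h hΦ]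
  add hY hZ Φ hΦ := by
    simp only [StringYM.fieldPd, hL.add hY hZ hΦ, Pi.add_apply]
    exact pd_add ((hL.regular hY).admissible hΦ).differentiable
      ((hL.regular hZ).admissible hΦ).differentiable μ
  smul hY r Φ hΦ := by
    simp only [StringYM.fieldPd, hL.smul hY r hΦ, Pi.smul_apply]
    exact pd_smul ((hL.regular hY).admissible hΦ).differentiable r μ
  deriv hv hY Φ hΦ := by
    rw [dirDeriv_fieldPd hv (hL.regular hY) μ hΦ]
    simp only [StringYM.fieldPd, hL.deriv hv hY hΦ]

lemma IsLinOp.fieldInt (hL : IsLinOp c L) (μ : Fin 4) : IsLinOp c fun Y => fieldInt c μ (L Y) where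
  regular hY := (hL.regular hY).fieldInt μ
  congr h Φ hΦ := by simp only [StringYM.fieldInt, hL.congr h hΦ]
  add hY hZ Φ hΦ := by
    simp only [StringYM.fieldInt, hL.add hY hZ hΦ, Pi.add_apply]
    exact stringInt_add ((hL.regular hY).admissible hΦ) ((hL.regular hZ).admissible hΦ) μ
  smul hY r Φ hΦ := by
    simp only [StringYM.fieldInt, hL.smul hY r hΦ, Pi.smul_apply]
    exact stringInt_smul ((hL.regular hY).admissible hΦ) r μ
  deriv hv hY Φ hΦ := by
    rw [dirDeriv_fieldInt hv (hL.regular hY) μ hΦ]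
    simp only [StringYM.fieldInt, hL.deriv hv hY hΦ]

lemma IsLinOp.sub (hL : IsLinOp c L) (hM : IsLinOp c M) : IsLinOp c fun Y => L Y - M Y where
  regular hY := (hL.regular hY).sub (hM.regular hY)
  congr h Φ hΦ := by simp only [Pi.sub_apply, hL.congr h hΦ, hM.congr h hΦ]
  add hY hZ Φ hΦ := by
    simp only [Pi.sub_apply, Pi.add_apply, hL.add hY hZ hΦ, hM.add hY hZ hΦ]
    exact add_sub_add_comm _ _ _ _
  smul hY r Φ hΦ := by
    simp only [Pi.sub_apply, Pi.smul_apply, hL.smul hY r hΦ, hM.smul hY r hΦ, smul_sub]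
  deriv {v Y} hv hY Φ hΦ := by
    have h : L Y - M Y = L Y + (-1 : ℝ) • M Y := by rw [neg_one_smul, sub_eq_add_neg]
    simp only [h, dirDeriv_add hv (hL.regular hY) ((hM.regular hY).smul _) hΦ, Pi.add_apply,
      dirDeriv_smul hv (hM.regular hY) _ hΦ, Pi.smul_apply, hL.deriv hv hY hΦ, hM.deriv hv hY hΦ,
      Pi.sub_apply]
    rw [neg_one_smul, sub_eq_add_neg]

lemma IsLinOp.sum {κ : Type*} [Fintype κ] {L : κ → (Fin 4 → QField ι) → QField ι}
    (hL : ∀ i, IsLinOp c (L i)) : IsLinOp c fun Y => ∑ i, L i Y where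
  regular hY := IsRegular.sum _ fun i _ => (hL i).regular hY
  congr h Φ hΦ := by simp only [Finset.sum_apply, fun i => (hL i).congr h hΦ]
  add hY hZ Φ hΦ := by
    simp only [Finset.sum_apply, Pi.add_apply, fun i => (hL i).add hY hZ hΦ]
    exact Finset.sum_add_distrib
  smul hY r Φ hΦ := by
    simp only [Finset.sum_apply, Pi.smul_apply, fun i => (hL i).smul hY r hΦ, Finset.smul_sum]
  deriv hv hY Φ hΦ := by
    rw [dirDeriv_sum hv _ (fun i _ => (hL i).regular hY) hΦ]
    simp only [Finset.sum_apply, fun i => (hL i).deriv hv hY hΦ]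

lemma IsLinOp.finsetSum (hL : IsLinOp c L) {κ : Type*} (s : Finset κ) {Y : κ → Fin 4 → QField ι}
    (hY : ∀ i ∈ s, ∀ ν, IsRegular c (Y i ν)) :
    Set.EqOn (L (∑ i ∈ s, Y i)) (∑ i ∈ s, L (Y i)) (configs ι c) := by
  classical
  induction s using Finset.induction_on with
  | empty =>
    intro Φ hΦ
    have h := hL.smul (Y := 0) (fun _ => isRegular_zero) 0 hΦ
    rwa [zero_smul, zero_smul] at h
  | insert i s hi ih =>
    intro Φ hΦ
    have hs : ∀ j ∈ s, ∀ ν, IsRegular c (Y j ν) := fun j hj => hY j (Finset.mem_insert_of_mem hj)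
    have hs' : ∀ ν, IsRegular c ((∑ j ∈ s, Y j) ν) := fun ν => by
      rw [Finset.sum_apply]
      exact IsRegular.sum s fun j hj => hs j hj ν
    rw [Finset.sum_insert hi, Finset.sum_insert hi, hL.add (hY i (Finset.mem_insert_self _ _)) hs' hΦ,
      Pi.add_apply, Pi.add_apply, ih hs hΦ]

/-- If the derivatives of the components of a vector field are regular, linear operations commute
with the flow. -/
lemma IsLinOp.flowCoeff (hL : IsLinOp c L) (hw : ∀ n, IsVariation c (w n)) {Y : Fin 4 → QField ι}
    (hY : ∀ k n ν, IsRegular c (flowCoeff w (Y ν) k n))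
    (hdY : ∀ j k n ν, IsRegular c (dirDeriv (w j) (flowCoeff w (Y ν) k n))) (k n : ℕ) :
    Set.EqOn (flowCoeff w (L Y) k n) (L fun ν => flowCoeff w (Y ν) k n) (configs ι c) := by
  induction k generalizing n with
  | zero =>
    intro Φ hΦ
    simp only [flowCoeff_zero]
    split_ifs
    · rfl
    · have h := hL.smul (Y := 0) (fun _ => isRegular_zero) 0 hΦ
      rw [zero_smul, zero_smul] at h
      exact h.symm
  | succ k ih =>
    intro Φ hΦ
    have h1 : (fun ν => StringYM.flowCoeff w (Y ν) (k + 1) n) =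
        ∑ p ∈ Finset.HasAntidiagonal.antidiagonal n, fun ν =>
          dirDeriv (w p.1) (StringYM.flowCoeff w (Y ν) k p.2) := by
      ext1 ν
      rw [flowCoeff_succ, Finset.sum_apply]
    rw [h1, hL.finsetSum _ (fun p _ ν => hdY p.1 k p.2 ν) hΦ, flowCoeff_succ, Finset.sum_apply,
      Finset.sum_apply]
    refine Finset.sum_congr rfl fun p _ => ?_
    rw [dirDeriv_congr (hw p.1) (ih p.2) hΦ, hL.deriv (hw p.1) (hY k p.2) hΦ]

lemma IsLinOp.expFlow (hL : IsLinOp c L) (hw : ∀ n, IsVariation c (w n)) {Y : Fin 4 → QField ι}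
    (hY : ∀ k n ν, IsRegular c (StringYM.flowCoeff w (Y ν) k n))
    (hdY : ∀ j k n ν, IsRegular c (dirDeriv (w j) (StringYM.flowCoeff w (Y ν) k n))) (n : ℕ) :
    Set.EqOn (expFlow w (L Y) n) (L fun ν => expFlow w (Y ν) n) (configs ι c) := by
  intro Φ hΦ
  have h1 : (fun ν => StringYM.expFlow w (Y ν) n) =
      ∑ k ∈ Finset.range (n + 1), ((k.factorial : ℝ)⁻¹) •
        fun ν => StringYM.flowCoeff w (Y ν) k n := by
    ext1 ν
    simp [StringYM.expFlow, Finset.sum_apply]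
  rw [h1, hL.finsetSum (Y := fun k => ((k.factorial : ℝ)⁻¹) •
    fun ν => StringYM.flowCoeff w (Y ν) k n) _ (fun k _ ν => (hY k n ν).smul _) hΦ,
    StringYM.expFlow, Finset.sum_apply, Finset.sum_apply]
  refine Finset.sum_congr rfl fun k _ => ?_
  rw [hL.smul (hY k n) _ hΦ, Pi.smul_apply, Pi.smul_apply, hL.flowCoeff hw hY hdY k n hΦ]

end Flow

/-! ### The mediator field -/

section Mediator

variable {ι : Type*} [Fintype ι] {f : ι → ι → ι → ℝ} {c : StringFunction}
  {α : ℕ → Fin 4 → ι → Wick f c}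

lemma omegaSeries_mediator (τ : Renormalization ι (spaceS f c)) (hα : ∀ n, α n ∈ spaceV f c) :
    omegaSeries τ (mediator α) = dSeries fun n => wickVec (α n) := by
  ext1 Y
  simp only [omegaSeries, dSeries, omega_mediator τ α _ (hα _)]
  rfl

lemma coeff_omegaSeries_mediator (τ : Renormalization ι (spaceS f c))
    (hα : ∀ n, α n ∈ spaceV f c) (X : QField ι) (n : ℕ) :
    coeff n (omegaSeries τ (mediator α) (C X)) = dirDeriv (wickVec (α n)) X := by
  rw [omegaSeries_mediator τ hα]
  have h := flowCoeff_one (w := fun n => wickVec (α n)) X n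
  rwa [flowCoeff, Function.iterate_one] at h

lemma coeff_expOmega_mediator (τ : Renormalization ι (spaceS f c))
    (hα : ∀ n, α n ∈ spaceV f c) (X : QField ι) (n : ℕ) :
    coeff n (expOmega τ (mediator α) (C X)) = expFlow (fun n => wickVec (α n)) X n := by
  rw [expOmega, coeff_mk, omegaSeries_mediator τ hα]
  rfl

lemma isVariation_wickVec {u : Fin 4 → ι → Wick f c} (hu : u ∈ spaceV f c) :
    IsVariation c (wickVec u) :=
  isVariation_wickField hu

/-- The derivatives of the potential are represented by elements of `𝒱`. -/
lemma exists_flowCoeff_fieldA (hα : ∀ n, α n ∈ spaceV f c) (k n : ℕ) : ∃ u ∈ spaceV f c, ∀ ν b,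
    Set.EqOn (flowCoeff (fun n => wickVec (α n)) (fieldA ν b) k n) (wickVec u ν b)
      (configs ι c) := by
  induction k generalizing n with
  | zero =>
    by_cases hn : n = 0
    · refine ⟨vecA, vecA_mem, fun ν b Φ _ => ?_⟩
      rw [flowCoeff_zero, if_pos hn, ← wickField_vecA (f := f) (c := c)]
      rfl
    · refine ⟨0, zero_mem _, fun ν b Φ _ => ?_⟩
      rw [flowCoeff_zero, if_neg hn, map_zero]
      rfl
  | succ k ih =>
    choose u hu h using ih
    choose x hx h' using fun p : ℕ × ℕ => exists_isDerivV (hα p.1) (hu p.2)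
    refine ⟨∑ p ∈ Finset.HasAntidiagonal.antidiagonal n, x p,
      Submodule.sum_mem _ fun p _ => hx p, fun ν b Φ hΦ => ?_⟩
    rw [flowCoeff_succ, map_sum, Finset.sum_apply, Finset.sum_apply, Finset.sum_apply,
      Finset.sum_apply]
    refine Finset.sum_congr rfl fun p _ => ?_
    rw [dirDeriv_congr (isVariation_wickVec (hα p.1)) (h p.2 ν b) hΦ]
    exact h' p ν b hΦ

lemma isRegular_flowCoeff_fieldA (hα : ∀ n, α n ∈ spaceV f c) (k n : ℕ) (ν : Fin 4) (b : ι) :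
    IsRegular c (flowCoeff (fun n => wickVec (α n)) (fieldA ν b) k n) := by
  obtain ⟨u, hu, h⟩ := exists_flowCoeff_fieldA hα k n
  exact (isRegular_wickField hu ν b).congr (h ν b).symm

lemma isRegular_dirDeriv_flowCoeff_fieldA (hα : ∀ n, α n ∈ spaceV f c) (j k n : ℕ) (ν : Fin 4)
    (b : ι) :
    IsRegular c (dirDeriv (wickVec (α j)) (flowCoeff (fun n => wickVec (α n)) (fieldA ν b) k n)) := by
  obtain ⟨u, hu, h⟩ := exists_flowCoeff_fieldA hα k n
  obtain ⟨x, hx, h'⟩ := exists_isDerivV (hα j) hu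
  exact (isRegular_wickField hx ν b).congr
    ((dirDeriv_congr (isVariation_wickVec (hα j)) (h ν b)).trans (h' ν b)).symm

/-- Every formal deformation of the potential by elements of `𝒱` is the flow of a mediator. -/
lemma exists_flow_eq {B : ℕ → Fin 4 → ι → QField ι} (hB : ∀ n, B n ∈ fieldV f c)
    (hB0 : B 0 = fieldA) :
    ∃ α : ℕ → Fin 4 → ι → Wick f c, α 0 = 0 ∧ (∀ n, α n ∈ spaceV f c) ∧ ∀ n ν b,
      Set.EqOn (expFlow (fun n => wickVec (α n)) (fieldA ν b) n) (B n ν b) (configs ι c) := by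
  obtain ⟨s, hs⟩ := exists_seq_of_step (M := spaceV f c)
    (fun n a x => (n = 0 → x = 0) ∧ ∀ m, n = m + 1 → ∀ ν b, Set.EqOn (wickVec x.1 ν b)
      (B n ν b - ∑ k ∈ Finset.range m, (((k + 2).factorial : ℝ)⁻¹) •
        flowCoeff (fun n => wickVec (a n).1) (fieldA ν b) (k + 2) n) (configs ι c)) (by
    intro n a
    cases n with
    | zero => exact ⟨0, fun _ => rfl, fun k hk => by omega⟩
    | succ n =>
      obtain ⟨x, hx, hxB⟩ := hB (n + 1)
      choose u hu h using fun k => exists_flowCoeff_fieldA (fun n => (a n).2) (k + 2) (n + 1)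
      -- The new order is the prescribed one minus the multiple derivatives. These are represented
      -- in `𝒱` since `𝒱` is closed under derivatives.
      refine ⟨⟨x - ∑ k ∈ Finset.range n, (((k + 2).factorial : ℝ)⁻¹) • u k, sub_mem hx
        (Submodule.sum_mem _ fun k _ => Submodule.smul_mem _ _ (hu k))⟩, fun h => by omega,
        fun m hm ν b Φ hΦ => ?_⟩
      obtain rfl : n = m := by omega
      rw [map_sub, hxB, map_sum]
      simp only [Pi.sub_apply, Finset.sum_apply, map_smul, Pi.smul_apply, h _ ν b hΦ])
  have h0 : s 0 = 0 := (hs 0).1 rfl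
  refine ⟨fun n => (s n).1, congrArg Subtype.val h0, fun n => (s n).2, fun n ν b Φ hΦ => ?_⟩
  cases n with
  | zero => rw [expFlow_zero, hB0]
  | succ n =>
    have h := (hs (n + 1)).2 n rfl ν b hΦ
    rw [expFlow_succ, dirDeriv_fieldA, Pi.add_apply, h, Pi.sub_apply]
    have h2 : ∀ k, flowCoeff (fun n => wickVec (s n).1) (fieldA ν b) (k + 2) (n + 1) =
        flowCoeff (fun j => wickVec (if j < n + 1 then s j else 0 : spaceV f c).1) (fieldA ν b)
          (k + 2) (n + 1) := by
      intro k
      refine flowCoeff_add_two_congr ?_ ?_ _ (fun j hj => ?_) k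
      · simp [h0]
      · simp [h0]
      · rw [if_pos hj]
    simp only [h2]
    exact sub_add_cancel _ _

end Mediator

end StringYM

end

noncomputable section

namespace StringYM

open PowerSeries

/-! ### The dressed fields -/

section Dressed

variable {ι : Type*} {c : StringFunction}

/-- String integration commutes with `∂_μ`, and `-I_c^ν ∂_ν` is the identity. For the potential this
reads `A_μ(c) = A_μ + ∂_μ I_c^ν A_ν`. -/
lemma sum_fieldInt_curl {Y : Fin 4 → QField ι} (hY : ∀ ν, IsRegular c (Y ν)) (μ : Fin 4) :
    Set.EqOn (∑ ν, fieldInt c ν (fieldPd μ (Y ν) - fieldPd ν (Y μ)))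
      (fieldPd μ (∑ ν, fieldInt c ν (Y ν)) + Y μ) (configs ι c) := by
  intro Φ hΦ
  have h1 : ∀ ν, fieldInt c ν (fieldPd μ (Y ν) - fieldPd ν (Y μ)) Φ =
      pd μ (fieldInt c ν (Y ν) Φ) - fieldInt c ν (fieldPd ν (Y μ)) Φ := by
    intro ν
    rw [sub_eq_add_neg, ← neg_one_smul ℝ, fieldInt_add_apply ((hY ν).fieldPd μ)
      (((hY μ).fieldPd ν).smul _) hΦ, fieldInt_smul_apply ((hY μ).fieldPd ν) hΦ, neg_one_smul,
      ← sub_eq_add_neg]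
    congr 1
    exact (pd_stringInt ((hY ν).admissible hΦ) ν μ).symm
  have h2 := sum_stringInt_pd_field (hY μ) hΦ
  rw [Finset.sum_apply] at h2
  rw [Finset.sum_apply, Pi.add_apply, fieldPd, Finset.sum_apply,
    pd_sum _ fun ν _ => (((hY ν).fieldInt ν).admissible hΦ).differentiable]
  simp only [h1]
  rw [Finset.sum_sub_distrib, h2, sub_neg_eq_add]

lemma isRegular_fieldF (μ ν : Fin 4) (a : ι) : IsRegular c (fieldF μ ν a) :=
  ((isRegular_fieldA ν a).fieldPd μ).sub ((isRegular_fieldA μ a).fieldPd ν)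

/-- The field equation `∂^μ F_{μν} = -∂_ν N`. -/
lemma sum_pd_fieldF {Φ : Conf ι} (hΦ : Φ ∈ onShell ι c) (ν : Fin 4) (a : ι) (x : Spacetime) :
    ∑ μ, sgn μ * pd μ (fieldF μ ν a Φ) x = -pd ν (Φ.2 a) x := by
  obtain ⟨hc, hbox, hN⟩ := hΦ
  have hA : ∀ μ, Admissible c (Φ.1 μ a) := fun μ => hc.1 μ a
  have h1 : ∀ μ, pd μ (fieldF μ ν a Φ) = pd μ (pd μ (Φ.1 ν a)) - pd ν (pd μ (Φ.1 μ a)) := by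
    intro μ
    rw [pd_pd_comm (hA μ).contDiff ν μ,
      ← pd_sub ((hA ν).pd μ).differentiable ((hA μ).pd ν).differentiable]
    rfl
  have h2 : Φ.2 a = ∑ μ, sgn μ • pd μ (Φ.1 μ a) := by
    ext y
    rw [hN a y, Finset.sum_apply]
    rfl
  rw [h2, pd_sum _ fun μ _ => (((hA μ).pd μ).smul _).differentiable, Finset.sum_apply]
  simp only [h1, fun μ => pd_smul ((hA μ).pd μ).differentiable (sgn μ) ν, Pi.sub_apply, mul_sub,
    Finset.sum_sub_distrib, hbox, zero_sub, Pi.smul_apply, smul_eq_mul]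

lemma dirDeriv_fieldF {v : Fin 4 → ι → QField ι} (hv : IsVariation c v) (μ ν : Fin 4) (a : ι) :
    Set.EqOn (dirDeriv v (fieldF μ ν a)) (fieldPd μ (v ν a) - fieldPd ν (v μ a))
      (configs ι c) := by
  intro Φ hΦ
  have h := (((isLinOp_proj ν).fieldPd μ).sub ((isLinOp_proj μ).fieldPd ν)).deriv
    (c := c) (Y := fun ν => fieldA ν a) hv (fun ν => isRegular_fieldA ν a) hΦ
  simp only [dirDeriv_fieldA] at h
  exact h

variable [Fintype ι] {f : ι → ι → ι → ℝ} {α : ℕ → Fin 4 → ι → Wick f c}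
  {B : ℕ → Fin 4 → ι → QField ι}

lemma expFlow_linOp {L : (Fin 4 → QField ι) → QField ι} (hL : IsLinOp c L)
    (hα : ∀ n, α n ∈ spaceV f c) (h : ∀ n ν b,
      Set.EqOn (expFlow (fun n => wickVec (α n)) (fieldA ν b) n) (B n ν b) (configs ι c))
    (n : ℕ) (a : ι) :
    Set.EqOn (expFlow (fun n => wickVec (α n)) (L fun ν => fieldA ν a) n) (L fun ν => B n ν a)
      (configs ι c) :=
  (hL.expFlow (fun n => isVariation_wickVec (hα n))
    (fun k n ν => isRegular_flowCoeff_fieldA hα k n ν a)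
    (fun j k n ν => isRegular_dirDeriv_flowCoeff_fieldA hα j k n ν a) n).trans
    (hL.congr fun ν => h n ν a)

lemma expFlow_fieldF (hα : ∀ n, α n ∈ spaceV f c) (h : ∀ n ν b,
      Set.EqOn (expFlow (fun n => wickVec (α n)) (fieldA ν b) n) (B n ν b) (configs ι c))
    (n : ℕ) (μ ν : Fin 4) (a : ι) :
    Set.EqOn (expFlow (fun n => wickVec (α n)) (fieldF μ ν a) n)
      (fieldPd μ (B n ν a) - fieldPd ν (B n μ a)) (configs ι c) :=
  expFlow_linOp (((isLinOp_proj ν).fieldPd μ).sub ((isLinOp_proj μ).fieldPd ν)) hα h n a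

lemma expFlow_fieldAc (hα : ∀ n, α n ∈ spaceV f c) (h : ∀ n ν b,
      Set.EqOn (expFlow (fun n => wickVec (α n)) (fieldA ν b) n) (B n ν b) (configs ι c))
    (hB : ∀ n, B n ∈ fieldV f c) (n : ℕ) (μ : Fin 4) (a : ι) :
    Set.EqOn (expFlow (fun n => wickVec (α n)) (fieldAc c μ a) n)
      (fieldPd μ (∑ ν, fieldInt c ν (B n ν a)) + B n μ a) (configs ι c) :=
  (expFlow_linOp (IsLinOp.sum fun ν =>
    (((isLinOp_proj ν).fieldPd μ).sub ((isLinOp_proj μ).fieldPd ν)).fieldInt ν) hα h n a).trans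
    (sum_fieldInt_curl (fun ν => fieldV_isRegular (hB n) ν a) μ)

/-- The gauge transformed potential, where the order zero is the potential itself. -/
def gaugePotential (f : ι → ι → ι → ℝ) (γ : ℕ → ι → QField ι) : ℕ → Fin 4 → ι → QField ι
  | 0 => fieldA
  | n + 1 => fun ν b => gaugeCoeff f γ ν (n + 2) b

lemma gaugePotential_mem_fieldV {γ : ℕ → ι → QField ι} (hγ : ∀ n, γ n ∈ spaceS f c) (n : ℕ) :
    gaugePotential f γ n ∈ fieldV f c := by
  cases n with
  | zero => exact fieldA_mem_fieldV
  | succ n => exact gaugeCoeff_mem_fieldV hγ (n + 2)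

/-- At order zero the gradient supplies `∂_μ γ_1`, because `γ_1` is the string integral of `A`. At
higher orders the gradient vanishes by the axial gauge condition. -/
lemma fieldPd_int_gaugePotential {γ : ℕ → ι → QField ι} (h0 : γ 0 = 0)
    (hγ : ∀ n, γ n ∈ spaceS f c)
    (h : ∀ n a, Set.EqOn (γ (n + 1) a) (∑ ν, fieldInt c ν (gaugeRest f γ ν n a)) (configs ι c))
    (n : ℕ) (μ : Fin 4) (a : ι) :
    Set.EqOn (fieldPd μ (∑ ν, fieldInt c ν (gaugePotential f γ n ν a)) + gaugePotential f γ n μ a)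
      (gaugeCoeff f γ μ (n + 1) a) (configs ι c) := by
  intro Φ hΦ
  cases n with
  | zero =>
    have h1 := h 0 a hΦ
    simp only [gaugeRest_zero h0] at h1
    rw [gaugeCoeff_succ, gaugeRest_zero h0, Pi.add_apply, Pi.add_apply, fieldPd, fieldPd, h1,
      add_comm]
    rfl
  | succ n =>
    -- The string integral of `∂γ_{n+2}` is `-γ_{n+2}`, and `γ_{n+2}` was chosen as the string
    -- integral of the remaining terms.
    have h1 : (∑ ν, fieldInt c ν (gaugeCoeff f γ ν (n + 2) a)) Φ = 0 := by
      have h2 := sum_stringInt_pd_field (isRegular_of_mem_spaceS (hγ (n + 2)) a) hΦ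
      have h3 := h (n + 1) a hΦ
      rw [Finset.sum_apply] at h2 h3 ⊢
      simp only [gaugeCoeff_succ, fieldInt_add_apply
        (fieldV_isRegular (gaugeRest_mem_fieldV hγ (n + 1)) _ a)
        ((isRegular_of_mem_spaceS (hγ (n + 2)) a).fieldPd _) hΦ]
      rw [Finset.sum_add_distrib, h2, ← h3, add_neg_cancel]
    rw [Pi.add_apply, fieldPd]
    change pd μ ((∑ ν, fieldInt c ν (gaugeCoeff f γ ν (n + 2) a)) Φ) + _ = _
    rw [h1, pd_zero, zero_add]
    rfl

end Dressed

/-! ### The divergence of the mediator field -/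

section Lagrangian

variable {ι : Type*} [Fintype ι] {f : ι → ι → ι → ℝ} {c : StringFunction}

/-- With `g` for `F`, `d` for `∂α` and `h` for `(∂F)α`: by antisymmetry the variation of `K₀` is
minus the contraction of `g` with `d`, and it cancels that part of `∂_μ U^μ`. -/
lemma sum_antisymm_contraction (s : Fin 4 → ℝ) {g : Fin 4 → Fin 4 → ι → ℝ}
    (hg : ∀ μ ν a, g μ ν a = -g ν μ a) (h d : Fin 4 → Fin 4 → ι → ℝ) :
    ∑ μ, ∑ ν, ∑ a, s μ * s ν * (h μ ν a + g μ ν a * d μ ν a) +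
      -(1 / 4) * ∑ μ, ∑ ν, ∑ a, s μ * s ν * ((d μ ν a - d ν μ a) * g μ ν a +
        g μ ν a * (d μ ν a - d ν μ a)) =
      ∑ μ, ∑ ν, ∑ a, s μ * s ν * h μ ν a := by
  have h1 : ∑ μ, ∑ ν, ∑ a, s μ * s ν * (g μ ν a * d ν μ a) =
      -∑ μ, ∑ ν, ∑ a, s μ * s ν * (g μ ν a * d μ ν a) := by
    rw [Finset.sum_comm]
    simp only [← Finset.sum_neg_distrib]
    refine Finset.sum_congr rfl fun μ _ => Finset.sum_congr rfl fun ν _ =>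
      Finset.sum_congr rfl fun a _ => ?_
    rw [hg ν μ a]
    ring
  have h2 : ∑ μ, ∑ ν, ∑ a, s μ * s ν * ((d μ ν a - d ν μ a) * g μ ν a +
        g μ ν a * (d μ ν a - d ν μ a)) = 2 * ∑ μ, ∑ ν, ∑ a, s μ * s ν * (g μ ν a * d μ ν a) -
      2 * ∑ μ, ∑ ν, ∑ a, s μ * s ν * (g μ ν a * d ν μ a) := by
    simp only [Finset.mul_sum, ← Finset.sum_sub_distrib]
    refine Finset.sum_congr rfl fun μ _ => Finset.sum_congr rfl fun ν _ =>
      Finset.sum_congr rfl fun a _ => ?_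
    ring
  rw [h2, h1]
  simp only [mul_add, Finset.sum_add_distrib]
  ring

lemma dirDeriv_fieldK0 {v : Fin 4 → ι → QField ι} (hv : IsVariation c v) {Φ : Conf ι}
    (hΦ : Φ ∈ configs ι c) (x : Spacetime) :
    dirDeriv v fieldK0 Φ x = -(1 / 4) * ∑ μ, ∑ ν, ∑ a, sgn μ * sgn ν *
      ((pd μ (v ν a Φ) x - pd ν (v μ a Φ) x) * fieldF μ ν a Φ x +
        fieldF μ ν a Φ x * (pd μ (v ν a Φ) x - pd ν (v μ a Φ) x)) := by
  have hF : ∀ μ ν (a : ι), IsRegular c (fieldF μ ν a * fieldF μ ν a) := fun μ ν a =>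
    (isRegular_fieldF μ ν a).mul (isRegular_fieldF μ ν a)
  have h3 : ∀ μ ν, IsRegular c (∑ a : ι, (sgn μ * sgn ν) • (fieldF μ ν a * fieldF μ ν a)) :=
    fun μ ν => IsRegular.sum _ fun a _ => (hF μ ν a).smul _
  have h2 : ∀ μ, IsRegular c (∑ ν, ∑ a : ι, (sgn μ * sgn ν) • (fieldF μ ν a * fieldF μ ν a)) :=
    fun μ => IsRegular.sum _ fun ν _ => h3 μ ν
  rw [fieldK0, dirDeriv_smul hv (IsRegular.sum _ fun μ _ => h2 μ) _ hΦ, Pi.smul_apply,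
    dirDeriv_sum hv _ (fun μ _ => h2 μ) hΦ, Finset.sum_apply, Pi.smul_apply, Finset.sum_apply,
    smul_eq_mul]
  congr 1
  refine Finset.sum_congr rfl fun μ _ => ?_
  rw [dirDeriv_sum hv _ (fun ν _ => h3 μ ν) hΦ, Finset.sum_apply, Finset.sum_apply]
  refine Finset.sum_congr rfl fun ν _ => ?_
  rw [dirDeriv_sum hv _ (fun a _ => (hF μ ν a).smul _) hΦ, Finset.sum_apply, Finset.sum_apply]
  refine Finset.sum_congr rfl fun a _ => ?_
  rw [dirDeriv_smul hv (hF μ ν a) _ hΦ, Pi.smul_apply, dirDeriv_mul hv (isRegular_fieldF μ ν a)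
    (isRegular_fieldF μ ν a) hΦ]
  simp only [Pi.smul_apply, Pi.add_apply, Pi.mul_apply, dirDeriv_fieldF hv μ ν a hΦ, Pi.sub_apply,
    fieldPd, smul_eq_mul]

lemma pd_wickField_mediator {α : ℕ → Fin 4 → ι → Wick f c} {n : ℕ} (hα : α n ∈ spaceV f c)
    {Φ : Conf ι} (hΦ : Φ ∈ configs ι c) (μ : Fin 4) (x : Spacetime) :
    pd μ (wickField (mediator α n μ) Φ) x = ∑ ν, ∑ a, sgn μ * sgn ν *
      (pd μ (fieldF μ ν a Φ) x * wickField (α n ν a) Φ x +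
        fieldF μ ν a Φ x * pd μ (wickField (α n ν a) Φ) x) := by
  have hF : ∀ ν a, Admissible c (fieldF μ ν a Φ) := fun ν a =>
    (isRegular_fieldF μ ν a).admissible hΦ
  have hU : ∀ ν a, Admissible c (wickField (α n ν a) Φ) := fun ν a =>
    (isRegular_wickField hα ν a).admissible hΦ
  have h1 : wickField (mediator α n μ) Φ = ∑ ν, ∑ a, (sgn μ * sgn ν) •
      (fieldF μ ν a Φ * wickField (α n ν a) Φ) := by
    simp only [mediator, map_sum, map_smul, map_mul, Finset.sum_apply]
    refine Finset.sum_congr rfl fun ν _ => Finset.sum_congr rfl fun a _ => ?_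
    rw [wickField, MvPolynomial.aeval_X]
    rfl
  have h2 : ∀ ν a, Admissible c ((sgn μ * sgn ν) • (fieldF μ ν a Φ * wickField (α n ν a) Φ)) :=
    fun ν a => ((hF ν a).mul (hU ν a)).smul _
  rw [h1, pd_sum _ fun ν _ => (Admissible.sum _ fun a _ => h2 ν a).differentiable,
    Finset.sum_apply]
  refine Finset.sum_congr rfl fun ν _ => ?_
  rw [pd_sum _ fun a _ => (h2 ν a).differentiable, Finset.sum_apply]
  refine Finset.sum_congr rfl fun a _ => ?_
  rw [pd_smul ((hF ν a).mul (hU ν a)).differentiable, pd_mul (hF ν a).differentiable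
    (hU ν a).differentiable]
  rfl

/-- The cancellation of the derivatives of `α` holds off shell. The field equations enter only at
the end, to replace `∂^μ F_{μν}` by `-∂_ν N`. -/
lemma sum_fieldPd_mediator_add_dirDeriv_fieldK0 {α : ℕ → Fin 4 → ι → Wick f c} {n : ℕ}
    (hα : α n ∈ spaceV f c) {Φ : Conf ι} (hΦ : Φ ∈ onShell ι c) :
    (∑ μ, fieldPd μ (wickField (mediator α n μ)) + dirDeriv (wickVec (α n)) fieldK0) Φ =
      (-∑ ν, ∑ a, sgn ν • (fieldPd ν (fieldN a) * wickField (α n ν a))) Φ := by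
  ext x
  have hK := dirDeriv_fieldK0 (isVariation_wickVec hα) hΦ.1 x
  have hd := sum_antisymm_contraction sgn (g := fun μ ν a => fieldF μ ν a Φ x)
    (fun μ ν a => by rw [fieldF_antisymm]; rfl)
    (fun μ ν a => pd μ (fieldF μ ν a Φ) x * wickField (α n ν a) Φ x)
    (fun μ ν a => pd μ (wickField (α n ν a) Φ) x)
  rw [Pi.add_apply, Pi.add_apply, hK, Finset.sum_apply, Finset.sum_apply]
  simp only [fieldPd, pd_wickField_mediator hα hΦ.1]
  refine hd.trans ?_
  rw [Finset.sum_comm]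
  simp only [Pi.neg_apply, Finset.sum_apply, Pi.smul_apply, Pi.mul_apply, smul_eq_mul,
    ← Finset.sum_neg_distrib]
  refine Finset.sum_congr rfl fun ν _ => ?_
  rw [Finset.sum_comm]
  refine Finset.sum_congr rfl fun a _ => ?_
  have hx := sum_pd_fieldF hΦ ν a x
  calc ∑ μ, sgn μ * sgn ν * (pd μ (fieldF μ ν a Φ) x * wickField (α n ν a) Φ x)
      = sgn ν * wickField (α n ν a) Φ x * ∑ μ, sgn μ * pd μ (fieldF μ ν a Φ) x := by
        rw [Finset.mul_sum]
        exact Finset.sum_congr rfl fun μ _ => by ring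
    _ = -(sgn ν * (pd ν (Φ.2 a) x * wickField (α n ν a) Φ x)) := by rw [hx]; ring

end Lagrangian

end StringYM

end

/-! ### Assembly of the proposition -/

theorem propositionp {𝔤 : Type*} [LieRing 𝔤] [LieAlgebra ℝ 𝔤] {ι : Type*} [Fintype ι]
    (ξ : Module.Basis ι ℝ 𝔤)
    (hξ : ∀ a b k, StringYM.strConst ξ a b k = StringYM.strConst ξ b k a)
    (c : StringYM.StringFunction) :
    ∃ (α : ℕ → Fin 4 → ι → StringYM.Wick (StringYM.strConst ξ) c)
      (γ : ℕ → ι → StringYM.QField ι),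
      -- `α ∈ g 𝒱[[g]]` and `γ ∈ g 𝒮[[g]]`
      (α 0 = 0 ∧ ∀ n, α n ∈ StringYM.spaceV (StringYM.strConst ξ) c) ∧
      (γ 0 = 0 ∧ ∀ n, γ n ∈ StringYM.spaceS (StringYM.strConst ξ) c) ∧
      -- `W = e^{iγ}` has the inverse `e^{-iγ}` and is string-localized
      (∀ (d : ℕ) (π : StringYM.HermitianRep 𝔤 d),
        StringYM.dressingFactor π ξ γ * StringYM.dressingFactor π ξ (-γ) = 1 ∧
        StringYM.dressingFactor π ξ (-γ) * StringYM.dressingFactor π ξ γ = 1 ∧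
        StringYM.StringLocalized c (StringYM.dressingFactor π ξ γ)) ∧
      ∀ τ : StringYM.Renormalization ι (StringYM.spaceS (StringYM.strConst ξ) c),
        -- `g e^{ω_U}(A_μ(c)) = W (g A_μ + i ∂_μ) W⁻¹`
        (∀ (d : ℕ) (π : StringYM.HermitianRep 𝔤 d) (μ : Fin 4),
          StringYM.MatEqOnConf (StringYM.configs ι c)
            (PowerSeries.X * StringYM.repSeries π ξ fun a =>
              StringYM.expOmega τ (StringYM.mediator α) (PowerSeries.C (StringYM.fieldAc c μ a)))
            (StringYM.dressingFactor π ξ γ *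
                (PowerSeries.X * StringYM.repSeries π ξ fun a =>
                  PowerSeries.C (StringYM.fieldA μ a)) *
                StringYM.dressingFactor π ξ (-γ) +
              Complex.I • (StringYM.dressingFactor π ξ γ *
                StringYM.matPd μ (StringYM.dressingFactor π ξ (-γ))))) ∧
        -- `e^{ω_U}(F_{μν}) = ∂_μ e^{ω_U}(A_ν(c)) - ∂_ν e^{ω_U}(A_μ(c))`
        (∀ μ ν a, StringYM.EqOnConf (StringYM.configs ι c)
          (StringYM.expOmega τ (StringYM.mediator α) (PowerSeries.C (StringYM.fieldF μ ν a)))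
          (PowerSeries.mk fun n =>
            StringYM.fieldPd μ (PowerSeries.coeff n (StringYM.expOmega τ (StringYM.mediator α)
              (PowerSeries.C (StringYM.fieldAc c ν a)))) -
            StringYM.fieldPd ν (PowerSeries.coeff n (StringYM.expOmega τ (StringYM.mediator α)
              (PowerSeries.C (StringYM.fieldAc c μ a)))))) ∧
        -- `ω_U(N) = ω_U(∂N) = 0`
        (∀ a, StringYM.EqOnConf (StringYM.configs ι c)
          (StringYM.omegaSeries τ (StringYM.mediator α)
            (PowerSeries.C (StringYM.fieldN a))) 0) ∧
        (∀ κ a, StringYM.EqOnConf (StringYM.configs ι c)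
          (StringYM.omegaSeries τ (StringYM.mediator α)
            (PowerSeries.C (StringYM.fieldPd κ (StringYM.fieldN a)))) 0) ∧
        -- `∂_μ U^μ + ω_U(K₀) = -⟨∂^ν N|α_ν⟩` by the field equations
        StringYM.EqOnConf (StringYM.onShell ι c)
          ((PowerSeries.mk fun n => ∑ μ,
              StringYM.fieldPd μ (StringYM.wickField (StringYM.mediator α n μ))) +
            StringYM.omegaSeries τ (StringYM.mediator α) (PowerSeries.C StringYM.fieldK0))
          (PowerSeries.mk fun n => -∑ ν, ∑ a, StringYM.sgn ν •
            (StringYM.fieldPd ν (StringYM.fieldN a) * StringYM.wickField (α n ν a))) := by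
  obtain ⟨γ, hγ0, hγ, hint⟩ := StringYM.exists_gauge_parameter (StringYM.strConst ξ) c
  obtain ⟨α, hα0, hα, hflow⟩ := StringYM.exists_flow_eq
    (StringYM.gaugePotential_mem_fieldV hγ) rfl
  -- The shift from `n` to `n + 1` is the factor `g⁻¹`: the gauge transform is computed with `g A_μ`
  -- and starts at order one.
  have hAc : ∀ n μ a, Set.EqOn
      (StringYM.expFlow (fun n => StringYM.wickVec (α n)) (StringYM.fieldAc c μ a) n)
      (StringYM.gaugeCoeff (StringYM.strConst ξ) γ μ (n + 1) a) (StringYM.configs ι c) :=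
    fun n μ a => (StringYM.expFlow_fieldAc hα hflow (StringYM.gaugePotential_mem_fieldV hγ)
      n μ a).trans (StringYM.fieldPd_int_gaugePotential hγ0 hγ hint n μ a)
  refine ⟨α, γ, ⟨hα0, hα⟩, ⟨hγ0, hγ⟩, fun d π => ⟨StringYM.dressingFactor_mul_neg π ξ hγ0, ?_,
    StringYM.stringLocalized_dressingFactor π ξ fun n a =>
      StringYM.isRegular_of_mem_spaceS (hγ n) a⟩, fun τ => ⟨fun d π μ n i j Φ hΦ => ?_,
    fun μ ν a n Φ hΦ => ?_, fun a n Φ _ => ?_, fun κ a n Φ _ => ?_, fun n Φ hΦ => ?_⟩⟩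
  -- The other one-sided inverse is the same identity for `-γ`.
  · have h := StringYM.dressingFactor_mul_neg π ξ (γ := -γ)
      (by rw [Pi.neg_apply, hγ0, neg_zero])
    rwa [neg_neg] at h
  · have h : (fun a => (PowerSeries.coeff n (PowerSeries.X * StringYM.expOmega τ
        (StringYM.mediator α) (PowerSeries.C (StringYM.fieldAc c μ a))) : StringYM.QField ι) Φ) =
        fun a => StringYM.gaugeCoeff (StringYM.strConst ξ) γ μ n a Φ := by
      ext1 a
      cases n with
      | zero => rw [PowerSeries.coeff_zero_X_mul, StringYM.gaugeCoeff_zero]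
      | succ n =>
        rw [PowerSeries.coeff_succ_X_mul, StringYM.coeff_expOmega_mediator τ hα, hAc n μ a hΦ]
    rw [StringYM.coeff_gaugeTransform π ξ hγ0 (fun n a =>
      ((StringYM.isRegular_of_mem_spaceS (hγ n) a).admissible hΦ).differentiable),
      StringYM.repSeries_X_mul, StringYM.coeff_repSeries_apply, h]
  · rw [PowerSeries.coeff_mk]
    simp only [StringYM.coeff_expOmega_mediator τ hα]
    have hB := StringYM.gaugePotential_mem_fieldV hγ n
    have hZ : StringYM.IsRegular c
        (∑ ρ, StringYM.fieldInt c ρ (StringYM.gaugePotential (StringYM.strConst ξ) γ n ρ a)) :=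
      StringYM.IsRegular.sum _ fun ρ _ => (StringYM.fieldV_isRegular hB ρ a).fieldInt ρ
    have hAc' := StringYM.expFlow_fieldAc hα hflow (StringYM.gaugePotential_mem_fieldV hγ) n
    -- The dressed `A_ρ(c)` differs from the deformed potential by a gradient, which drops out of
    -- the curl because partial derivatives commute.
    have hpd : ∀ κ ρ, StringYM.pd κ (StringYM.expFlow (fun n => StringYM.wickVec (α n))
        (StringYM.fieldAc c ρ a) n Φ) =
        StringYM.pd κ (StringYM.pd ρ ((∑ ρ, StringYM.fieldInt c ρ
          (StringYM.gaugePotential (StringYM.strConst ξ) γ n ρ a)) Φ)) +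
        StringYM.pd κ (StringYM.gaugePotential (StringYM.strConst ξ) γ n ρ a Φ) := by
      intro κ ρ
      rw [hAc' ρ a hΦ]
      exact StringYM.pd_add ((hZ.fieldPd ρ).admissible hΦ).differentiable
        ((StringYM.fieldV_isRegular hB ρ a).admissible hΦ).differentiable κ
    rw [StringYM.expFlow_fieldF hα hflow n μ ν a hΦ, Pi.sub_apply, Pi.sub_apply]
    simp only [StringYM.fieldPd]
    rw [hpd, hpd, StringYM.pd_pd_comm (hZ.admissible hΦ).contDiff ν μ, add_sub_add_left_eq_sub]
  · rw [StringYM.coeff_omegaSeries_mediator τ hα, StringYM.dirDeriv_fieldN]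
    rfl
  · rw [StringYM.coeff_omegaSeries_mediator τ hα, StringYM.dirDeriv_fieldPd_fieldN]
    rfl
  · rw [map_add, PowerSeries.coeff_mk, PowerSeries.coeff_mk,
      StringYM.coeff_omegaSeries_mediator τ hα]
    exact StringYM.sum_fieldPd_mediator_add_dirDeriv_fieldK0 (hα n) hΦ
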